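/- Let $N>2$, $M\ge 1$, $n\ge 1$ be integers, let $F^+$ be a totally real number field containing $\mathbb{Q}(\mu_N)^+$, and put $F=F^+(\mu_N)$, a CM field. Let $S_0^+$ be a scheme over $F^+$ and $S_0=S_0^+\times_{F^+}F$. Fix a complex conjugation $c\in\mathrm{Gal}(\overline F/F^+)$ (the element induced by complex conjugation on $\mathbb{C}$ under some embedding $\overline F\hookrightarrow\mathbb{C}$); it induces an involution of $S_0$ over $S_0^+$, and for a sheaf $\mathcal{A}$ on $S_0$ we write $\mathcal{A}^c$ for the pull-back of $\mathcal{A}$ along it. Let $\chi:\mathrm{Gal}(\overline F/F)\to(\mathbb{Z}/M\mathbb{Z})^\times$ be a continuous character, regarded also as a rank one lisse sheaf of $\mathbb{Z}/M\mathbb{Z}$-modules on $S_0$. Let $\mathcal{A}$, $\mathcal{B}$ be lisse étale sheaves of $\mathbb{Z}/M\mathbb{Z}$-modules on $S_0$, étale locally free of rank $n$, each with a given polarization of sign $+1$, that is, an isomorphism $\mathcal{A}^c\cong\mathcal{A}^\vee\otimes\chi$ (resp. $\mathcal{B}^c\cong\mathcal{B}^\vee\otimes\chi$) whose associated perfect pairing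 $\langle\cdot,\cdot\rangle:\mathcal{A}\times\mathcal{A}^c\to\chi$ is symmetric. (Symmetric means $\langle a,b\rangle=c^*\langle b,a\rangle$, where sections of $\chi$ over an $S_0$-scheme $V$ are regarded as $\chi$-equivariant locally constant functions $V\times_F\overline F\to\mathbb{Z}/M\mathbb{Z}$, and $c$ acts on $\overline F$. If $c$ lifts to an involution $c$ in $\pi_1(S_0^+)$, such a pairing is the same as a perfect symmetric bilinear form on the representation $V_{\mathcal{A}}$ of $\pi_1(S_0)$ with $\langle\sigma v,c\sigma c^{-1}w\rangle=\chi(\sigma)\langle v,w\rangle$.) Let $\eta:\wedge^n\mathcal{A}\xrightarrow{\sim}\wedge^n\mathcal{B}$ be an isomorphism compatible with the polarizations: $\eta\otimes\eta^c$ carries the pairing $(\wedge^n\mathcal{A})\otimes(\wedge^n\mathcal{A})^c\to\chi^n$ induced by the polarization of $\mathcal{A}$ to the pairing $(\wedge^n\mathcal{B})\otimes(\wedge^n\mathcal{B})^c\to\chi^n$ induced by that of $\mathcal{B}$. For an $S_0^+$-scheme $R^+$ put $R=R^+\times_{S_0^+}S_0$. Then the functor $$R^+\longmapsto\{\text{isomorphisms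 } \xi:\mathcal{A}|_R\to\mathcal{B}|_R \text{ preserving the pairings, with } \wedge^n\xi=\eta|_R\}$$ from $S_0^+$-schemes to sets is represented by an $S_0^+$-scheme, which is finite, étale and surjective over $S_0^+$. -/

import Mathlib

open CategoryTheory CategoryTheory.Limits AlgebraicGeometry Opposite

universe u

noncomputable section

namespace GaloisDescent

/-! ## Existence of associated sheaves -/

instance preservesFilteredColimits_forget (R : Type) [Ring R] :
    PreservesFilteredColimitsOfSize.{u, u} (forget (ModuleCat.{u} R)) where
  preserves_filtered_colimits J _ _ := by
    change PreservesColimitsOfShape J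
      (forget₂ (ModuleCat.{u} R) AddCommGrpCat.{u} ⋙ forget AddCommGrpCat.{u})
    infer_instance

instance hasLimits_moduleCat (R : Type) [Ring R] : HasLimits (ModuleCat.{u} R) :=
  ModuleCat.hasLimitsOfSize.{u, u, u}

instance preservesLimits_forget (R : Type) [Ring R] :
    PreservesLimits (forget (ModuleCat.{u} R)) :=
  ModuleCat.forget_preservesLimitsOfSize.{u, u, u}

/-! ## Sheaves of `ℤ/M`-modules, lisse sheaves, exterior powers -/

/-- Sheaves of `ℤ/M`-modules on the (big) étale site of `S`. The pull-back of such a sheaf along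
`f : T ⟶ S` is its restriction to the `T`-schemes, regarded as `S`-schemes through `f`. (Lisse
sheaves on the big and on the small étale site are the same: both are represented by finite
étale `S`-schemes.) -/
abbrev EtSheaf (M : ℕ) (S : Scheme.{u}) : Type (u + 2) :=
  Sheaf (Scheme.etaleTopology.over S) (ModuleCat.{u + 1} (ZMod M))

variable {M : ℕ} {S : Scheme.{u}}

/-- The module of sections of `A` over an `S`-scheme `V`. -/
abbrev sec (A : EtSheaf M S) (V : Over S) : ModuleCat.{u + 1} (ZMod M) :=
  A.obj.obj (op V)

/-- Restriction of sections along a morphism of `S`-schemes. -/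
abbrev res (A : EtSheaf M S) {V W : Over S} (f : V ⟶ W) : sec A W →ₗ[ZMod M] sec A V :=
  (A.obj.map f.op).hom

/-- The map on sections over `V` given by a morphism of sheaves. -/
abbrev secMap {A B : EtSheaf M S} (φ : A ⟶ B) (V : Over S) : sec A V →ₗ[ZMod M] sec B V :=
  (φ.hom.app (op V)).hom

/-- The continuous map underlying a morphism of schemes. -/
def toContinuousMap {X Y : Scheme.{u}} (f : X ⟶ Y) : C(X, Y) :=
  ⟨f, f.continuous⟩

/-- `A` is lisse of rank `n`: étale locally on `S` it is isomorphic to the constant sheaf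
`(ℤ/M)ⁿ`, whose sections over `T` are the locally constant functions from `T` to `(ℤ/M)ⁿ`. -/
def IsLisse (A : EtSheaf M S) (n : ℕ) : Prop :=
  ∀ x : S, ∃ U : Over S, Etale U.hom ∧ x ∈ Set.range U.hom ∧
    ∃ e : ∀ T : Over U, sec A T.left ≃ₗ[ZMod M] LocallyConstant T.left.left (Fin n → ZMod M),
      ∀ (T T' : Over U) (f : T' ⟶ T) (a : sec A T.left),
        e T' (res A f.left a) = (e T a).comap (toContinuousMap f.left.left)

/-- The `n`-th exterior power of a sheaf of `ℤ/M`-modules: the sheaf associated with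
`V ↦ ⋀ⁿ A(V)`. -/
def extPower (n : ℕ) (A : EtSheaf M S) : EtSheaf M S :=
  (presheafToSheaf (Scheme.etaleTopology.over S) (ModuleCat.{u + 1} (ZMod M))).obj
    (A.obj ⋙ ModuleCat.exteriorPower.functor (ZMod M) n)

/-- The section `a₁ ∧ ⋯ ∧ aₙ` of the exterior power. -/
def wedge {n : ℕ} (A : EtSheaf M S) (V : Over S) (a : Fin n → sec A V) : sec (extPower n A) V :=
  ((toSheafify (Scheme.etaleTopology.over S)
      (A.obj ⋙ ModuleCat.exteriorPower.functor.{u + 1} (ZMod M) n)).app (op V)).hom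
    (exteriorPower.ιMulti (ZMod M) n a)

/-! ## The sheaf of a character of the Galois group of a field -/

section Character

variable {F : Type u} [Field F]

/-- The base change to the algebraic closure of a scheme over the field `F`. -/
abbrev geom {X : Scheme.{u}} (f : X ⟶ Spec (.of F)) : Scheme.{u} :=
  pullback f (Spec.map (CommRingCat.ofHom (algebraMap F (AlgebraicClosure F))))

/-- The base change to the algebraic closure of a morphism of schemes over `F`. -/
def geomMap {X Y : Scheme.{u}} {f : X ⟶ Spec (.of F)} {g : Y ⟶ Spec (.of F)} (h : X ⟶ Y)
    (w : h ≫ g = f) : geom f ⟶ geom g :=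
  pullback.map _ _ _ _ h (𝟙 _) (𝟙 _) (by simp [w]) (by simp)

/-- The automorphism of `X ×_F F̄` induced by an element of the absolute Galois group of `F`. -/
def geomGal {X : Scheme.{u}} (f : X ⟶ Spec (.of F))
    (σ : AlgebraicClosure F ≃ₐ[F] AlgebraicClosure F) : geom f ⟶ geom f :=
  pullback.map _ _ _ _ (𝟙 _) (Spec.map (CommRingCat.ofHom (σ : AlgebraicClosure F →+* _))) (𝟙 _)
    (by simp) (by
      rw [Category.comp_id, ← Spec.map_comp, ← CommRingCat.ofHom_comp]
      congr 2
      ext x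
      simp)

/-- The sections over an `F`-scheme `X` of the rank one sheaf attached to a character `χ` of the
absolute Galois group: locally constant functions on `X ×_F F̄` which are `χ`-equivariant.
(The element `σ` acts on geometric points by the inverse of `geomGal f σ`, so that equivariance
`φ (σ x) = χ (σ) φ (x)` reads `χ (σ) φ (geomGal f σ x) = φ (x)`.) -/
def charSections (χ : (AlgebraicClosure F ≃ₐ[F] AlgebraicClosure F) →* (ZMod M)ˣ)
    {X : Scheme.{u}} (f : X ⟶ Spec (.of F)) :
    Submodule (ZMod M) (LocallyConstant (geom f) (ZMod M)) where
  carrier := {φ | ∀ σ x, (χ σ : ZMod M) * φ (toContinuousMap (geomGal f σ) x) = φ x}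
  add_mem' {φ ψ} hφ hψ σ x := by
    simp only [LocallyConstant.coe_add, Pi.add_apply, mul_add, hφ σ x, hψ σ x]
  zero_mem' σ x := by simp
  smul_mem' r φ hφ σ x := by
    simp only [LocallyConstant.coe_smul, Pi.smul_apply, smul_eq_mul]
    rw [mul_left_comm, hφ σ x]

end Character

/-! ## Complex conjugation -/

section Conj

variable (Fp F : Type u) [Field Fp] [Field F] [Algebra Fp F]

/-- A complex conjugation of the algebraic closure of `F` over `Fp`, together with the
automorphism of `F` which it induces. -/
structure ComplexConjugation where
  onClosure : AlgebraicClosure F ≃ₐ[Fp] AlgebraicClosure F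
  onBase : F ≃ₐ[Fp] F
  restricts : ∀ x : F, onClosure (algebraMap F (AlgebraicClosure F) x) =
    algebraMap F (AlgebraicClosure F) (onBase x)
  isConj : ∃ τ : AlgebraicClosure F →+* ℂ, NumberField.ComplexEmbedding.IsConj τ onClosure

variable {Fp F}

lemma ComplexConjugation.onBase_onBase (c : ComplexConjugation Fp F) (x : F) :
    c.onBase (c.onBase x) = x := by
  obtain ⟨τ, hτ⟩ := c.isConj
  apply (algebraMap F (AlgebraicClosure F)).injective
  rw [← c.restricts, ← c.restricts]
  exact NumberField.ComplexEmbedding.isConj_apply_apply hτ _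

variable (F) {Sp : Scheme.{u}} (s : Sp ⟶ Spec (.of Fp))

/-- The base change `S₀ = S₀⁺ ×_{F⁺} F` of an `F⁺`-scheme. -/
abbrev baseF : Scheme.{u} :=
  pullback s (Spec.map (CommRingCat.ofHom (algebraMap Fp F)))

/-- The projection `S₀ ⟶ S₀⁺`. -/
abbrev projPlus : baseF F s ⟶ Sp := pullback.fst _ _

/-- The structure morphism to `Spec F` of an `S₀`-scheme. -/
abbrev toF {s : Sp ⟶ Spec (.of Fp)} (V : Over (baseF F s)) : V.left ⟶ Spec (.of F) :=
  V.hom ≫ pullback.snd _ _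

variable {F} (c : ComplexConjugation Fp F)

/-- Complex conjugation on `S₀ = S₀⁺ ×_{F⁺} F`, through the second factor. -/
def conjBase : baseF F s ⟶ baseF F s :=
  pullback.map _ _ _ _ (𝟙 _) (Spec.map (CommRingCat.ofHom (c.onBase : F →+* F))) (𝟙 _)
    (by simp) (by
      rw [Category.comp_id, ← Spec.map_comp, ← CommRingCat.ofHom_comp]
      congr 2
      ext x
      simp)

@[simp]
lemma conjBase_fst : conjBase s c ≫ projPlus F s = projPlus F s :=
  (pullback.lift_fst _ _ _).trans (Category.comp_id _)

@[simp]
lemma conjBase_snd : conjBase s c ≫ pullback.snd _ _ =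
    pullback.snd _ _ ≫ Spec.map (CommRingCat.ofHom (c.onBase : F →+* F)) :=
  pullback.lift_snd _ _ _

lemma conjBase_conjBase : conjBase s c ≫ conjBase s c = 𝟙 _ := by
  apply pullback.hom_ext
  · change (conjBase s c ≫ conjBase s c) ≫ projPlus F s = 𝟙 _ ≫ projPlus F s
    simp
  · rw [Category.assoc, conjBase_snd, ← Category.assoc, conjBase_snd, Category.assoc,
      ← Spec.map_comp, ← CommRingCat.ofHom_comp]
    have : (c.onBase : F →+* F).comp (c.onBase : F →+* F) = RingHom.id F := by
      ext x
      exact c.onBase_onBase x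
    simp [this]

/-- The functor which composes the structure morphism of an `S₀`-scheme with complex conjugation
of `S₀`. The conjugate sheaf `Aᶜ` (the pull-back of `A` along complex conjugation) has sections
`Aᶜ(V) = A(conj V)`. -/
abbrev conj : Over (baseF F s) ⥤ Over (baseF F s) := Over.map (conjBase s c)

/-- The complex conjugate sheaf: the pull-back along complex conjugation of `S₀`. -/
abbrev conjSheaf (A : EtSheaf M (baseF F s)) : EtSheaf M (baseF F s) :=
  (Scheme.etaleTopology.overMapPullback _ (conjBase s c)).obj A

variable {s}

/-- Conjugating the structure morphism twice gives back the original `S₀`-scheme. -/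
def conjConj (V : Over (baseF F s)) : (conj s c).obj ((conj s c).obj V) ⟶ V :=
  Over.homMk (𝟙 _) (by simp [conjBase_conjBase])

/-- The isomorphism `V ×_F F̄ ⟶ (conj V) ×_F F̄` which is the identity on `V` and complex
conjugation on `F̄`. -/
def geomConj (V : Over (baseF F s)) : geom (toF F V) ⟶ geom (toF F ((conj s c).obj V)) :=
  pullback.map _ _ _ _ (𝟙 _)
    (Spec.map (CommRingCat.ofHom (c.onClosure : AlgebraicClosure F →+* AlgebraicClosure F)))
    (Spec.map (CommRingCat.ofHom (c.onBase : F →+* F)))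
    (by simp [toF])
    (by
      rw [← Spec.map_comp, ← Spec.map_comp, ← CommRingCat.ofHom_comp, ← CommRingCat.ofHom_comp]
      congr 2
      ext x
      simp [c.restricts])

/-! ## Polarizations -/

/-- A polarization of `A` with similitude character `χ` and sign `+1`: an isomorphism
`Aᶜ ≅ 𝓗om(A, χ) = A^∨ ⊗ χ`, given as a perfect pairing `A × Aᶜ ⟶ χ`, which is symmetric with
respect to complex conjugation. If `V_A` is the representation of the fundamental group of `S₀`
on a geometric fibre of `A`, and the complex conjugation lifts to an involution `c` in the
fundamental group of `S₀⁺`, then such a pairing is the same as a perfect symmetric bilinear form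
on `V_A` with `⟨σ v, c σ c⁻¹ w⟩ = χ (σ) ⟨v, w⟩`: the lift `c` identifies the fibres of `A` and
`Aᶜ`. -/
structure Polarization (χ : (AlgebraicClosure F ≃ₐ[F] AlgebraicClosure F) →* (ZMod M)ˣ)
    (A : EtSheaf M (baseF F s)) where
  pair (V : Over (baseF F s)) :
    sec A V →ₗ[ZMod M] sec (conjSheaf s c A) V →ₗ[ZMod M] charSections χ (toF F V)
  natural : ∀ {V W : Over (baseF F s)} (f : V ⟶ W) (a : sec A W) (b : sec (conjSheaf s c A) W),
    (pair V (res A f a) (res (conjSheaf s c A) f b) : LocallyConstant (geom (toF F V)) (ZMod M)) =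
      (pair W a b : LocallyConstant (geom (toF F W)) (ZMod M)).comap
        (toContinuousMap (geomMap f.left (by simp [toF])))
  /-- Every morphism `A|_V ⟶ χ|_V` is `⟨·, b⟩` for exactly one section `b` of `Aᶜ` over `V`. -/
  perfect : ∀ (V : Over (baseF F s))
    (φ : ∀ T : Over V, sec A T.left →ₗ[ZMod M] charSections χ (toF F T.left)),
    (∀ (T T' : Over V) (f : T' ⟶ T) (a : sec A T.left),
      (φ T' (res A f.left a) : LocallyConstant (geom (toF F T'.left)) (ZMod M)) =
        (φ T a : LocallyConstant (geom (toF F T.left)) (ZMod M)).comap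
          (toContinuousMap (geomMap f.left.left (by simp [toF])))) →
    ∃! b : sec (conjSheaf s c A) V, ∀ (T : Over V) (a : sec A T.left),
      φ T a = pair T.left a (res (conjSheaf s c A) T.hom b)
  symm : ∀ (V : Over (baseF F s)) (a : sec A V) (b : sec A ((conj s c).obj V)),
    (pair V a b : LocallyConstant (geom (toF F V)) (ZMod M)) =
      (pair ((conj s c).obj V) b (res A (conjConj c V) a) :
        LocallyConstant (geom (toF F ((conj s c).obj V))) (ZMod M)).comap
          (toContinuousMap (geomConj c V))

variable {c} {χ : (AlgebraicClosure F ≃ₐ[F] AlgebraicClosure F) →* (ZMod M)ˣ}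

/-- The matrix of pairings `⟨aᵢ, bⱼ⟩`; its determinant is the value at
`(a₁ ∧ ⋯ ∧ aₙ) ⊗ (b₁ ∧ ⋯ ∧ bₙ)` of the induced pairing `(⋀ⁿA) ⊗ (⋀ⁿA)ᶜ ⟶ χⁿ`. -/
def Polarization.matrix {A : EtSheaf M (baseF F s)} (P : Polarization c χ A) {n : ℕ}
    (V : Over (baseF F s)) (a : Fin n → sec A V) (b : Fin n → sec A ((conj s c).obj V)) :
    Matrix (Fin n) (Fin n) (LocallyConstant (geom (toF F V)) (ZMod M)) :=
  Matrix.of fun i j => (P.pair V (a i) (b j) : LocallyConstant (geom (toF F V)) (ZMod M))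

/-- The isomorphism `η` of exterior powers is compatible with the polarizations: it carries the
pairing `(⋀ⁿA) ⊗ (⋀ⁿA)ᶜ ⟶ χⁿ` induced by the polarization of `A` to the one induced by the
polarization of `B`. (If `0 < n`, every section of the `n`-th exterior power of a lisse sheaf of
rank `n` is étale locally of the form `a₁ ∧ ⋯ ∧ aₙ`.) -/
def CompatibleDet {A B : EtSheaf M (baseF F s)} (P : Polarization c χ A) (Q : Polarization c χ B)
    {n : ℕ} (η : extPower n A ≅ extPower n B) : Prop :=
  ∀ (V : Over (baseF F s)) (a : Fin n → sec A V) (b : Fin n → sec A ((conj s c).obj V))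
    (a' : Fin n → sec B V) (b' : Fin n → sec B ((conj s c).obj V)),
    secMap η.hom V (wedge A V a) = wedge B V a' →
    secMap η.hom ((conj s c).obj V) (wedge A ((conj s c).obj V) b) =
      wedge B ((conj s c).obj V) b' →
    (Q.matrix V a' b').det = (P.matrix V a b).det

/-! ## The functor of isomorphisms -/

/-- The base change `R = R⁺ ×_{S₀⁺} S₀` of an `S₀⁺`-scheme, as an `S₀`-scheme. -/
abbrev baseChange : Over Sp ⥤ Over (baseF F s) := Over.pullback (projPlus F s)

variable (c) in
/-- Complex conjugation on `R = R⁺ ×_{S₀⁺} S₀`, through the second factor; it lies over complex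
conjugation of `S₀`. -/
def conjR (Rp : Over Sp) : (conj s c).obj (baseChange.obj Rp) ⟶ baseChange.obj Rp :=
  Over.homMk (pullback.lift (pullback.fst _ _) (pullback.snd _ _ ≫ conjBase s c)
    (by simp [pullback.condition])) (pullback.lift_snd _ _ _)

variable (c) in
lemma conjR_naturality {Rp Rp' : Over Sp} (g : Rp' ⟶ Rp) :
    (conj s c).map (baseChange.map g) ≫ conjR c Rp = conjR c Rp' ≫ baseChange.map g := by
  ext
  apply pullback.hom_ext
  · simp only [conjR, Over.comp_left, Over.map_map_left, Over.homMk_left, Over.pullback_map_left,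
      Category.assoc]
    erw [pullback.lift_fst, pullback.lift_fst, pullback.lift_fst_assoc]
  · simp only [conjR, Over.comp_left, Over.map_map_left, Over.homMk_left, Over.pullback_map_left,
      Category.assoc]
    erw [pullback.lift_snd, pullback.lift_snd, pullback.lift_snd_assoc, pullback.lift_snd]

variable (c) in
/-- The conjugate of a scheme over `R = R⁺ ×_{S₀⁺} S₀`. -/
abbrev conjOver {Rp : Over Sp} (T : Over (baseChange (F := F) (s := s).obj Rp)) :
    Over (baseChange (F := F) (s := s).obj Rp) :=
  Over.mk ((conj s c).map T.hom ≫ conjR c Rp)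

/-- The restriction `A|_R` of a sheaf `A` to the schemes over an `S₀`-scheme `R`. -/
abbrev restrict (A : EtSheaf M S) (R : Over S) : (Over R)ᵒᵖ ⥤ ModuleCat.{u + 1} (ZMod M) :=
  (Over.forget R).op ⋙ A.obj

/-- The map on sections over an `R`-scheme `T` given by a morphism `A|_R ⟶ B|_R`. -/
abbrev restrictMap {A B : EtSheaf M S} {R : Over S} (ξ : restrict A R ⟶ restrict B R)
    (T : Over R) : sec A T.left →ₗ[ZMod M] sec B T.left :=
  (ξ.app (op T)).hom

lemma restrictMap_mk_congr {A B : EtSheaf M S} {R : Over S} (ξ : restrict A R ⟶ restrict B R)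
    {T : Over S} {f g : T ⟶ R} (h : f = g) (a : sec A T) :
    restrictMap ξ (Over.mk f) a = restrictMap ξ (Over.mk g) a := by
  subst h
  rfl

/-- The isomorphisms `ξ : A|_R ≅ B|_R`, where `R = R⁺ ×_{S₀⁺} S₀`, which preserve the
pairings and satisfy `⋀ⁿ ξ = η|_R`. -/
@[ext]
structure PolarizedIso {A B : EtSheaf M (baseF F s)} (P : Polarization c χ A)
    (Q : Polarization c χ B) {n : ℕ} (η : extPower n A ≅ extPower n B) (Rp : Over Sp) where
  iso : restrict A (baseChange.obj Rp) ≅ restrict B (baseChange.obj Rp)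
  pair_eq : ∀ (T : Over (baseChange.obj Rp)) (a : sec A T.left)
    (b : sec A ((conj s c).obj T.left)),
    Q.pair T.left (restrictMap iso.hom T a) (restrictMap iso.hom (conjOver c T) b) =
      P.pair T.left a b
  wedge_eq : ∀ (T : Over (baseChange.obj Rp)) (a : Fin n → sec A T.left),
    wedge B T.left (fun i => restrictMap iso.hom T (a i)) = secMap η.hom T.left (wedge A T.left a)

/-- The restriction of a polarized isomorphism along a morphism of `S₀⁺`-schemes. -/
def PolarizedIso.pull {A B : EtSheaf M (baseF F s)} {P : Polarization c χ A}
    {Q : Polarization c χ B} {n : ℕ} {η : extPower n A ≅ extPower n B} {Rp Rp' : Over Sp}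
    (g : Rp' ⟶ Rp) (ξ : PolarizedIso P Q η Rp) : PolarizedIso P Q η Rp' where
  iso := Functor.isoWhiskerLeft (Over.map (baseChange.map g)).op ξ.iso
  pair_eq T a b := by
    have h := ξ.pair_eq ((Over.map (baseChange.map g)).obj T) a b
    have e : (conj s c).map (T.hom ≫ baseChange.map g) ≫ conjR c Rp =
        ((conj s c).map T.hom ≫ conjR c Rp') ≫ baseChange.map g := by
      rw [Functor.map_comp, Category.assoc, Category.assoc, conjR_naturality]
    have h' := restrictMap_mk_congr ξ.iso.hom e b
    exact (congrArg _ h'.symm).trans h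
  wedge_eq T a := ξ.wedge_eq ((Over.map (baseChange.map g)).obj T) a

/-- The functor which sends an `S₀⁺`-scheme `R⁺` to the set of isomorphisms between the pull-backs
of `A` and `B` to `R = R⁺ ×_{S₀⁺} S₀` which preserve the pairings and lift `η`. -/
def isomFunctor {A B : EtSheaf M (baseF F s)} (P : Polarization c χ A)
    (Q : Polarization c χ B) {n : ℕ} (η : extPower n A ≅ extPower n B) :
    (Over Sp)ᵒᵖ ⥤ Type (u + 1) where
  obj Rp := PolarizedIso P Q η Rp.unop
  map g := ↾(PolarizedIso.pull g.unop)
  map_id Rp := by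
    ext ξ T a
    exact restrictMap_mk_congr ξ.iso.hom (f := T.unop.hom ≫ baseChange.map (𝟙 Rp.unop))
      (g := T.unop.hom) (by rw [CategoryTheory.Functor.map_id, Category.comp_id]) a
  map_comp {Rp Rp' Rp''} f g := by
    ext ξ T a
    exact restrictMap_mk_congr ξ.iso.hom
      (f := T.unop.hom ≫ baseChange.map (g.unop ≫ f.unop))
      (g := (T.unop.hom ≫ baseChange.map g.unop) ≫ baseChange.map f.unop)
      (by rw [Functor.map_comp, Category.assoc]) a

end Conj

end GaloisDescent

end

open GaloisDescent

universe w

namespace GaloisDescent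

/-! ### Gluing of sections and relative representability on the étale site. -/

section EtaleSheaves

variable {S : Scheme.{u}}

/-! The functor is shown to be an étale sheaf on `S₀⁺` (`isSheaf_isomFunctor`) which is étale
locally constant with finite nonempty value (`exists_isConstantOn`); every such sheaf of sets is
representable by a finite étale surjective scheme (`exists_representableBy_of_isConstantOn`).

Representability is descent. A constant sheaf over `Spec T` with value `G` is represented by `Spec
(G → T)`. If the sheaf already lives over `Spec R`, with `Spec T ⟶ Spec R` étale surjective, the
universal property turns this algebra into a comodule, and its coinvariants represent the sheaf over
`Spec R` (`isPushout_equalizer_of_coaction`, `RepresentsOver.descend`). The resulting affine pieces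
are glued in the Zariski topology.

Local constancy is the arithmetic part. The field `F = F⁺(ζ)` is quadratic over `F⁺`: `ζ + ζ⁻¹` lies
in `F⁺`, and `c` sends `ζ` to `ζ⁻¹`, which differs from `ζ` because `N > 2`. Hence, if `R⁺ ⟶ S₀⁺`
lifts to `h : R⁺ ⟶ S₀`, then `R` is the disjoint union of two copies of `R⁺`, the graphs of `h` and
of its conjugate, and complex conjugation exchanges them (`mem_range_sheetι`,
`isEmpty_of_comp_conjBase`, `conj_map_sheetι`). An isomorphism over `R` is therefore a pair `(ξ₁,
ξ₂)`, one on each sheet. Preservation of the pairing on the first sheet says that `ξ₂` is the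
inverse adjoint of `ξ₁`; on the second sheet it says the same, by the symmetry of the polarizations.

Étale locally `χ` has a section `q` without zeros, and `A` and `B` have frames on one sheet with
dual frames, up to `q`, on the other. In these frames `η` is a unit `r` on the first sheet, and its
compatibility with the polarizations makes it `r⁻¹` on the second (`IsDual.mul_eq_one`). So `ξ₁` is
locally a matrix of determinant `r`, `ξ₂` is its inverse transpose, and the condition on exterior
powers holds on the second sheet as soon as it holds on the first. The value of the functor is the
set of matrices over `ℤ/M` of determinant `r`, which is finite, and nonempty since `0 < n`. -/

lemma mem_over_of_forall {T : Over S} (R : Sieve T)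
    (h : ∀ t : T.left, ∃ (W : Over S) (i : W ⟶ T),
      Etale i.left ∧ t ∈ Set.range i.left ∧ R i) :
    R ∈ Scheme.etaleTopology.over S T := by
  choose W i hi ht hR using h
  rw [GrothendieckTopology.mem_over_iff]
  have hm : Presieve.ofArrows (fun t => (W t).left) (fun t => (i t).left) ∈
      Scheme.etalePrecoverage T.left :=
    (Scheme.ofArrows_mem_precoverage_iff (P := @Etale)).2 ⟨fun x => ⟨x, ht x⟩, hi⟩
  refine GrothendieckTopology.superset_covering _ ?_
    (Precoverage.generate_mem_toGrothendieck hm)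
  rw [Sieve.generate_le_iff]
  rintro _ _ ⟨t⟩
  rw [Sieve.overEquiv_iff]
  convert! R.downward_closed (hR t)
    (Over.homMk (𝟙 _) (by simp) : Over.mk ((i t).left ≫ T.hom) ⟶ W t) using 1

lemma exists_of_mem_over {T : Over S} {R : Sieve T} (hR : R ∈ Scheme.etaleTopology.over S T)
    (t : T.left) :
    ∃ (W : Over S) (i : W ⟶ T), Etale i.left ∧ t ∈ Set.range i.left ∧ R i := by
  rw [GrothendieckTopology.mem_over_iff] at hR
  obtain ⟨𝒰, h𝒰⟩ := (Scheme.mem_grothendieckTopology_iff (P := @Etale)).1 hR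
  obtain ⟨j, y, hy⟩ := ((Scheme.ofArrows_mem_precoverage_iff (P := @Etale)).1 𝒰.mem₀).1 t
  have := h𝒰 _ _ (Presieve.ofArrows.mk j)
  exact ⟨_, _, 𝒰.map_prop j, ⟨y, hy⟩, (Sieve.overEquiv_iff _ _).1 this⟩

variable {Φ : (Over S)ᵒᵖ ⥤ Type w}

lemma sheaf_ext (hΦ : Presieve.IsSheaf (Scheme.etaleTopology.over S) Φ) {T : Over S}
    {a b : Φ.obj (op T)}
    (h : ∀ t : T.left, ∃ (W : Over S) (i : W ⟶ T),
      Etale i.left ∧ t ∈ Set.range i.left ∧ Φ.map i.op a = Φ.map i.op b) : a = b := by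
  let R : Sieve T :=
    { arrows := fun W i => Φ.map i.op a = Φ.map i.op b
      downward_closed := fun {W W' i} hi j => by
        simp only [op_comp, Functor.map_comp_apply]
        rw [hi] }
  exact (hΦ R (mem_over_of_forall R h)).isSeparatedFor.ext fun W i hi => hi

/-- The predicate `Q` picks at most one section over each `T`-scheme and is stable under
restriction. The chosen local sections are then compatible: on a common refinement both restrictions
satisfy `Q`. -/
lemma sheaf_glue (hΦ : Presieve.IsSheaf (Scheme.etaleTopology.over S) Φ) {T : Over S}
    (Q : ∀ {W : Over S}, (W ⟶ T) → Φ.obj (op W) → Prop)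
    (huniq : ∀ {W : Over S} (i : W ⟶ T) (a b : Φ.obj (op W)), Q i a → Q i b → a = b)
    (hres : ∀ {W W' : Over S} (i : W ⟶ T) (j : W' ⟶ W) (a : Φ.obj (op W)), Q i a →
      Q (j ≫ i) (Φ.map j.op a))
    (hex : ∀ t : T.left, ∃ (W : Over S) (i : W ⟶ T),
      Etale i.left ∧ t ∈ Set.range i.left ∧ ∃ a, Q i a) :
    ∃ a : Φ.obj (op T), ∀ {W : Over S} (i : W ⟶ T) (b : Φ.obj (op W)), Q i b →
      Φ.map i.op a = b := by
  let R : Sieve T :=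
    { arrows := fun W i => ∃ a, Q i a
      downward_closed := fun {W W' i} hi j => ⟨_, hres i j _ hi.choose_spec⟩ }
  let x : Presieve.FamilyOfElements Φ R.arrows := fun W i hi => Exists.choose hi
  have hx : x.Compatible := by
    intro W₁ W₂ Z g₁ g₂ f₁ f₂ h₁ h₂ e
    have q₁ := hres f₁ g₁ _ (Exists.choose_spec h₁)
    have q₂ := hres f₂ g₂ _ (Exists.choose_spec h₂)
    exact huniq _ _ _ q₁ (by rw [e]; exact q₂)
  obtain ⟨a, ha, -⟩ := hΦ R (mem_over_of_forall R hex) x hx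
  exact ⟨a, fun i b hb => (ha i ⟨b, hb⟩).trans
    (huniq i _ _ (Exists.choose_spec (⟨b, hb⟩ : ∃ a, Q i a)) hb)⟩

/-- Étale coverings are in particular flat and locally of finite presentation, and the fpqc topology
is subcanonical. -/
instance subcanonical_etaleTopology : Scheme.etaleTopology.{u}.Subcanonical := by
  refine .of_le (le_trans ?_ Scheme.fppfTopology_le_fpqcTopology)
  refine Precoverage.toGrothendieck_mono (Scheme.precoverage_mono fun X Y f hf => ?_)
  have : Etale f := hf
  exact ⟨inferInstance, inferInstance⟩

lemma isSheaf_yoneda_over (X : Over S) :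
    Presieve.IsSheaf (Scheme.etaleTopology.over S) (yoneda.obj X) :=
  GrothendieckTopology.Subcanonical.isSheaf_of_isRepresentable _

lemma over_hom_ext {T X : Over S} {a b : T ⟶ X}
    (h : ∀ t : T.left, ∃ (W : Over S) (i : W ⟶ T),
      Etale i.left ∧ t ∈ Set.range i.left ∧ i ≫ a = i ≫ b) : a = b :=
  sheaf_ext (isSheaf_yoneda_over X) h

/-- `X ⟶ U`, together with the section `x` of `Φ` over `X`, represents the restriction of `Φ`
to the schemes over `U`. -/
def RepresentsOver (Φ : (Over S)ᵒᵖ ⥤ Type w) {X U : Over S} (π : X ⟶ U)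
    (x : Φ.obj (op X)) : Prop :=
  ∀ (T : Over S) (f : T ⟶ U) (a : Φ.obj (op T)), ∃! h : T ⟶ X, h ≫ π = f ∧ Φ.map h.op x = a

lemma RepresentsOver.hom_ext {X U : Over S} {π : X ⟶ U} {x : Φ.obj (op X)}
    (hx : RepresentsOver Φ π x) {T : Over S} {h h' : T ⟶ X} (e : h ≫ π = h' ≫ π)
    (e' : Φ.map h.op x = Φ.map h'.op x) : h = h' :=
  (hx T (h' ≫ π) (Φ.map h'.op x)).unique ⟨e, e'⟩ ⟨rfl, rfl⟩

lemma RepresentsOver.pullback {X U X' U' : Over S} {π : X ⟶ U} {x : Φ.obj (op X)}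
    (hx : RepresentsOver Φ π x) {r : X' ⟶ X} {π' : X' ⟶ U'} {g : U' ⟶ U}
    (hp : IsPullback r π' π g) : RepresentsOver Φ π' (Φ.map r.op x) := by
  intro T f a
  obtain ⟨h, ⟨h₁, h₂⟩, -⟩ := hx T (f ≫ g) a
  refine ⟨hp.lift h f h₁, ⟨hp.lift_snd _ _ _, ?_⟩, ?_⟩
  · rw [← Functor.map_comp_apply, ← op_comp, hp.lift_fst, h₂]
  · rintro k ⟨k₁, k₂⟩
    apply hp.hom_ext
    · rw [hp.lift_fst]
      refine hx.hom_ext ?_ ?_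
      · rw [h₁, Category.assoc, hp.w, reassoc_of% k₁]
      · rw [h₂, op_comp, Functor.map_comp_apply, k₂]
    · rw [hp.lift_snd, k₁]

/-- Representability is étale local on the base, once the representing object is given. -/
lemma RepresentsOver.of_local (hΦ : Presieve.IsSheaf (Scheme.etaleTopology.over S) Φ)
    {X₀ V : Over S} (π₀ : X₀ ⟶ V) (x₀ : Φ.obj (op X₀))
    (h : ∀ v : V.left, ∃ (U X : Over S) (f : U ⟶ V) (π : X ⟶ U) (r : X ⟶ X₀),
      Etale f.left ∧ v ∈ Set.range f.left ∧ IsPullback r π π₀ f ∧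
        RepresentsOver Φ π (Φ.map r.op x₀)) :
    RepresentsOver Φ π₀ x₀ := by
  -- Every point of a `V`-scheme `T` has an étale neighbourhood mapping to one of the given charts:
  -- the fibre product of `T` with the chart.
  have cov (T : Over S) (f : T ⟶ V) (t : T.left) : ∃ (U X : Over S) (g : U ⟶ V) (π : X ⟶ U)
      (r : X ⟶ X₀) (W : Over S) (i : W ⟶ T) (k : W ⟶ U), IsPullback r π π₀ g ∧
        RepresentsOver Φ π (Φ.map r.op x₀) ∧
        Etale i.left ∧ t ∈ Set.range i.left ∧ k ≫ g = i ≫ f := by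
    obtain ⟨U, X, g, π, r, hg, hv, hp, hr⟩ := h (f.left t)
    obtain ⟨y, hy⟩ := hv
    refine ⟨U, X, g, π, r, Over.mk (pullback.fst f.left g.left ≫ T.hom),
      Over.homMk (pullback.fst _ _) rfl, Over.homMk (pullback.snd _ _) ?_, hp, hr, ?_, ?_, ?_⟩
    · simp [← Over.w g, ← Over.w f, pullback.condition_assoc, -Over.w]
    · exact inferInstanceAs (Etale (pullback.fst f.left g.left))
    · obtain ⟨z, hz, -⟩ := Scheme.Pullback.exists_preimage_pullback t y hy.symm
      exact ⟨z, hz⟩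
    · ext; exact pullback.condition.symm
  have uniq (T : Over S) (h h' : T ⟶ X₀) (e : h ≫ π₀ = h' ≫ π₀)
      (e' : Φ.map h.op x₀ = Φ.map h'.op x₀) : h = h' := by
    refine over_hom_ext fun t => ?_
    obtain ⟨U, X, g, π, r, W, i, k, hp, hr, hi, ht, hk⟩ := cov T (h ≫ π₀) t
    refine ⟨W, i, hi, ht, ?_⟩
    have w₁ : (i ≫ h) ≫ π₀ = k ≫ g := by rw [hk, Category.assoc]
    have w₂ : (i ≫ h') ≫ π₀ = k ≫ g := by rw [hk, Category.assoc, e]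
    have : hp.lift _ _ w₁ = hp.lift _ _ w₂ := by
      refine hr.hom_ext (by simp) ?_
      rw [← Functor.map_comp_apply, ← Functor.map_comp_apply, ← op_comp, ← op_comp, hp.lift_fst,
        hp.lift_fst, op_comp, op_comp, Functor.map_comp_apply, Functor.map_comp_apply, e']
    rw [← hp.lift_fst _ _ w₁, this, hp.lift_fst]
  intro T f a
  obtain ⟨b, hb⟩ := sheaf_glue (isSheaf_yoneda_over X₀) (T := T)
    (fun {W} i (b : W ⟶ X₀) => b ≫ π₀ = i ≫ f ∧ Φ.map b.op x₀ = Φ.map i.op a)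
    (fun i b b' h h' => uniq _ _ _ (h.1.trans h'.1.symm) (h.2.trans h'.2.symm))
    (fun i j b hb => by
      refine ⟨?_, ?_⟩
      · change (j ≫ b) ≫ π₀ = _
        rw [Category.assoc, Category.assoc, hb.1]
      · change Φ.map (j ≫ b).op x₀ = _
        rw [op_comp, op_comp, Functor.map_comp_apply, Functor.map_comp_apply, hb.2])
    (fun t => by
      obtain ⟨U, X, g, π, r, W, i, k, hp, hr, hi, ht, hk⟩ := cov T f t
      obtain ⟨l, ⟨l₁, l₂⟩, -⟩ := hr W k (Φ.map i.op a)
      refine ⟨W, i, hi, ht, l ≫ r, ?_, ?_⟩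
      · rw [Category.assoc, hp.w, reassoc_of% l₁, hk]
      · rw [op_comp, Functor.map_comp_apply, l₂])
  have hloc (t : T.left) : ∃ (W : Over S) (i : W ⟶ T), Etale i.left ∧ t ∈ Set.range i.left ∧
      (i ≫ b) ≫ π₀ = i ≫ f ∧ Φ.map (i ≫ b).op x₀ = Φ.map i.op a := by
    obtain ⟨U, X, g, π, r, W, i, k, hp, hr, hi, ht, hk⟩ := cov T f t
    obtain ⟨l, ⟨l₁, l₂⟩, -⟩ := hr W k (Φ.map i.op a)
    have hl : (l ≫ r) ≫ π₀ = i ≫ f ∧ Φ.map (l ≫ r).op x₀ = Φ.map i.op a := by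
      refine ⟨?_, ?_⟩
      · rw [Category.assoc, hp.w, reassoc_of% l₁, hk]
      · rw [op_comp, Functor.map_comp_apply, l₂]
    have : i ≫ b = l ≫ r := hb i (l ≫ r) hl
    exact ⟨W, i, hi, ht, by rwa [this]⟩
  refine ⟨b, ⟨?_, ?_⟩, fun b' hb' => ?_⟩
  · refine over_hom_ext fun t => ?_
    obtain ⟨W, i, hi, ht, h₁, -⟩ := hloc t
    exact ⟨W, i, hi, ht, by rw [← Category.assoc, h₁]⟩
  · refine sheaf_ext hΦ fun t => ?_
    obtain ⟨W, i, hi, ht, -, h₂⟩ := hloc t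
    exact ⟨W, i, hi, ht, by rw [← h₂, op_comp, Functor.map_comp_apply]⟩
  · refine over_hom_ext fun t => ?_
    obtain ⟨W, i, hi, ht, -, -⟩ := hloc t
    refine ⟨W, i, hi, ht, (hb i (i ≫ b') ⟨?_, ?_⟩).symm⟩
    · rw [Category.assoc, hb'.1]
    · rw [op_comp, Functor.map_comp_apply, hb'.2]

end EtaleSheaves

/-! ### Faithfully flat descent of algebras by coinvariants. -/

section Comodule

open TensorProduct

variable {R T B : Type*} [CommRing R] [CommRing T] [CommRing B] [Algebra R T] [Algebra R B]
  [Algebra T B] [IsScalarTower R T B]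

/-- Descent of an algebra with a coaction along a flat ring map: the algebra is the base change
of its subalgebra of coinvariants. -/
lemma isPushout_equalizer_of_coaction [Module.Flat R T] (ρ : B →ₐ[R] T ⊗[R] B)
    (hρ : ∀ t : T, ρ (algebraMap T B t) = t ⊗ₜ 1)
    (hcounit : ∀ b, Algebra.TensorProduct.lift (Algebra.ofId T B) (AlgHom.id R B)
      (fun _ _ => Commute.all _ _) (ρ b) = b)
    (hcoassoc : ∀ b, Algebra.TensorProduct.map (AlgHom.id T T) ρ (ρ b) =
      Algebra.TensorProduct.map (AlgHom.id T T)
        (Algebra.TensorProduct.includeRight : B →ₐ[R] T ⊗[R] B) (ρ b)) :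
    Algebra.IsPushout R T
      (AlgHom.equalizer ρ (Algebra.TensorProduct.includeRight : B →ₐ[R] T ⊗[R] B)) B := by
  set ι : B →ₐ[R] T ⊗[R] B := Algebra.TensorProduct.includeRight with hι
  set E := AlgHom.equalizer ρ ι with hE
  set μ : T ⊗[R] B →ₐ[T] B := Algebra.TensorProduct.lift (Algebra.ofId T B) (AlgHom.id R B)
      (fun _ _ => Commute.all _ _) with hμ
  let m : T ⊗[R] (T ⊗[R] B) →ₐ[T] T ⊗[R] B :=
    Algebra.TensorProduct.lift (Algebra.ofId T _) (AlgHom.id R _) (fun _ _ => Commute.all _ _)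
  -- With `m` the multiplication of the two copies of `T`, the composite `ρ ∘ μ` is `m ∘ (id ⊗ ρ)`,
  -- while `m ∘ (id ⊗ ι)` is the identity. On the equalizer of `id ⊗ ρ` and `id ⊗ ι` this gives `ρ ∘
  -- μ = id`.
  have key (y : T ⊗[R] B) : ρ (μ y) = m (Algebra.TensorProduct.map (AlgHom.id T T) ρ y) := by
    induction y with
    | zero => simp
    | tmul t b => simp [μ, m, Algebra.ofId_apply, hρ, Algebra.TensorProduct.algebraMap_apply]
    | add x y hx hy => simp only [map_add, hx, hy]
  have key' (y : T ⊗[R] B) : m (Algebra.TensorProduct.map (AlgHom.id T T) ι y) = y := by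
    induction y with
    | zero => simp
    | tmul t b => simp [ι, m, Algebra.ofId_apply, Algebra.TensorProduct.algebraMap_apply]
    | add x y hx hy => simp only [map_add, hx, hy]
  let e := AlgHom.tensorEqualizerEquiv T T ρ ι
  -- By flatness this equalizer is `T ⊗ E`. The map `μ` identifies it with `B`, with inverse `ρ`:
  -- coassociativity says that `ρ b` lies in the equalizer, the counit law that `μ (ρ b) = b`.
  let f : AlgHom.equalizer (Algebra.TensorProduct.map (AlgHom.id T T) ρ)
      (Algebra.TensorProduct.map (AlgHom.id T T) ι) ≃ₗ[T] B :=
    LinearEquiv.ofBijective (μ.toLinearMap ∘ₗ (Subalgebra.val _).toLinearMap) (by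
      refine ⟨fun x y hxy => ?_, fun b => ⟨⟨ρ b, hcoassoc b⟩, hcounit b⟩⟩
      have h : μ x.1 = μ y.1 := hxy
      apply Subtype.ext
      have hx : Algebra.TensorProduct.map (AlgHom.id T T) ρ x.1 =
        Algebra.TensorProduct.map (AlgHom.id T T) ι x.1 := x.2
      have hy : Algebra.TensorProduct.map (AlgHom.id T T) ρ y.1 =
        Algebra.TensorProduct.map (AlgHom.id T T) ι y.1 := y.2
      rw [← key' x.1, ← hx, ← key, h, key, hy, key'])
  exact ⟨IsBaseChange.of_equiv (e.toLinearEquiv.trans f) fun x => by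
    change μ ((1 : T) ⊗ₜ[R] (x : B)) = x
    simp [μ]⟩

end Comodule

/-! ### Descent of representing objects between affine schemes. -/

section AffineDescent

open TensorProduct

variable {S : Scheme.{u}} {R : Type u} [CommRing R] (j : Spec (.of R) ⟶ S)

/-- The spectrum of an `R`-algebra, as an `S`-scheme via `j : Spec R ⟶ S`. -/
noncomputable abbrev specOver (C : Type u) [CommRing C] [Algebra R C] : Over S :=
  Over.mk (Spec.map (CommRingCat.ofHom (algebraMap R C)) ≫ j)

/-- The morphism of spectra induced by a homomorphism of `R`-algebras. -/
noncomputable def specOverMap {C D : Type u} [CommRing C] [Algebra R C] [CommRing D] [Algebra R D]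
    (φ : C →ₐ[R] D) : specOver j D ⟶ specOver j C :=
  Over.homMk (Spec.map (CommRingCat.ofHom φ.toRingHom)) (by
    dsimp
    rw [← Spec.map_comp_assoc, ← CommRingCat.ofHom_comp]
    congr 3
    exact φ.comp_algebraMap)

variable {C D E : Type u} [CommRing C] [Algebra R C] [CommRing D] [Algebra R D]
  [CommRing E] [Algebra R E]

@[simp]
lemma specOverMap_left (φ : C →ₐ[R] D) :
    (specOverMap j φ).left = Spec.map (CommRingCat.ofHom φ.toRingHom) := rfl

lemma specOverMap_comp (φ : C →ₐ[R] D) (ψ : D →ₐ[R] E) :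
    specOverMap j ψ ≫ specOverMap j φ = specOverMap j (ψ.comp φ) := by
  ext1
  rw [Over.comp_left, specOverMap_left, specOverMap_left, specOverMap_left, ← Spec.map_comp]
  rfl

@[simp]
lemma specOverMap_id : specOverMap j (AlgHom.id R C) = 𝟙 _ := by
  ext1
  exact Spec.map_id _

lemma specOverMap_injective {φ ψ : C →ₐ[R] D} (h : specOverMap j φ = specOverMap j ψ) :
    φ = ψ := by
  have h' := congrArg (fun f => f.left) h
  have := congrArg (fun f => f.hom) (Spec.map_injective h')
  ext x
  exact congrArg (fun f : C →+* D => f x) this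

lemma exists_eq_specOverMap (f : specOver j D ⟶ specOver j C)
    (hf : f ≫ specOverMap j (Algebra.ofId R C) = specOverMap j (Algebra.ofId R D)) :
    ∃ φ : C →ₐ[R] D, f = specOverMap j φ := by
  have h := congrArg (fun f => f.left) hf
  obtain ⟨φ, hφ⟩ := Spec.map_surjective f.left
  simp only [Over.comp_left, ← hφ, specOverMap_left, ← Spec.map_comp] at h
  have h' := congrArg (fun f => f.hom) (Spec.map_injective h)
  refine ⟨{ φ.hom with commutes' := fun r => congrArg (fun f : R →+* D => f r) h' }, ?_⟩
  ext1
  exact hφ.symm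

lemma isPullback_specOverMap {C D E P : Type u} [CommRing C] [Algebra R C] [CommRing D]
    [Algebra R D] [CommRing E] [Algebra R E] [CommRing P] [Algebra R P] [Algebra C D]
    [Algebra C E] [Algebra D P] [Algebra E P] [Algebra C P]
    [IsScalarTower R C D] [IsScalarTower R C E] [IsScalarTower R D P] [IsScalarTower R E P]
    [IsScalarTower C D P] [IsScalarTower C E P] [Algebra.IsPushout C D E P] :
    IsPullback (specOverMap j (IsScalarTower.toAlgHom R D P))
      (specOverMap j (IsScalarTower.toAlgHom R E P))
      (specOverMap j (IsScalarTower.toAlgHom R C D))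
      (specOverMap j (IsScalarTower.toAlgHom R C E)) := by
  have h := isPullback_SpecMap_of_isPushout _ _ _ _
    (CommRingCat.isPushout_of_isPushout C D E P)
  refine IsPullback.of_map (Over.forget S) ?_ h
  ext1
  exact h.w

variable {Φ : (Over S)ᵒᵖ ⥤ Type w}

lemma map_specOverMap_comp (φ : C →ₐ[R] D) (ψ : D →ₐ[R] E) (x : Φ.obj (op (specOver j C))) :
    Φ.map (specOverMap j ψ).op (Φ.map (specOverMap j φ).op x) =
      Φ.map (specOverMap j (ψ.comp φ)).op x := by
  rw [← specOverMap_comp, op_comp, Functor.map_comp_apply]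

variable {T B : Type u} [CommRing T] [Algebra R T] [CommRing B] [Algebra R B] [Algebra T B]
  [IsScalarTower R T B]

/-- The coaction on a `T`-algebra representing `Φ` over `Spec T`, where `Φ` is defined over
`Spec R`. -/
lemma RepresentsOver.exists_coaction {x : Φ.obj (op (specOver j B))}
    (hx : RepresentsOver Φ (specOverMap j (IsScalarTower.toAlgHom R T B)) x) :
    ∃ ρ : B →ₐ[R] T ⊗[R] B,
      Φ.map (specOverMap j ρ).op x =
        Φ.map (specOverMap j (Algebra.TensorProduct.includeRight : B →ₐ[R] T ⊗[R] B)).op x ∧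
      (∀ t : T, ρ (algebraMap T B t) = t ⊗ₜ 1) ∧
      (∀ b, Algebra.TensorProduct.lift (Algebra.ofId T B) (AlgHom.id R B)
        (fun _ _ => Commute.all _ _) (ρ b) = b) ∧
      (∀ b, Algebra.TensorProduct.map (AlgHom.id T T) ρ (ρ b) =
        Algebra.TensorProduct.map (AlgHom.id T T)
          (Algebra.TensorProduct.includeRight : B →ₐ[R] T ⊗[R] B) (ρ b)) := by
  -- An algebra map out of `B` is determined by its restriction to `T` and by the pull-back of the
  -- universal section. Both comodule laws are instances of this.
  have huniq {D : Type u} [CommRing D] [Algebra R D] {φ ψ : B →ₐ[R] D}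
      (h : φ.comp (IsScalarTower.toAlgHom R T B) = ψ.comp (IsScalarTower.toAlgHom R T B))
      (h' : Φ.map (specOverMap j φ).op x = Φ.map (specOverMap j ψ).op x) : φ = ψ :=
    specOverMap_injective j (hx.hom_ext (by rw [specOverMap_comp, specOverMap_comp, h]) h')
  set ι : B →ₐ[R] T ⊗[R] B := Algebra.TensorProduct.includeRight
  -- The coaction classifies the universal section pulled back along the second factor, viewed over
  -- `Spec T` through the first factor. This makes sense because `Φ` is defined over `Spec R`.
  obtain ⟨q, ⟨hq₁, hq₂⟩, -⟩ := hx (specOver j (T ⊗[R] B))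
    (specOverMap j (Algebra.TensorProduct.includeLeft : T →ₐ[R] T ⊗[R] B))
    (Φ.map (specOverMap j ι).op x)
  obtain ⟨ρ, rfl⟩ := exists_eq_specOverMap j q (by
    have : Algebra.ofId R B = (IsScalarTower.toAlgHom R T B).comp (Algebra.ofId R T) :=
      Subsingleton.elim _ _
    rw [this, ← specOverMap_comp, reassoc_of% hq₁, specOverMap_comp]
    congr 1)
  rw [specOverMap_comp] at hq₁
  have hρ : ρ.comp (IsScalarTower.toAlgHom R T B) = Algebra.TensorProduct.includeLeft :=
    specOverMap_injective j hq₁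
  have hρ' (t : T) : ρ (algebraMap T B t) = t ⊗ₜ 1 := DFunLike.congr_fun hρ t
  refine ⟨ρ, hq₂, hρ', ?_, ?_⟩
  · let μ : T ⊗[R] B →ₐ[R] B := (Algebra.TensorProduct.lift (Algebra.ofId T B) (AlgHom.id R B)
        (fun _ _ => Commute.all _ _)).restrictScalars R
    have : μ.comp ρ = AlgHom.id R B := by
      refine huniq ?_ ?_
      · ext t
        simp [μ, hρ', Algebra.ofId_apply]
      · rw [← map_specOverMap_comp, hq₂, map_specOverMap_comp]
        have e : μ.comp ι = AlgHom.id R B := by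
          ext b
          simp [μ, ι]
        rw [e]
    exact fun b => DFunLike.congr_fun this b
  · let m (φ : B →ₐ[R] T ⊗[R] B) : T ⊗[R] B →ₐ[R] T ⊗[R] (T ⊗[R] B) :=
      (Algebra.TensorProduct.map (AlgHom.id T T) φ).restrictScalars R
    have : (m ρ).comp ρ = (m ι).comp ρ := by
      refine huniq ?_ ?_
      · ext t
        simp [m, hρ']
      · have e (φ : B →ₐ[R] T ⊗[R] B) :
            (m φ).comp ι = (Algebra.TensorProduct.includeRight).comp φ := by
          ext b
          simp [m, ι]
        rw [← map_specOverMap_comp, ← map_specOverMap_comp, hq₂, map_specOverMap_comp,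
          map_specOverMap_comp, e, e, ← map_specOverMap_comp, ← map_specOverMap_comp, hq₂]
    exact fun b => DFunLike.congr_fun this b

/-- Effective descent of finite étale representing objects along étale surjective morphisms of
affine schemes. -/
theorem RepresentsOver.descend (hΦ : Presieve.IsSheaf (Scheme.etaleTopology.over S) Φ)
    [Etale (specOverMap j (IsScalarTower.toAlgHom R R T)).left]
    [Surjective (specOverMap j (IsScalarTower.toAlgHom R R T)).left]
    [IsFinite (specOverMap j (IsScalarTower.toAlgHom R T B)).left]
    [Etale (specOverMap j (IsScalarTower.toAlgHom R T B)).left]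
    [Surjective (specOverMap j (IsScalarTower.toAlgHom R T B)).left]
    {x : Φ.obj (op (specOver j B))}
    (hx : RepresentsOver Φ (specOverMap j (IsScalarTower.toAlgHom R T B)) x) :
    ∃ (X₀ : Over S) (π₀ : X₀ ⟶ specOver j R) (x₀ : Φ.obj (op X₀)), RepresentsOver Φ π₀ x₀ ∧
      IsFinite π₀.left ∧ Etale π₀.left ∧ Surjective π₀.left := by
  obtain ⟨ρ, hρx, hρ, hcounit, hcoassoc⟩ := hx.exists_coaction
  have hff : Module.FaithfullyFlat R T := by
    rw [← RingHom.faithfullyFlat_algebraMap_iff]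
    exact (flat_and_surjective_SpecMap_iff
      (CommRingCat.ofHom (IsScalarTower.toAlgHom R R T).toRingHom)).1
        ⟨inferInstanceAs (Flat (specOverMap j (IsScalarTower.toAlgHom R R T)).left), ‹_›⟩
  have hqc : QuasiCompact (specOverMap j (IsScalarTower.toAlgHom R R T)).left :=
    inferInstanceAs (QuasiCompact (Spec.map _))
  have hpush := isPushout_equalizer_of_coaction ρ hρ hcounit hcoassoc
  set ι : B →ₐ[R] T ⊗[R] B := Algebra.TensorProduct.includeRight
  set A := AlgHom.equalizer ρ ι
  have hpull := isPullback_specOverMap j (C := R) (D := T) (E := A) (P := B)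
  have hpull' := (hpull.map (Over.forget S))
  dsimp only [Over.forget_obj, Over.forget_map] at hpull'
  have hval : Etale (specOverMap j (IsScalarTower.toAlgHom R A B)).left :=
    MorphismProperty.of_isPullback (P := @Etale) hpull' inferInstance
  have hval' : Surjective (specOverMap j (IsScalarTower.toAlgHom R A B)).left :=
    MorphismProperty.of_isPullback (P := @Surjective) hpull' inferInstance
  -- The two pull-backs of `x` to `Spec (B ⊗[A] B)` agree because the two inclusions of `B` are `v ∘
  -- ρ` and `v ∘ ι`, and `x` has the same image under `ρ` and `ι`. For `v ∘ ρ` it suffices to look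
  -- at `T` and at `A`, which generate `B`, and `ρ = ι` on `A`.
  have hagree : Φ.map (specOverMap j ((Algebra.TensorProduct.includeLeft : B →ₐ[A] B ⊗[A] B).restrictScalars R)).op x =
      Φ.map (specOverMap j ((Algebra.TensorProduct.includeRight : B →ₐ[A] B ⊗[A] B).restrictScalars R)).op x := by
    let v : T ⊗[R] B →ₐ[R] B ⊗[A] B := Algebra.TensorProduct.lift
      (((Algebra.TensorProduct.includeLeft : B →ₐ[A] B ⊗[A] B).restrictScalars R).comp
        (IsScalarTower.toAlgHom R T B))
      ((Algebra.TensorProduct.includeRight : B →ₐ[A] B ⊗[A] B).restrictScalars R)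
      (fun _ _ => Commute.all _ _)
    have h₁ : v.comp ι = (Algebra.TensorProduct.includeRight : B →ₐ[A] B ⊗[A] B).restrictScalars R := by
      ext b
      simp [v, ι]
    have h₂ : v.comp ρ = (Algebra.TensorProduct.includeLeft : B →ₐ[A] B ⊗[A] B).restrictScalars R := by
      ext b
      induction b using hpush.out.inductionOn with
      | zero => simp
      | tmul a =>
        have : ρ (a : B) = ι a := a.2
        change v (ρ (a : B)) = (a : B) ⊗ₜ[A] (1 : B)
        rw [this]
        have e : (a : B) ⊗ₜ[A] (1 : B) = (a • (1 : B)) ⊗ₜ[A] (1 : B) := by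
          rw [Algebra.smul_def, mul_one]; rfl
        rw [e, TensorProduct.smul_tmul, Algebra.smul_def, mul_one]
        simp [v, ι]
      | smul t b hb =>
        rw [Algebra.smul_def]
        simp only [map_mul, hb]
        congr 1
        simp [hρ, v]
      | add b b' hb hb' => simp only [map_add, hb, hb']
    rw [← h₁, ← h₂, ← map_specOverMap_comp, ← map_specOverMap_comp, hρx]
  -- Descent of the section `x` along the étale covering `Spec B ⟶ Spec A`: two lifts of a scheme
  -- over `Spec A` to `Spec B` factor through `Spec (B ⊗[A] B)`, where `hagree` applies.
  obtain ⟨x₀, hx₀⟩ := sheaf_glue hΦ (T := specOver j A)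
    (fun {W} i a => ∃ l : W ⟶ specOver j B, l ≫ specOverMap j (IsScalarTower.toAlgHom R A B) = i ∧
      a = Φ.map l.op x)
    (fun {W} i a b ha hb => by
      obtain ⟨l, rfl, rfl⟩ := ha
      obtain ⟨l', hl', rfl⟩ := hb
      have hp := isPullback_SpecMap_of_isPushout _ _ _ _
        (CommRingCat.isPushout_tensorProduct A B B)
      have hl := congrArg (fun f => f.left) hl'
      let k : W ⟶ specOver j (B ⊗[A] B) := Over.homMk (hp.lift l.left l'.left hl.symm) (by
        have : hp.lift l.left l'.left hl.symm ≫ (specOverMap j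
            ((Algebra.TensorProduct.includeLeft : B →ₐ[A] B ⊗[A] B).restrictScalars R)).left =
            l.left := hp.lift_fst _ _ _
        have e := Over.w (specOverMap j
          ((Algebra.TensorProduct.includeLeft : B →ₐ[A] B ⊗[A] B).restrictScalars R))
        refine (congrArg (hp.lift l.left l'.left hl.symm ≫ ·) e).symm.trans ?_
        refine (Category.assoc _ _ _).symm.trans ?_
        exact (congrArg (· ≫ (specOver j B).hom) this).trans (Over.w l))
      have hk : k ≫ specOverMap j
          ((Algebra.TensorProduct.includeLeft : B →ₐ[A] B ⊗[A] B).restrictScalars R) = l := by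
        ext1
        exact hp.lift_fst _ _ _
      have hk' : k ≫ specOverMap j
          ((Algebra.TensorProduct.includeRight : B →ₐ[A] B ⊗[A] B).restrictScalars R) = l' := by
        ext1
        exact hp.lift_snd _ _ _
      rw [← hk, ← hk', op_comp, op_comp, Functor.map_comp_apply, Functor.map_comp_apply, hagree])
    (fun i l a ha => by
      obtain ⟨l', rfl, rfl⟩ := ha
      exact ⟨l ≫ l', by rw [Category.assoc], by rw [op_comp, Functor.map_comp_apply]⟩)
    (fun t => ⟨specOver j B, specOverMap j (IsScalarTower.toAlgHom R A B), hval,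
      hval'.surj t, x, 𝟙 _, Category.id_comp _, by simp⟩)
  have hx₀' : Φ.map (specOverMap j (IsScalarTower.toAlgHom R A B)).op x₀ = x :=
    hx₀ _ _ ⟨𝟙 _, Category.id_comp _, by simp⟩
  refine ⟨specOver j A, specOverMap j (IsScalarTower.toAlgHom R R A), x₀,
    RepresentsOver.of_local hΦ _ _ fun v => ⟨specOver j T, specOver j B,
      specOverMap j (IsScalarTower.toAlgHom R R T), specOverMap j (IsScalarTower.toAlgHom R T B),
      specOverMap j (IsScalarTower.toAlgHom R A B), inferInstance, Surjective.surj v,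
      hpull.flip, by rwa [hx₀']⟩, ?_, ?_, ?_⟩
  -- Finiteness descends from `T ⊗[R] A`, which is `B`, to `A` by faithful flatness.
  · have : Module.Finite T B := by
      have h := (IsFinite.SpecMap_iff
        ( CommRingCat.ofHom (IsScalarTower.toAlgHom R T B).toRingHom)).1 ‹_›
      exact RingHom.finite_algebraMap.1 h
    have : Module.Finite T (T ⊗[R] A) := Module.Finite.equiv hpush.out.equiv.symm
    have : Module.Finite R A := .of_finite_tensorProduct_of_faithfullyFlat T
    exact (IsFinite.SpecMap_iff
      ( CommRingCat.ofHom (IsScalarTower.toAlgHom R R A).toRingHom)).2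
        (RingHom.finite_algebraMap.2 this)
  · refine MorphismProperty.of_isPullback_of_descendsAlong (P := @Etale)
      (Q := @Surjective ⊓ @Flat ⊓ @QuasiCompact) hpull' ⟨⟨?_, ?_⟩, ?_⟩ ?_ <;> infer_instance
  · refine MorphismProperty.of_isPullback_of_descendsAlong (P := @Surjective)
      (Q := @Surjective ⊓ @Flat ⊓ @QuasiCompact) hpull' ⟨⟨?_, ?_⟩, ?_⟩ ?_ <;> infer_instance

end AffineDescent

/-! ### Constant sheaves and disjoint unions of copies of the base. -/

section Constant

variable {S : Scheme.{u}} {Φ : (Over S)ᵒᵖ ⥤ Type w}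

/-- The sections `ξ g` of `Φ` over `U` identify the restriction of `Φ` to the schemes over `U`
with the constant sheaf attached to `G`. -/
structure IsConstantOn (Φ : (Over S)ᵒᵖ ⥤ Type w) {U : Over S} {G : Type}
    (ξ : G → Φ.obj (op U)) : Prop where
  exists_eq : ∀ {T : Over S} (f : T ⟶ U) (a : Φ.obj (op T)) (t : T.left),
    ∃ (W : Over S) (i : W ⟶ T), Etale i.left ∧ t ∈ Set.range i.left ∧
      ∃ g, Φ.map i.op a = Φ.map (i ≫ f).op (ξ g)
  eq_of_map_eq : ∀ {T : Over S} (f : T ⟶ U) (_ : T.left) (g g' : G),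
    Φ.map f.op (ξ g) = Φ.map f.op (ξ g') → g = g'

lemma IsConstantOn.map {U U' : Over S} {G : Type} {ξ : G → Φ.obj (op U)}
    (h : IsConstantOn Φ ξ) (f : U' ⟶ U) : IsConstantOn Φ fun g => Φ.map f.op (ξ g) where
  exists_eq k a t := by
    obtain ⟨W, i, hi, ht, g, hg⟩ := h.exists_eq (k ≫ f) a t
    refine ⟨W, i, hi, ht, g, ?_⟩
    rw [hg, ← Functor.map_comp_apply, ← op_comp, Category.assoc]
  eq_of_map_eq k t g g' e := by
    refine h.eq_of_map_eq (k ≫ f) t g g' ?_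
    rw [op_comp, Functor.map_comp_apply, Functor.map_comp_apply, e]

variable {R : Type u} [CommRing R] (j : Spec (.of R) ⟶ S) (T : Type u) [CommRing T] [Algebra R T]
  {G : Type}

/-- The inclusion of the component of index `g` of a disjoint union of copies of `Spec T`. -/
noncomputable def component (g : G) : specOver j T ⟶ specOver j (G → T) :=
  specOverMap j (Pi.evalAlgHom R (fun _ : G => T) g)

lemma component_comp (g : G) :
    component j T g ≫ specOverMap j (IsScalarTower.toAlgHom R T (G → T)) = 𝟙 _ := by
  rw [component, specOverMap_comp, ← specOverMap_id]
  rfl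

instance [Finite G] (g : G) : IsOpenImmersion (component j T g).left := by
  change IsOpenImmersion (Spec.map (CommRingCat.ofHom (Pi.evalRingHom (fun _ : G => T) g)))
  infer_instance

lemma exists_mem_range_component [Finite G] (x : (specOver j (G → T)).left) :
    ∃ g, x ∈ Set.range (component j T g).left := by
  obtain ⟨g, y, hy⟩ := PrimeSpectrum.exists_comap_evalRingHom_eq (R := fun _ : G => T) x
  exact ⟨g, y, hy⟩

/-- The idempotent supported at `g` lies in every prime coming from the factor `g'` and in none
coming from the factor `g`. -/
lemma comap_evalRingHom_ne {p q : PrimeSpectrum T} {g g' : G} (hg : g ≠ g') :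
    PrimeSpectrum.comap (Pi.evalRingHom (fun _ : G => T) g) p ≠
      PrimeSpectrum.comap (Pi.evalRingHom (fun _ : G => T) g') q := by
  classical
  intro e
  have h₁ : (Pi.single g 1 : G → T) ∉
      (PrimeSpectrum.comap (Pi.evalRingHom (fun _ : G => T) g) p).asIdeal := by
    rw [PrimeSpectrum.comap_asIdeal, Ideal.mem_comap, Pi.evalRingHom_apply, Pi.single_eq_same]
    exact p.2.one_notMem
  refine h₁ ?_
  rw [e, PrimeSpectrum.comap_asIdeal, Ideal.mem_comap, Pi.evalRingHom_apply,
    Pi.single_eq_of_ne hg.symm]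
  exact Ideal.zero_mem _

lemma isEmpty_of_component_eq {W : Over S} {f f' : W ⟶ specOver j T} {g g' : G}
    (h : f ≫ component j T g = f' ≫ component j T g') (hg : g ≠ g') : IsEmpty W.left := by
  refine ⟨fun y => comap_evalRingHom_ne T (p := f.left y) (q := f'.left y) hg ?_⟩
  change (component j T g).left (f.left y) = (component j T g').left (f'.left y)
  rw [← Scheme.Hom.comp_apply, ← Scheme.Hom.comp_apply, ← Over.comp_left, ← Over.comp_left, h]

/-- A constant sheaf is represented by a disjoint union of copies of the base. -/
theorem IsConstantOn.exists_representsOver (hΦ : Presieve.IsSheaf (Scheme.etaleTopology.over S) Φ)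
    [Finite G] {ξ : G → Φ.obj (op (specOver j T))} (hξ : IsConstantOn Φ ξ) :
    ∃ x, RepresentsOver Φ (specOverMap j (IsScalarTower.toAlgHom R T (G → T))) x := by
  set π := specOverMap j (IsScalarTower.toAlgHom R T (G → T)) with hπ
  have hmono {W : Over S} {f f' : W ⟶ specOver j T} {g : G}
      (h : f ≫ component j T g = f' ≫ component j T g) : f = f' := by
    rw [← Category.comp_id f, ← component_comp j T g, ← Category.assoc, h, Category.assoc,
      component_comp, Category.comp_id]
  -- The universal section is `ξ g` on the component of index `g`.
  obtain ⟨x, hx⟩ := sheaf_glue hΦ (T := specOver j (G → T))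
    (fun {W} i a => ∃ (g : G) (f : W ⟶ specOver j T), f ≫ component j T g = i ∧
      a = Φ.map f.op (ξ g))
    (fun {W} i a b ha hb => by
      obtain ⟨g, f, rfl, rfl⟩ := ha
      obtain ⟨g', f', h, rfl⟩ := hb
      by_cases hg : g' = g
      · subst hg
        rw [hmono h]
      -- Distinct components meet in the empty scheme, over which a sheaf has at most one section
      -- since the empty family covers.
      · have := isEmpty_of_component_eq j T h hg
        exact sheaf_ext hΦ isEmptyElim)
    (fun i l a ha => by
      obtain ⟨g, f, rfl, rfl⟩ := ha
      exact ⟨g, l ≫ f, by rw [Category.assoc], by rw [op_comp, Functor.map_comp_apply]⟩)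
    (fun t => by
      obtain ⟨g, hg⟩ := exists_mem_range_component j T t
      exact ⟨_, component j T g, inferInstance, hg, ξ g, g, 𝟙 _, Category.id_comp _, by simp⟩)
  have hx' (g : G) : Φ.map (component j T g).op x = ξ g :=
    hx _ _ ⟨g, 𝟙 _, Category.id_comp _, by simp⟩
  refine ⟨x, fun Y f a => ?_⟩
  have key {W : Over S} (i : W ⟶ Y) (g : G) (hg : Φ.map i.op a = Φ.map (i ≫ f).op (ξ g)) :
      Φ.map ((i ≫ f) ≫ component j T g).op x = Φ.map i.op a := by
    rw [op_comp, Functor.map_comp_apply, hx', hg]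
  -- Where `a` coincides with `ξ g`, the classifying morphism is the inclusion of the component `g`;
  -- these local morphisms glue because representable functors are sheaves.
  obtain ⟨b, hb⟩ := sheaf_glue (isSheaf_yoneda_over (specOver j (G → T))) (T := Y)
    (fun {W} i (b : W ⟶ specOver j (G → T)) => ∃ g : G, b = (i ≫ f) ≫ component j T g ∧
      Φ.map i.op a = Φ.map (i ≫ f).op (ξ g))
    (fun {W} i b b' h h' => by
      obtain ⟨g, rfl, hg⟩ := h
      obtain ⟨g', rfl, hg'⟩ := h'
      refine over_hom_ext fun t => ?_
      rw [hξ.eq_of_map_eq (i ≫ f) t g g' (hg.symm.trans hg')]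
      exact ⟨W, 𝟙 _, inferInstanceAs (Etale (𝟙 _)), ⟨t, rfl⟩, rfl⟩)
    (fun i l b h => by
      obtain ⟨g, rfl, hg⟩ := h
      refine ⟨g, by simp, ?_⟩
      rw [op_comp, Functor.map_comp_apply, hg, ← Functor.map_comp_apply, ← op_comp,
        Category.assoc])
    (fun t => by
      obtain ⟨W, i, hi, ht, g, hg⟩ := hξ.exists_eq f a t
      exact ⟨W, i, hi, ht, _, g, rfl, hg⟩)
  have hloc (t : Y.left) : ∃ (W : Over S) (i : W ⟶ Y), Etale i.left ∧ t ∈ Set.range i.left ∧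
      (i ≫ b) ≫ π = i ≫ f ∧ Φ.map (i ≫ b).op x = Φ.map i.op a := by
    obtain ⟨W, i, hi, ht, g, hg⟩ := hξ.exists_eq f a t
    have : i ≫ b = (i ≫ f) ≫ component j T g := hb i _ ⟨g, rfl, hg⟩
    refine ⟨W, i, hi, ht, ?_, ?_⟩
    · rw [this, Category.assoc, component_comp, Category.comp_id]
    · rw [this, key i g hg]
  refine ⟨b, ⟨?_, ?_⟩, fun b' hb' => ?_⟩
  · refine over_hom_ext fun t => ?_
    obtain ⟨W, i, hi, ht, h₁, -⟩ := hloc t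
    exact ⟨W, i, hi, ht, by rw [← Category.assoc, h₁]⟩
  · refine sheaf_ext hΦ fun t => ?_
    obtain ⟨W, i, hi, ht, -, h₂⟩ := hloc t
    exact ⟨W, i, hi, ht, by rw [← h₂, op_comp, Functor.map_comp_apply]⟩
  · refine over_hom_ext fun t => ?_
    -- Uniqueness is tested on the preimage under `b'` of the component containing the image of `t`:
    -- there `b'` is a component inclusion and `a` is the corresponding `ξ g`.
    obtain ⟨g, y, hy⟩ := exists_mem_range_component j T (b'.left t)
    let W : Over S := Over.mk (pullback.fst b'.left (component j T g).left ≫ Y.hom)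
    let i : W ⟶ Y := Over.homMk (pullback.fst _ _) rfl
    let k : W ⟶ specOver j T := Over.homMk (pullback.snd _ _) (by
      have := Over.w (component j T g)
      have h' := Over.w b'
      change pullback.snd _ _ ≫ (specOver j T).hom = pullback.fst _ _ ≫ Y.hom
      rw [← this, ← h', pullback.condition_assoc])
    have hk : i ≫ b' = k ≫ component j T g := by
      ext1
      exact pullback.condition
    have hk' : k = i ≫ f := by
      rw [← hb'.1, ← Category.assoc, hk, Category.assoc, component_comp, Category.comp_id]
    refine ⟨W, i, inferInstanceAs (Etale (pullback.fst b'.left (component j T g).left)), ?_, ?_⟩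
    · obtain ⟨z, hz, -⟩ := Scheme.Pullback.exists_preimage_pullback t y hy.symm
      exact ⟨z, hz⟩
    · refine (hb i (i ≫ b') ⟨g, by rw [hk, hk'], ?_⟩).symm
      rw [← hb'.2, ← Functor.map_comp_apply, ← op_comp, hk, op_comp, Functor.map_comp_apply, hx',
        hk']

variable [Finite G]

instance : IsFinite (specOverMap j (IsScalarTower.toAlgHom R T (G → T))).left :=
  (IsFinite.SpecMap_iff (CommRingCat.ofHom (algebraMap T (G → T)))).2
    (RingHom.finite_algebraMap.2 inferInstance)

instance : Etale (specOverMap j (IsScalarTower.toAlgHom R T (G → T))).left := by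
  refine (HasRingHomProperty.Spec_iff (P := @Etale)
    (φ := CommRingCat.ofHom (algebraMap T (G → T)))).2 ?_
  exact RingHom.etale_algebraMap.2 inferInstance

instance [Nonempty G] : Surjective (specOverMap j (IsScalarTower.toAlgHom R T (G → T))).left := by
  obtain ⟨g⟩ := ‹Nonempty G›
  have h := congrArg (fun f => f.left) (component_comp j T g)
  refine ⟨fun y => ⟨(component j T g).left y, ?_⟩⟩
  rw [← Scheme.Hom.comp_apply, ← Over.comp_left, component_comp]
  rfl

end Constant

/-! ### From étale local constancy to a global finite étale scheme. -/

section Gluing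

lemma isZariskiLocalAtTarget_etale :
    IsZariskiLocalAtTarget (@Etale : MorphismProperty Scheme.{u}) :=
  HasRingHomProperty.instIsZariskiLocalAtTarget (P := @Etale)

lemma isZariskiLocalAtTarget_isFinite :
    IsZariskiLocalAtTarget (@IsFinite : MorphismProperty Scheme.{u}) :=
  @HasAffineProperty.instIsZariskiLocalAtTarget _ _
    IsFinite.instHasAffinePropertyAndIsAffineFiniteCarrierObjOppositeOpensCarrierCarrierCommRingCatPresheafOpOpensTopHomAppTop

/-- Étale morphisms are, locally around a point of the source, étale surjections of affine
schemes up to open immersions. -/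
lemma exists_affine_etale_surjective {U S : Scheme.{u}} (h : U ⟶ S) [Etale h] (y : U) :
    ∃ (R T : CommRingCat.{u}) (j : Spec R ⟶ S) (i : Spec T ⟶ U) (φ : R ⟶ T),
      IsOpenImmersion j ∧ h y ∈ Set.range j ∧ i ≫ h = Spec.map φ ≫ j ∧
        Etale (Spec.map φ) ∧ Surjective (Spec.map φ) := by
  obtain ⟨R₀, j₀, hj₀, ⟨a, ha⟩, -⟩ :=
    Scheme.exists_affine_mem_range_and_range_subset (show h y ∈ (⊤ : S.Opens) from trivial)
  obtain ⟨p, hp, hp'⟩ := Scheme.Pullback.exists_preimage_pullback (f := h) (g := j₀) y a ha.symm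
  obtain ⟨T₀, i₀, hi₀, ⟨q, hq⟩, -⟩ := Scheme.exists_affine_mem_range_and_range_subset
    (show p ∈ (⊤ : (pullback h j₀).Opens) from trivial)
  let g := i₀ ≫ pullback.snd h j₀
  have hg : Etale g := inferInstance
  have hga : g q = a := by rw [Scheme.Hom.comp_apply, hq, hp']
  -- The image of the étale map `g` is open; restricting `g` over an affine open contained in the
  -- image makes it surjective.
  obtain ⟨R, l, hl, ⟨b, hb⟩, hl'⟩ := Scheme.exists_affine_mem_range_and_range_subset
    (U := ⟨Set.range g, g.isOpenMap.isOpen_range⟩) (show a ∈ Set.range g from ⟨q, hga⟩)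
  obtain ⟨φ, hφ⟩ := Spec.map_surjective ((pullback g l).isoSpec.inv ≫ pullback.snd g l)
  refine ⟨R, _, l ≫ j₀, (pullback g l).isoSpec.inv ≫ pullback.fst g l ≫ i₀ ≫ pullback.fst h j₀,
    φ, inferInstance, ⟨b, ?_⟩, ?_, ?_, ?_⟩
  · rw [Scheme.Hom.comp_apply, hb, ha]
  · rw [hφ]
    simp only [Category.assoc, pullback.condition, g]
    rw [← pullback.condition_assoc (f := g) (g := l)]
    simp [g]
  · rw [hφ]
    infer_instance
  · rw [hφ]
    have : Surjective (pullback.snd g l) := by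
      refine ⟨fun z => ?_⟩
      obtain ⟨z', hz'⟩ := hl' ⟨z, rfl⟩
      obtain ⟨w, -, hw⟩ := Scheme.Pullback.exists_preimage_pullback z' z hz'
      exact ⟨w, hw⟩
    infer_instance

variable {S : Scheme.{u}} {Φ : (Over S)ᵒᵖ ⥤ Type w}

/-- A finite étale surjective `V`-scheme representing `Φ` over `V`. -/
structure FiniteEtaleRepr (Φ : (Over S)ᵒᵖ ⥤ Type w) (V : Over S) where
  X : Over S
  π : X ⟶ V
  x : Φ.obj (op X)
  represents : RepresentsOver Φ π x
  finite : IsFinite π.left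
  etale : Etale π.left
  surj : Surjective π.left

/-- A morphism to `X'` amounts to a morphism to `U'` and a section of `Φ`, and likewise for `X` and
`U`; so `X'` is the base change of `X`. This supplies the cartesian squares of the gluing datum. -/
lemma RepresentsOver.isPullback {X U X' U' : Over S} {π : X ⟶ U} {x : Φ.obj (op X)}
    (hx : RepresentsOver Φ π x) {π' : X' ⟶ U'} {x' : Φ.obj (op X')}
    (hx' : RepresentsOver Φ π' x') {r : X' ⟶ X} {g : U' ⟶ U} (e : r ≫ π = π' ≫ g)
    (hr : Φ.map r.op x = x') : IsPullback r π' π g := by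
  have ex (s : PullbackCone π g) : ∃ l : s.pt ⟶ X', l ≫ r = s.fst ∧ l ≫ π' = s.snd := by
    obtain ⟨l, ⟨h₁, h₂⟩, -⟩ := hx' _ s.snd (Φ.map s.fst.op x)
    refine ⟨l, hx.hom_ext ?_ ?_, h₁⟩
    · rw [Category.assoc, e, reassoc_of% h₁, s.condition]
    · rw [op_comp, Functor.map_comp_apply, hr, h₂]
  choose l h₁ h₂ using ex
  refine ⟨⟨e⟩, ⟨PullbackCone.IsLimit.mk e l h₁ h₂ fun s m hm hm' => ?_⟩⟩
  refine hx'.hom_ext (by rw [hm', h₂]) ?_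
  rw [← hr, ← Functor.map_comp_apply, ← Functor.map_comp_apply, ← op_comp, ← op_comp, hm, h₁]

/-- Restriction of a representing object along a morphism of bases. -/
noncomputable def FiniteEtaleRepr.restrict {V V' : Over S} (A : FiniteEtaleRepr Φ V)
    (g : V' ⟶ V) : FiniteEtaleRepr Φ V' where
  X := Over.mk (pullback.snd A.π.left g.left ≫ V'.hom)
  π := Over.homMk (pullback.snd A.π.left g.left) rfl
  x := Φ.map (Quiver.Hom.op (Over.homMk (pullback.fst A.π.left g.left) (by
    dsimp
    rw [← Over.w A.π, ← Over.w g, pullback.condition_assoc]))) A.x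
  represents := by
    refine A.represents.pullback (IsPullback.of_map (Over.forget S) ?_
      (IsPullback.of_hasPullback A.π.left g.left))
    ext1
    exact pullback.condition
  finite := have := A.finite; inferInstanceAs (IsFinite (pullback.snd A.π.left g.left))
  etale := have := A.etale; inferInstanceAs (Etale (pullback.snd A.π.left g.left))
  surj := have := A.surj; inferInstanceAs (Surjective (pullback.snd A.π.left g.left))

/-- A locally constant sheaf with finite nonempty fibres is representable in a neighbourhood of
every point. -/
lemma exists_finiteEtaleRepr (hΦ : Presieve.IsSheaf (Scheme.etaleTopology.over S) Φ)
    {U : Over S} [Etale U.hom] (y : U.left) {G : Type} [Finite G] [Nonempty G]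
    {ξ : G → Φ.obj (op U)} (hξ : IsConstantOn Φ ξ) :
    ∃ V : Over S, IsOpenImmersion V.hom ∧ U.hom y ∈ Set.range V.hom ∧
      Nonempty (FiniteEtaleRepr Φ V) := by
  obtain ⟨R, T, j, i, φ, hj, hy, hw, hφ, hφ'⟩ := exists_affine_etale_surjective U.hom y
  algebraize [φ.hom]
  let f : specOver j T ⟶ U := Over.homMk i hw
  obtain ⟨x, hx⟩ := (hξ.map f).exists_representsOver j T hΦ
  have h₁ : Etale (specOverMap j (IsScalarTower.toAlgHom R R T)).left := hφ
  have h₂ : Surjective (specOverMap j (IsScalarTower.toAlgHom R R T)).left := hφ'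
  obtain ⟨X₀, π₀, x₀, h₀, h₃, h₄, h₅⟩ := hx.descend j hΦ
  refine ⟨specOver j R, ?_, ?_, ⟨X₀, π₀, x₀, h₀, h₃, h₄, h₅⟩⟩
  · dsimp
    infer_instance
  · obtain ⟨z, hz⟩ := hy
    refine ⟨z, ?_⟩
    rw [← hz]
    simp

/-- The open subschemes over which `Φ` is representable. -/
abbrev GoodOpens (Φ : (Over S)ᵒᵖ ⥤ Type w) : Type u :=
  {V : S.Opens // Nonempty (FiniteEtaleRepr Φ (Over.mk V.ι))}

variable (h : ∀ s : S, ∃ V : GoodOpens Φ, s ∈ V.1)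

/-- Stability under shrinking makes these open subschemes a basis of the topology, so that the cover
by all of them is locally directed. -/
lemma nonempty_finiteEtaleRepr_of_le {V W : S.Opens} (hVW : V ≤ W)
    (hW : Nonempty (FiniteEtaleRepr Φ (Over.mk W.ι))) :
    Nonempty (FiniteEtaleRepr Φ (Over.mk V.ι)) :=
  hW.map fun A => A.restrict (Over.homMk (S.homOfLE hVW) (by simp))

/-- The cover by the open subschemes over which `Φ` is representable. -/
noncomputable def goodCover : S.OpenCover where
  I₀ := GoodOpens Φ
  X V := V.1
  f V := V.1.ι
  mem₀ := by
    rw [Scheme.presieve₀_mem_precoverage_iff]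
    exact ⟨fun x => ⟨(h x).choose, by simpa using (h x).choose_spec⟩, fun V => inferInstance⟩

instance : Preorder (goodCover h).I₀ := inferInstanceAs (Preorder (GoodOpens Φ))

noncomputable instance : Scheme.Cover.LocallyDirected (goodCover h) :=
  .ofIsBasisOpensRange (fun {i j} => by
      change i.1 ≤ j.1 ↔ i.1.ι.opensRange ≤ j.1.ι.opensRange
      rw [Scheme.Opens.opensRange_ι, Scheme.Opens.opensRange_ι]) <| by
    rw [TopologicalSpace.Opens.isBasis_iff_nbhd]
    intro U x hx
    obtain ⟨V, hV⟩ := h x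
    refine ⟨V.1 ⊓ U, ⟨⟨V.1 ⊓ U, nonempty_finiteEtaleRepr_of_le inf_le_left V.2⟩, ?_⟩,
      ⟨hV, hx⟩, inf_le_right⟩
    exact Scheme.Opens.opensRange_ι _

/-- The transition morphisms of `goodCover`, over `S`. -/
noncomputable def goodTrans {V W : (goodCover h).I₀} (i : V ⟶ W) :
    Over.mk V.1.ι ⟶ Over.mk W.1.ι :=
  Over.homMk ((goodCover h).trans i) ((goodCover h).trans_map i)

/-- The chosen representing object over `V`. -/
noncomputable def goodRepr (V : (goodCover h).I₀) : FiniteEtaleRepr Φ (Over.mk V.1.ι) :=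
  V.2.some

lemma exists_goodMap {V W : (goodCover h).I₀} (i : V ⟶ W) :
    ∃ t : (goodRepr h V).X ⟶ (goodRepr h W).X,
      t ≫ (goodRepr h W).π = (goodRepr h V).π ≫ goodTrans h i ∧
      Φ.map t.op (goodRepr h W).x = (goodRepr h V).x :=
  ((goodRepr h W).represents _ _ _).exists

/-- The transition morphisms of the representing objects. -/
noncomputable def goodMap {V W : (goodCover h).I₀} (i : V ⟶ W) :
    (goodRepr h V).X ⟶ (goodRepr h W).X :=
  (exists_goodMap h i).choose

lemma goodMap_π {V W : (goodCover h).I₀} (i : V ⟶ W) :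
    goodMap h i ≫ (goodRepr h W).π = (goodRepr h V).π ≫ goodTrans h i :=
  (exists_goodMap h i).choose_spec.1

lemma map_goodMap {V W : (goodCover h).I₀} (i : V ⟶ W) :
    Φ.map (goodMap h i).op (goodRepr h W).x = (goodRepr h V).x :=
  (exists_goodMap h i).choose_spec.2

lemma isPullback_goodMap {V W : (goodCover h).I₀} (i : V ⟶ W) :
    IsPullback (goodMap h i) (goodRepr h V).π (goodRepr h W).π (goodTrans h i) :=
  (goodRepr h W).represents.isPullback (goodRepr h V).represents (goodMap_π h i)
    (map_goodMap h i)

/-- The gluing datum given by the representing objects. -/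
noncomputable def goodGluingData : (goodCover h).RelativeGluingData where
  functor :=
    { obj := fun V => (goodRepr h V).X.left
      map := fun i => (goodMap h i).left
      map_id := fun V => by
        rw [← Over.id_left]
        congr 1
        -- Functoriality of the transition maps is automatic: a map to a representing object is
        -- known by its projection and by the pull-back of the universal section.
        refine (goodRepr h V).represents.hom_ext ?_ ?_
        · rw [goodMap_π, Category.id_comp]
          convert! Category.comp_id _
          ext1
          exact (goodCover h).trans_id V
        · rw [map_goodMap]
          simp
      map_comp := fun {V W Z} i j => by
        rw [← Over.comp_left]
        congr 1
        refine (goodRepr h Z).represents.hom_ext ?_ ?_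
        · rw [goodMap_π, Category.assoc, goodMap_π, reassoc_of% (goodMap_π h)]
          congr 1
          ext1
          exact (goodCover h).trans_comp i j
        · rw [map_goodMap, op_comp, Functor.map_comp_apply, map_goodMap, map_goodMap] }
  natTrans :=
    { app := fun V => (goodRepr h V).π.left
      naturality := fun V W i => congrArg (fun f => f.left) (goodMap_π h i) }
  equifibered := fun V W i => (isPullback_goodMap h i).map (Over.forget S)

/-- The glued scheme. -/
noncomputable abbrev gluedOver : Over S := Over.mk (goodGluingData h).toBase

/-- The inclusion of a chart of the glued scheme. -/
noncomputable def goodι (V : (goodCover h).I₀) : (goodRepr h V).X ⟶ gluedOver h :=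
  Over.homMk (colimit.ι (goodGluingData h).functor V)
    (((goodGluingData h).ι_toBase V).trans (Over.w (goodRepr h V).π))

instance (V : (goodCover h).I₀) : IsOpenImmersion (goodι h V).left :=
  inferInstanceAs (IsOpenImmersion (colimit.ι (goodGluingData h).functor V))

lemma goodMap_goodι {V W : (goodCover h).I₀} (i : V ⟶ W) :
    goodMap h i ≫ goodι h W = goodι h V := by
  ext1
  exact colimit.w (goodGluingData h).functor i

lemma isPullback_goodι (V : (goodCover h).I₀) :
    IsPullback (goodι h V) (goodRepr h V).π (Over.homMk (U := gluedOver h) (V := Over.mk (𝟙 S))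
      (goodGluingData h).toBase) (Over.homMk V.1.ι) :=
  IsPullback.of_map (Over.forget S) (by ext1; exact (goodGluingData h).ι_toBase V)
    ((goodGluingData h).isPullback_natTrans_ι_toBase V).flip

/-- The universal sections of two charts are compared through the chart over the intersection of the
two opens, to which both restrict. -/
lemma exists_glued_section (hΦ : Presieve.IsSheaf (Scheme.etaleTopology.over S) Φ) :
    ∃ x : Φ.obj (op (gluedOver h)), ∀ V, Φ.map (goodι h V).op x = (goodRepr h V).x := by
  refine (sheaf_glue hΦ (T := gluedOver h)
    (fun {W} i a => ∃ (V : (goodCover h).I₀) (l : W ⟶ (goodRepr h V).X), l ≫ goodι h V = i ∧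
      a = Φ.map l.op (goodRepr h V).x) ?_ ?_ ?_).imp fun x hx V =>
    hx _ _ ⟨V, 𝟙 _, Category.id_comp _, by simp⟩
  · rintro W i _ _ ⟨V₁, l₁, h₁, rfl⟩ ⟨V₂, l₂, h₂, rfl⟩
    let V : (goodCover h).I₀ :=
      (⟨V₁.1 ⊓ V₂.1, nonempty_finiteEtaleRepr_of_le inf_le_left V₁.2⟩ : GoodOpens Φ)
    let i₁ : V ⟶ V₁ := homOfLE (show V₁.1 ⊓ V₂.1 ≤ V₁.1 from inf_le_left)
    let i₂ : V ⟶ V₂ := homOfLE (show V₁.1 ⊓ V₂.1 ≤ V₂.1 from inf_le_right)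
    have e (V' : (goodCover h).I₀) (l : W ⟶ (goodRepr h V').X) (hl : l ≫ goodι h V' = i) :
        Set.range W.hom ⊆ V'.1 := by
      rintro _ ⟨y, rfl⟩
      rw [← Over.w (l ≫ (goodRepr h V').π)]
      exact ((l ≫ (goodRepr h V').π).left y).2
    -- A scheme mapping to both charts lies over both opens, hence over their intersection, and its
    -- maps factor through the chart there.
    let k : W ⟶ Over.mk V.1.ι := Over.homMk (IsOpenImmersion.lift V.1.ι W.hom (by
      rw [Scheme.Opens.range_ι]
      exact Set.subset_inter (e V₁ l₁ h₁) (e V₂ l₂ h₂))) (IsOpenImmersion.lift_fac _ _ _)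
    have fac {V' : (goodCover h).I₀} (j : V ⟶ V') (l : W ⟶ (goodRepr h V').X) :
        ∃ m : W ⟶ (goodRepr h V).X, m ≫ goodMap h j = l := by
      refine ⟨(isPullback_goodMap h j).lift l k ?_, (isPullback_goodMap h j).lift_fst _ _ _⟩
      ext1
      rw [← cancel_mono V'.1.ι]
      exact (Over.w (l ≫ (goodRepr h V').π)).trans (Over.w (k ≫ goodTrans h j)).symm
    obtain ⟨m₁, hm₁⟩ := fac i₁ l₁
    obtain ⟨m₂, hm₂⟩ := fac i₂ l₂
    have : m₁ = m₂ := by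
      ext1
      rw [← cancel_mono (goodι h V).left]
      refine congrArg (fun f => f.left) (?_ : m₁ ≫ goodι h V = m₂ ≫ goodι h V)
      rw [← goodMap_goodι h i₁, reassoc_of% hm₁, h₁, goodMap_goodι h i₁, ← goodMap_goodι h i₂,
        reassoc_of% hm₂, h₂]
    rw [← hm₁, ← hm₂, op_comp, op_comp, Functor.map_comp_apply, Functor.map_comp_apply,
      map_goodMap, map_goodMap, this]
  · rintro W W' i j _ ⟨V, l, rfl, rfl⟩
    exact ⟨V, j ≫ l, Category.assoc _ _ _, by rw [op_comp, Functor.map_comp_apply]⟩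
  · intro t
    obtain ⟨V, y, hy⟩ := Scheme.IsLocallyDirected.ι_jointly_surjective (goodGluingData h).functor t
    exact ⟨_, goodι h V, inferInstance, ⟨y, hy⟩, _, V, 𝟙 _, Category.id_comp _, rfl⟩

/-- A sheaf which is representable by finite étale surjective schemes Zariski locally is so
globally. -/
lemma exists_representableBy_of_goodOpens
    (hΦ : Presieve.IsSheaf (Scheme.etaleTopology.over S) Φ)
    (h : ∀ s : S, ∃ V : GoodOpens Φ, s ∈ V.1) :
    ∃ X : Over S, Nonempty (Φ.RepresentableBy X) ∧
      IsFinite X.hom ∧ Etale X.hom ∧ Surjective X.hom := by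
  obtain ⟨x, hx⟩ := exists_glued_section h hΦ
  have hr : RepresentsOver Φ (Over.homMk (U := gluedOver h) (V := Over.mk (𝟙 S))
      (goodGluingData h).toBase) x := by
    refine .of_local hΦ _ _ fun v => ?_
    obtain ⟨V, hV⟩ := h v
    refine ⟨_, _, Over.homMk V.1.ι, (goodRepr h V).π, goodι h V, ?_, ⟨⟨v, hV⟩, rfl⟩,
      isPullback_goodι h V, ?_⟩
    · exact inferInstanceAs (Etale V.1.ι)
    · have e := hx V
      exact e ▸ (goodRepr h V).represents
  have hp (V : (goodCover h).I₀) : IsPullback (goodι h V).left (goodRepr h V).π.left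
      (goodGluingData h).toBase ((goodCover h).f V) :=
    (isPullback_goodι h V).map (Over.forget S)
  have hs (V : (goodCover h).I₀) : (goodCover h).pullbackHom (gluedOver h).hom V =
      (hp V).isoPullback.inv ≫ (goodRepr h V).π.left :=
    (hp V).isoPullback_inv_snd.symm
  refine ⟨gluedOver h, ⟨⟨fun {T} => Equiv.ofBijective (fun f => Φ.map f.op x) ?_, ?_⟩⟩, ?_, ?_, ?_⟩
  · constructor
    · intro f g hfg
      exact hr.hom_ext (by ext1; exact (Over.w f).trans (Over.w g).symm) hfg
    · intro a
      obtain ⟨f, hf, -⟩ := hr T (Over.homMk T.hom) a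
      exact ⟨f, hf.2⟩
  · intro T T' f g
    exact Functor.map_comp_apply Φ g.op f.op x
  · refine (@IsZariskiLocalAtTarget.iff_of_openCover _ isZariskiLocalAtTarget_isFinite _ _ _ (goodCover h)).2 fun V => ?_
    have := (goodRepr h V).finite
    exact (hs V).symm ▸ inferInstanceAs (IsFinite ((hp V).isoPullback.inv ≫ (goodRepr h V).π.left))
  · refine (@IsZariskiLocalAtTarget.iff_of_openCover _ isZariskiLocalAtTarget_etale _ _ _ (goodCover h)).2 fun V => ?_
    have := (goodRepr h V).etale
    exact (hs V).symm ▸ inferInstanceAs (Etale ((hp V).isoPullback.inv ≫ (goodRepr h V).π.left))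
  · refine (IsZariskiLocalAtTarget.iff_of_openCover (P := @Surjective) (goodCover h)).2 fun V => ?_
    have := (goodRepr h V).surj
    exact (hs V).symm ▸ inferInstanceAs (Surjective ((hp V).isoPullback.inv ≫ (goodRepr h V).π.left))

/-- An étale sheaf of sets which is, étale locally, constant with finite nonempty fibres is
representable by a finite étale surjective scheme. -/
theorem exists_representableBy_of_isConstantOn
    (hΦ : Presieve.IsSheaf (Scheme.etaleTopology.over S) Φ)
    (h : ∀ s : S, ∃ U : Over S, Etale U.hom ∧ s ∈ Set.range U.hom ∧
      ∃ (G : Type) (_ : Finite G) (_ : Nonempty G) (ξ : G → Φ.obj (op U)), IsConstantOn Φ ξ) :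
    ∃ X : Over S, Nonempty (Φ.RepresentableBy X) ∧
      IsFinite X.hom ∧ Etale X.hom ∧ Surjective X.hom := by
  refine exists_representableBy_of_goodOpens hΦ fun s => ?_
  obtain ⟨U, hU, ⟨y, rfl⟩, G, _, _, ξ, hξ⟩ := h s
  obtain ⟨V, hV, hy, ⟨A⟩⟩ := exists_finiteEtaleRepr hΦ y hξ
  refine ⟨⟨V.hom.opensRange, ⟨A.restrict (Over.homMk (IsOpenImmersion.lift V.hom
    V.hom.opensRange.ι (by simp)) (IsOpenImmersion.lift_fac _ _ _))⟩⟩, hy⟩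

end Gluing

/-! ### Restriction of sections and of exterior products. -/

section Sections

variable {M : ℕ} {S : Scheme.{u}}

lemma isSheaf_sections (A : EtSheaf M S) :
    Presieve.IsSheaf (Scheme.etaleTopology.over S) (A.obj ⋙ forget _) :=
  (isSheaf_iff_isSheaf_of_type _ _).1 (Presheaf.isSheaf_comp_of_isSheaf _ _ _ A.property)

lemma isSheaf_presheafHom (A B : EtSheaf M S) :
    Presieve.IsSheaf (Scheme.etaleTopology.over S) (presheafHom A.obj B.obj) :=
  (isSheaf_iff_isSheaf_of_type _ _).1 (Presheaf.IsSheaf.hom _ _ B.property)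

lemma res_res (A : EtSheaf M S) {U V W : Over S} (f : U ⟶ V) (g : V ⟶ W) (a : sec A W) :
    res A f (res A g a) = res A (f ≫ g) a :=
  (congrArg (fun φ => φ.hom a) (A.obj.map_comp g.op f.op)).symm

lemma res_id (A : EtSheaf M S) {V : Over S} (a : sec A V) : res A (𝟙 V) a = a :=
  congrArg (fun φ => φ.hom a) (A.obj.map_id (op V))

lemma secMap_res {A B : EtSheaf M S} (φ : A ⟶ B) {V W : Over S} (f : V ⟶ W) (a : sec A W) :
    secMap φ V (res A f a) = res B f (secMap φ W a) :=
  congrArg (fun ψ => ψ.hom a) (φ.hom.naturality f.op)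

lemma restrictMap_res {A B : EtSheaf M S} {R : Over S} (ξ : restrict A R ⟶ restrict B R)
    {T T' : Over R} (f : T' ⟶ T) (a : sec A T.left) :
    restrictMap ξ T' (res A f.left a) = res B f.left (restrictMap ξ T a) :=
  congrArg (fun ψ => ψ.hom a) (ξ.naturality f.op)

lemma restrictMap_comp_res {A B : EtSheaf M S} {R : Over S} (ξ : restrict A R ⟶ restrict B R)
    (T : Over R) {T' : Over S} (f : T' ⟶ T.left) (a : sec A T.left) :
    restrictMap ξ (Over.mk (f ≫ T.hom)) (res A f a) = res B f (restrictMap ξ T a) :=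
  restrictMap_res ξ (Over.homMk f : Over.mk (f ≫ T.hom) ⟶ T) a

lemma sec_ext (A : EtSheaf M S) {T : Over S} {a b : sec A T}
    (h : ∀ t : T.left, ∃ (W : Over S) (i : W ⟶ T),
      Etale i.left ∧ t ∈ Set.range i.left ∧ res A i a = res A i b) : a = b :=
  sheaf_ext (isSheaf_sections A) h

lemma wedge_res {n : ℕ} (A : EtSheaf M S) {V W : Over S} (f : V ⟶ W) (a : Fin n → sec A W) :
    wedge A V (fun i => res A f (a i)) = res (extPower n A) f (wedge A W a) := by
  have h := congrArg (fun φ => φ.hom (exteriorPower.ιMulti (ZMod M) n a))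
    ((toSheafify (Scheme.etaleTopology.over S)
      (A.obj ⋙ ModuleCat.exteriorPower.functor.{u + 1} (ZMod M) n)).naturality f.op)
  refine Eq.trans ?_ h
  exact congrArg ((toSheafify (Scheme.etaleTopology.over S)
    (A.obj ⋙ ModuleCat.exteriorPower.functor.{u + 1} (ZMod M) n)).app (op V)).hom
    (exteriorPower.map_apply_ιMulti (A.obj.map f.op).hom a).symm

end Sections

/-! ### The functor of polarized isomorphisms is an étale sheaf. -/

section Conj

variable {M : ℕ} {Fp F : Type u} [Field Fp] [Field F] [Algebra Fp F]
  {c : ComplexConjugation Fp F} {χ : (AlgebraicClosure F ≃ₐ[F] AlgebraicClosure F) →* (ZMod M)ˣ}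
  {Sp : Scheme.{u}} {s : Sp ⟶ Spec (.of Fp)} {A B : EtSheaf M (baseF F s)}
  {P : Polarization c χ A} {Q : Polarization c χ B} {n : ℕ} {η : extPower n A ≅ extPower n B}

/-- The projection of the base change to the algebraic closure. -/
noncomputable abbrev geomFst {X : Scheme.{u}} (f : X ⟶ Spec (.of F)) : geom f ⟶ X :=
  pullback.fst _ _

/-- The map on geometric base changes is itself the base change of `h` along the projection, so its
image is the full preimage of the image of `h`. -/
lemma exists_geomMap_eq {X Y : Scheme.{u}} {f : X ⟶ Spec (.of F)} {g : Y ⟶ Spec (.of F)}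
    (h : X ⟶ Y) (w : h ≫ g = f) (y : geom g) (hy : geomFst g y ∈ Set.range h) :
    ∃ x, geomMap h w x = y := by
  have hp : IsPullback (geomMap h w) (geomFst f) (geomFst g) h := by
    refine IsPullback.of_right ?_ (pullback.lift_fst _ _ _) (IsPullback.of_hasPullback g _).flip
    have e : geomMap h w ≫ pullback.snd g _ = pullback.snd f _ :=
      (pullback.lift_snd _ _ _).trans (Category.comp_id _)
    rw [e, w]
    exact (IsPullback.of_hasPullback f _).flip
  obtain ⟨x, hx⟩ := hy
  obtain ⟨z, hz, -⟩ := Scheme.exists_preimage_of_isPullback hp y x hx.symm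
  exact ⟨z, hz⟩

/-- An equality of locally constant functions on `T ×_F F̄` can be checked étale locally on
`T`. -/
lemma geom_ext {T : Over (baseF F s)} {φ ψ : LocallyConstant (geom (toF F T)) (ZMod M)}
    (h : ∀ t : T.left, ∃ (W : Over (baseF F s)) (i : W ⟶ T), t ∈ Set.range i.left ∧
      φ.comap (toContinuousMap (geomMap i.left (by simp [toF]) : geom (toF F W) ⟶ _)) =
        ψ.comap (toContinuousMap (geomMap i.left (by simp [toF])))) : φ = ψ := by
  ext x
  obtain ⟨W, i, hi, e⟩ := h (geomFst _ x)
  obtain ⟨y, rfl⟩ := exists_geomMap_eq i.left (f := toF F W) (by simp [toF]) x hi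
  exact congrArg (fun f => f y) e

/-- A morphism `A|_R ⟶ B|_R` preserves the pairing of sections over `T`. -/
def PreservesPair (P : Polarization c χ A) (Q : Polarization c χ B) {Rp : Over Sp}
    (ξ : restrict A (baseChange.obj Rp) ⟶ restrict B (baseChange.obj Rp))
    (T : Over (baseChange (F := F) (s := s).obj Rp)) : Prop :=
  ∀ (a : sec A T.left) (b : sec A ((conj s c).obj T.left)),
    Q.pair T.left (restrictMap ξ T a) (restrictMap ξ (conjOver c T) b) = P.pair T.left a b

/-- A morphism `A|_R ⟶ B|_R` lifts `η` over `T`. -/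
def LiftsWedge (η : extPower n A ≅ extPower n B) {R : Over (baseF F s)}
    (ξ : restrict A R ⟶ restrict B R) (T : Over R) : Prop :=
  ∀ a : Fin n → sec A T.left,
    wedge B T.left (fun i => restrictMap ξ T (a i)) = secMap η.hom T.left (wedge A T.left a)

lemma Polarization.pair_res (P : Polarization c χ A) {V W : Over (baseF F s)} (f : V ⟶ W)
    (a : sec A W) (b : sec A ((conj s c).obj W)) :
    (P.pair V (res A f a) (res A ((conj s c).map f) b) :
        LocallyConstant (geom (toF F V)) (ZMod M)) =
      (P.pair W a b : LocallyConstant (geom (toF F W)) (ZMod M)).comap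
        (toContinuousMap (geomMap f.left (by simp [toF]))) :=
  P.natural f a b

/-- The pairings take values in functions on geometric points, so any jointly surjective family
detects their equality. For `LiftsWedge.of_local` separatedness of the exterior power is used,
whence the étaleness required there. -/
lemma PreservesPair.of_local {Rp : Over Sp}
    {ξ : restrict A (baseChange.obj Rp) ⟶ restrict B (baseChange.obj Rp)}
    {T : Over (baseChange (F := F) (s := s).obj Rp)}
    (h : ∀ t : T.left.left, ∃ (W : Over (baseF F s)) (i : W ⟶ T.left), t ∈ Set.range i.left ∧
      PreservesPair P Q ξ (Over.mk (i ≫ T.hom))) : PreservesPair P Q ξ T := by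
  intro a b
  refine Subtype.ext (geom_ext fun t => ?_)
  obtain ⟨W, i, ht, hi⟩ := h t
  refine ⟨W, i, ht, ?_⟩
  have h₁ := hi (res A i a) (res A ((conj s c).map i) b)
  rw [restrictMap_comp_res] at h₁
  have e : (conj s c).map (i ≫ T.hom) ≫ conjR c Rp = (conj s c).map i ≫ (conjOver c T).hom := by
    rw [Functor.map_comp, Category.assoc]
    rfl
  have h₂ := restrictMap_mk_congr ξ e (res A ((conj s c).map i) b)
  have h₃ := h₂.trans (restrictMap_comp_res ξ (conjOver c T) ((conj s c).map i) b)
  have h₄ := (congrArg _ h₃.symm).trans h₁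
  rw [← Q.pair_res, ← P.pair_res]
  exact congrArg Subtype.val h₄

lemma LiftsWedge.of_local {R : Over (baseF F s)} {ξ : restrict A R ⟶ restrict B R} {T : Over R}
    (h : ∀ t : T.left.left, ∃ (W : Over (baseF F s)) (i : W ⟶ T.left), Etale i.left ∧
      t ∈ Set.range i.left ∧ LiftsWedge η ξ (Over.mk (i ≫ T.hom))) : LiftsWedge η ξ T := by
  intro a
  refine sec_ext _ fun t => ?_
  obtain ⟨W, i, hi, ht, h⟩ := h t
  refine ⟨W, i, hi, ht, ?_⟩
  have h₁ := h (fun k => res A i (a k))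
  simp only [restrictMap_comp_res] at h₁
  erw [wedge_res, wedge_res, secMap_res] at h₁
  exact h₁

/-- The restriction of a morphism `A|_R ⟶ B|_R` to `R'`. -/
noncomputable abbrev pullHom {R R' : Over (baseF F s)} (f : R' ⟶ R) (ξ : restrict A R ⟶ restrict B R) :
    restrict A R' ⟶ restrict B R' :=
  (Over.map f).op.whiskerLeft ξ

lemma PreservesPair.of_pullHom {Rp Rp' : Over Sp} (f : Rp' ⟶ Rp)
    {ξ : restrict A (baseChange.obj Rp) ⟶ restrict B (baseChange.obj Rp)}
    {T : Over (baseF F s)} {g : T ⟶ baseChange.obj Rp'} {k : T ⟶ baseChange.obj Rp}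
    (hk : g ≫ baseChange.map f = k)
    (h : PreservesPair P Q (pullHom (baseChange.map f) ξ) (Over.mk g)) :
    PreservesPair P Q ξ (Over.mk k) := by
  subst hk
  intro a b
  have e : (conj s c).map (g ≫ baseChange.map f) ≫ conjR c Rp =
      ((conj s c).map g ≫ conjR c Rp') ≫ baseChange.map f := by
    rw [Functor.map_comp, Category.assoc, Category.assoc, conjR_naturality]
  exact (congrArg _ (restrictMap_mk_congr ξ e b)).trans (h a b)

lemma LiftsWedge.of_pullHom {R R' : Over (baseF F s)} (f : R' ⟶ R)
    {ξ : restrict A R ⟶ restrict B R} {T : Over (baseF F s)} {g : T ⟶ R'} {k : T ⟶ R}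
    (hk : g ≫ f = k) (h : LiftsWedge η (pullHom f ξ) (Over.mk g)) :
    LiftsWedge η ξ (Over.mk k) := by
  subst hk
  exact h

/-- The conditions on a polarized isomorphism concern all schemes over `R`, while coverings are
given over `R⁺`. Viewing `T` as an `S₀⁺`-scheme, by adjunction it maps to `R⁺`, and the covering can
be pulled back to it. -/
lemma exists_of_mem_over_baseChange {Rp : Over Sp} {R : Sieve Rp}
    (hR : R ∈ Scheme.etaleTopology.over Sp Rp) (T : Over (baseChange (F := F) (s := s).obj Rp))
    (t : T.left.left) :
    ∃ (W : Over (baseF F s)) (i : W ⟶ T.left) (Rp' : Over Sp) (f : Rp' ⟶ Rp)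
      (g : W ⟶ baseChange.obj Rp'), Etale i.left ∧ t ∈ Set.range i.left ∧ R f ∧
        g ≫ baseChange.map f = i ≫ T.hom := by
  let adj := Over.mapPullbackAdj (projPlus F s)
  let k := (adj.homEquiv _ _).symm T.hom
  obtain ⟨V, i, hi, ht, h⟩ := exists_of_mem_over (GrothendieckTopology.pullback_stable _ k hR) t
  let j : Over.mk (i.left ≫ T.left.hom) ⟶ T.left := Over.homMk i.left
  let e : (Over.map (projPlus F s)).obj (Over.mk (i.left ≫ T.left.hom)) ⟶ V :=
    Over.homMk (𝟙 _) (by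
      have := Over.w i
      dsimp at this ⊢
      rw [Category.id_comp, Category.assoc, this])
  refine ⟨_, j, _, (Over.map (projPlus F s)).map j ≫ k, adj.unit.app _, hi, ht, ?_, ?_⟩
  · have hj : (Over.map (projPlus F s)).map j = e ≫ i := by
      ext1
      exact (Category.id_comp _).symm
    rw [hj, Category.assoc]
    exact Sieve.downward_closed _ h e
  · have := adj.unit_naturality j
    have h' : adj.unit.app T.left ≫ baseChange.map k = T.hom :=
      (adj.homEquiv_unit ..).symm.trans (Equiv.apply_symm_apply ..)
    rw [Functor.map_comp, ← Category.assoc]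
    exact (congrArg (· ≫ baseChange.map k) this).trans
      ((Category.assoc _ _ _).trans (congrArg (j ≫ ·) h'))

lemma isSheaf_presheafHom_baseChange (A B : EtSheaf M (baseF F s)) :
    Presieve.IsSheaf (Scheme.etaleTopology.over Sp)
      ((baseChange (F := F) (s := s)).op ⋙ presheafHom A.obj B.obj) :=
  (isSheaf_iff_isSheaf_of_type _ _).1 (Functor.op_comp_isSheaf (Over.pullback (projPlus F s))
    (Scheme.etaleTopology.over Sp) (Scheme.etaleTopology.over (baseF F s))
    ⟨_, (isSheaf_iff_isSheaf_of_type _ _).2 (isSheaf_presheafHom A B)⟩)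

/-- An isomorphism and its inverse glue separately, as sections of sheaves of homomorphisms, and
remain inverse by separatedness. Preservation of the pairing and of `η` can be checked on the
covering. -/
lemma isSheaf_isomFunctor : Presieve.IsSheaf (Scheme.etaleTopology.over Sp) (isomFunctor P Q η) := by
  intro Rp R hR x hx
  obtain ⟨a, ha, ha'⟩ := isSheaf_presheafHom_baseChange A B R hR (fun Y f hf => (x f hf).iso.hom)
    (fun Y₁ Y₂ Z g₁ g₂ f₁ f₂ h₁ h₂ e => congrArg (fun y => y.iso.hom) (hx g₁ g₂ h₁ h₂ e))
  obtain ⟨b, hb, -⟩ := isSheaf_presheafHom_baseChange B A R hR (fun Y f hf => (x f hf).iso.inv)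
    (fun Y₁ Y₂ Z g₁ g₂ f₁ f₂ h₁ h₂ e => congrArg (fun y => y.iso.inv) (hx g₁ g₂ h₁ h₂ e))
  have ha₁ {Y : Over Sp} (f : Y ⟶ Rp) (hf : R f) :
      pullHom (baseChange.map f) a = (x f hf).iso.hom := ha f hf
  have hb₁ {Y : Over Sp} (f : Y ⟶ Rp) (hf : R f) :
      pullHom (baseChange.map f) b = (x f hf).iso.inv := hb f hf
  have hab : a ≫ b = 𝟙 _ := by
    refine (isSheaf_presheafHom_baseChange A A R hR).isSeparatedFor.ext fun Y f hf => ?_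
    change pullHom (baseChange.map f) a ≫ pullHom (baseChange.map f) b = 𝟙 _
    rw [ha₁ f hf, hb₁ f hf, Iso.hom_inv_id]
  have hba : b ≫ a = 𝟙 _ := by
    refine (isSheaf_presheafHom_baseChange B B R hR).isSeparatedFor.ext fun Y f hf => ?_
    change pullHom (baseChange.map f) b ≫ pullHom (baseChange.map f) a = 𝟙 _
    rw [ha₁ f hf, hb₁ f hf, Iso.inv_hom_id]
  refine ⟨⟨⟨a, b, hab, hba⟩, fun T => ?_, fun T => ?_⟩, fun Y f hf => ?_, fun y hy => ?_⟩
  · refine PreservesPair.of_local (P := P) (Q := Q) (ξ := a) (T := T) fun t => ?_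
    obtain ⟨W, i, Rp', f, g, -, ht, hf, e⟩ := exists_of_mem_over_baseChange hR T t
    refine ⟨W, i, ht, PreservesPair.of_pullHom f e ?_⟩
    rw [ha₁ f hf]
    exact (x f hf).pair_eq _
  · refine LiftsWedge.of_local (η := η) (ξ := a) (T := T) fun t => ?_
    obtain ⟨W, i, Rp', f, g, hi, ht, hf, e⟩ := exists_of_mem_over_baseChange hR T t
    refine ⟨W, i, hi, ht, LiftsWedge.of_pullHom (baseChange.map f) e ?_⟩
    rw [ha₁ f hf]
    exact (x f hf).wedge_eq _
  · exact PolarizedIso.ext (Iso.ext (ha₁ f hf))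
  · refine PolarizedIso.ext (Iso.ext (ha' _ fun Y f hf => ?_))
    exact congrArg (fun z => z.iso.hom) (hy f hf)

end Conj

/-! ### The quadratic extension generated by the roots of unity. -/

section Fields

variable {Fp F : Type u} [Field Fp] [Field F] [Algebra Fp F] (c : ComplexConjugation Fp F)

lemma star_eq_inv_of_pow_eq_one {N : ℕ} [NeZero N] {z : ℂ} (hz : z ^ N = 1) :
    star z = z⁻¹ :=
  (Complex.inv_eq_conj (Complex.norm_eq_one_of_pow_eq_one hz (NeZero.ne N))).symm

/-- Complex conjugation inverts roots of unity. -/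
lemma ComplexConjugation.onBase_of_pow_eq_one {N : ℕ} [NeZero N] {ζ : F} (hζ : ζ ^ N = 1) :
    c.onBase ζ = ζ⁻¹ := by
  obtain ⟨τ, hτ⟩ := c.isConj
  apply (algebraMap F (AlgebraicClosure F)).injective
  apply τ.injective
  rw [← c.restricts, hτ.eq, map_inv₀, map_inv₀]
  exact star_eq_inv_of_pow_eq_one (N := N) (by simp only [← map_pow, hζ, map_one])

/-- Conjugation inverts `ζ`, and `ζ = ζ⁻¹` would force `N ∣ 2`. -/
lemma ComplexConjugation.onBase_ne {N : ℕ} (hN : 2 < N) {ζ : F} (hζ : IsPrimitiveRoot ζ N) :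
    c.onBase ζ ≠ ζ := by
  have : NeZero N := ⟨by omega⟩
  rw [c.onBase_of_pow_eq_one hζ.pow_eq_one]
  intro h
  have h2 : ζ ^ 2 = 1 := by
    rw [pow_two]
    nth_rewrite 1 [← h]
    exact inv_mul_cancel₀ (hζ.ne_zero (by omega))
  exact absurd (Nat.le_of_dvd two_pos (hζ.dvd_of_pow_eq_one 2 h2)) (by omega)

/-- The root `ζ` is chosen to match the embedding of `ℚ(μ_N)⁺` in `F⁺`: that embedding extends to
`ℚ(μ_N)` with values in `F̄`, and the image of a primitive root lies in `F`, which contains all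
`N`-th roots of unity of `F̄`. -/
lemma exists_isPrimitiveRoot_add_inv {N : ℕ} (hN : 2 < N) [NumberField Fp]
    (hFp : Nonempty (NumberField.maximalRealSubfield (CyclotomicField N ℚ) →+* Fp))
    [IsCyclotomicExtension {N} Fp F] :
    ∃ (ζ : F) (t : Fp), IsPrimitiveRoot ζ N ∧ algebraMap Fp F t = ζ + ζ⁻¹ := by
  obtain ⟨ι⟩ := hFp
  have : NeZero N := ⟨by omega⟩
  have : NeZero (N : ℚ) := ⟨by exact_mod_cast NeZero.ne N⟩
  obtain ⟨ζ₀, hζ₀⟩ : ∃ ζ₀ : CyclotomicField N ℚ, IsPrimitiveRoot ζ₀ N :=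
    (CyclotomicField.isCyclotomicExtension N ℚ).exists_isPrimitiveRoot (Set.mem_singleton N)
      (NeZero.ne N)
  have hmem : ζ₀ + ζ₀⁻¹ ∈ NumberField.maximalRealSubfield (CyclotomicField N ℚ) := by
    intro φ
    rw [map_add, map_inv₀, star_add, star_inv₀, star_eq_inv_of_pow_eq_one (N := N)
      (by rw [← map_pow, hζ₀.pow_eq_one, map_one]), inv_inv, add_comm]
  let j : NumberField.maximalRealSubfield (CyclotomicField N ℚ) →+* AlgebraicClosure F :=
    ((algebraMap F (AlgebraicClosure F)).comp (algebraMap Fp F)).comp ι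
  let := j.toAlgebra
  let l : CyclotomicField N ℚ →ₐ[NumberField.maximalRealSubfield (CyclotomicField N ℚ)]
      AlgebraicClosure F := IsAlgClosed.lift
  have hl : IsPrimitiveRoot (l ζ₀) N := hζ₀.map_of_injective l.injective
  have hF := IsCyclotomicExtension.zeta_spec N Fp F
  obtain ⟨i, -, hi⟩ := (hF.map_of_injective
    (algebraMap F (AlgebraicClosure F)).injective).eq_pow_of_pow_eq_one hl.pow_eq_one
  rw [← map_pow] at hi
  refine ⟨_, ι ⟨_, hmem⟩, .of_map_of_injective (f := algebraMap F (AlgebraicClosure F))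
    (by rw [hi]; exact hl) (algebraMap F (AlgebraicClosure F)).injective, ?_⟩
  apply (algebraMap F (AlgebraicClosure F)).injective
  rw [map_add, map_inv₀, hi, ← map_inv₀, ← map_add]
  exact (l.commutes ⟨_, hmem⟩).symm

/-- Two homomorphisms from `F` to a field which agree on `F⁺` are equal or complex conjugate. -/
lemma eq_or_eq_comp_onBase {N : ℕ} (hN : 2 < N) [NumberField Fp]
    (hFp : Nonempty (NumberField.maximalRealSubfield (CyclotomicField N ℚ) →+* Fp))
    [IsCyclotomicExtension {N} Fp F] {κ : Type*} [Field κ] (α β : F →+* κ)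
    (h : α.comp (algebraMap Fp F) = β.comp (algebraMap Fp F)) :
    α = β ∨ α = β.comp (c.onBase : F →+* F) := by
  obtain ⟨ζ, t, hζ, ht⟩ := exists_isPrimitiveRoot_add_inv (F := F) hN hFp
  have : NeZero N := ⟨by omega⟩
  have htop := IsCyclotomicExtension.adjoin_primitive_root_eq_top (A := Fp) hζ
  let := (β.comp (algebraMap Fp F)).toAlgebra
  -- Since `F = F⁺(ζ)`, a homomorphism with given restriction to `F⁺` is determined by the image of
  -- `ζ`.
  have ext (γ : F →+* κ) (hγ : γ.comp (algebraMap Fp F) = β.comp (algebraMap Fp F))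
      (e : α ζ = γ ζ) : α = γ := by
    let α' : F →ₐ[Fp] κ := { α with commutes' := fun x => congrArg (fun f => f x) h }
    let γ' : F →ₐ[Fp] κ := { γ with commutes' := fun x => congrArg (fun f => f x) hγ }
    have : α' = γ' := AlgHom.ext_of_adjoin_eq_top htop (by
      rintro _ rfl
      exact e)
    exact congrArg (fun f : F →ₐ[Fp] κ => (f : F →+* κ)) this
  have h0 : ζ ≠ 0 := hζ.ne_zero (by omega)
  have hα := congrArg (fun f => f t) h
  simp only [RingHom.comp_apply, ht, map_add, map_inv₀] at hα
  have hα0 : α ζ ≠ 0 := by simpa using h0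
  have hβ0 : β ζ ≠ 0 := by simpa using h0
  -- The element `α ζ` is a root of `X² - tX + 1`, with `t` the common image of `ζ + ζ⁻¹`; the roots
  -- of this polynomial are `β ζ` and its inverse.
  have : (α ζ - β ζ) * (α ζ - (β ζ)⁻¹) = 0 := by
    field_simp at hα ⊢
    linear_combination hα
  rcases mul_eq_zero.1 this with h' | h'
  · exact .inl (ext β rfl (sub_eq_zero.1 h'))
  · refine .inr (ext _ ?_ ?_)
    · ext x
      simp
    · simp [c.onBase_of_pow_eq_one hζ.pow_eq_one, sub_eq_zero.1 h']

end Fields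

/-! ### Splitting of the double cover over a scheme which maps to `S₀`. -/

section Geometry

variable {Fp F : Type u} [Field Fp] [Field F] [Algebra Fp F] {Sp : Scheme.{u}}
  {s : Sp ⟶ Spec (.of Fp)}

/-- The section of `R ⟶ R⁺` given by a lift of `R⁺ ⟶ S₀⁺` to `S₀`. -/
noncomputable def sheetι {Rp : Over Sp} (h : Rp.left ⟶ baseF F s)
    (w : h ≫ projPlus F s = Rp.hom) : Over.mk h ⟶ baseChange.obj Rp :=
  Over.homMk (pullback.lift (𝟙 _) h (by simp [w])) (pullback.lift_snd _ _ _)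

lemma sheetι_fst {Rp : Over Sp} (h : Rp.left ⟶ baseF F s) (w : h ≫ projPlus F s = Rp.hom) :
    (sheetι h w).left ≫ pullback.fst Rp.hom (projPlus F s) = 𝟙 _ :=
  pullback.lift_fst _ _ _

lemma etale_projPlus [CharZero Fp] [FiniteDimensional Fp F] :
    Etale (projPlus F s) := by
  have : Etale (Spec.map (CommRingCat.ofHom (algebraMap Fp F))) :=
    (HasRingHomProperty.Spec_iff (P := @Etale)).2 (RingHom.etale_algebraMap.2
      ⟨Algebra.FormallyEtale.of_isSeparable Fp F,
        Algebra.FinitePresentation.of_finiteType.1 (inferInstanceAs (Algebra.FiniteType Fp F))⟩)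
  infer_instance

instance mono_sheetι {Rp : Over Sp} (h : Rp.left ⟶ baseF F s)
    (w : h ≫ projPlus F s = Rp.hom) : Mono (sheetι h w) := by
  refine ⟨fun a b e => ?_⟩
  ext1
  have := congrArg (fun f => f.left ≫ pullback.fst Rp.hom (projPlus F s)) e
  simpa [sheetι_fst] using this

/-- A section of an étale morphism is étale. -/
lemma etale_sheetι [CharZero Fp] [FiniteDimensional Fp F] {Rp : Over Sp}
    (h : Rp.left ⟶ baseF F s) (w : h ≫ projPlus F s = Rp.hom) : Etale (sheetι h w).left := by
  have := etale_projPlus (F := F) (s := s)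
  have h₁ : Etale (pullback.fst Rp.hom (projPlus F s)) := inferInstance
  have h₂ : Etale ((sheetι h w).left ≫ pullback.fst Rp.hom (projPlus F s)) := by
    rw [sheetι_fst]
    infer_instance
  exact Etale.of_comp _ (pullback.fst Rp.hom (projPlus F s))

variable (c : ComplexConjugation Fp F)

/-- Every point of `R` lies on the sheet of a lift `R⁺ ⟶ S₀` or on its conjugate. -/
lemma mem_range_sheetι {N : ℕ} (hN : 2 < N) [NumberField Fp]
    (hFp : Nonempty (NumberField.maximalRealSubfield (CyclotomicField N ℚ) →+* Fp))
    [IsCyclotomicExtension {N} Fp F] {Rp : Over Sp} (h : Rp.left ⟶ baseF F s)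
    (w : h ≫ projPlus F s = Rp.hom) (w' : (h ≫ conjBase s c) ≫ projPlus F s = Rp.hom)
    (z : (baseChange (F := F) (s := s).obj Rp).left) :
    z ∈ Set.range (sheetι h w).left ∨ z ∈ Set.range (sheetι (h ≫ conjBase s c) w').left := by
  let R := (baseChange (F := F) (s := s).obj Rp).left
  let g : Spec (R.residueField z) ⟶ R := R.fromSpecResidueField z
  let p : R ⟶ Rp.left := pullback.fst Rp.hom (projPlus F s)
  let q : R ⟶ baseF F s := pullback.snd Rp.hom (projPlus F s)
  let toSpec : baseF F s ⟶ Spec (.of F) := pullback.snd _ _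
  -- The point `z` gives two homomorphisms from `F` to its residue field, `α` through the projection
  -- to `S₀` and `β` through `h`. They agree on `F⁺`, so they are equal or conjugate, and this
  -- decides the sheet.
  obtain ⟨α, hα⟩ := Spec.map_surjective (g ≫ q ≫ toSpec)
  obtain ⟨β, hβ⟩ := Spec.map_surjective (g ≫ p ≫ h ≫ toSpec)
  have hq : q ≫ projPlus F s = p ≫ Rp.hom := pullback.condition.symm
  have hs : toSpec ≫ Spec.map (CommRingCat.ofHom (algebraMap Fp F)) = projPlus F s ≫ s :=
    pullback.condition.symm
  have e : α.hom.comp (algebraMap Fp F) = β.hom.comp (algebraMap Fp F) := by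
    have : CommRingCat.ofHom (algebraMap Fp F) ≫ α = CommRingCat.ofHom (algebraMap Fp F) ≫ β := by
      apply Spec.map_injective
      rw [Spec.map_comp, Spec.map_comp, hα, hβ]
      simp only [Category.assoc, hs]
      rw [reassoc_of% hq, reassoc_of% w]
    exact congrArg CommRingCat.Hom.hom this
  have key (h' : Rp.left ⟶ baseF F s) (w : h' ≫ projPlus F s = Rp.hom)
      (hh : g ≫ p ≫ h' ≫ toSpec = g ≫ q ≫ toSpec) : z ∈ Set.range (sheetι h' w).left := by
    have hp : (sheetι h' w).left ≫ p = 𝟙 _ := sheetι_fst h' w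
    have hq' : (sheetι h' w).left ≫ q = h' := pullback.lift_snd _ _ _
    have e : g = (g ≫ p) ≫ (sheetι h' w).left := by
      refine pullback.hom_ext ?_ (pullback.hom_ext ?_ ?_)
      · change g ≫ p = ((g ≫ p) ≫ (sheetι h' w).left) ≫ p
        rw [Category.assoc, hp]
        exact (Category.comp_id _).symm
      · change (g ≫ q) ≫ projPlus F s = (((g ≫ p) ≫ (sheetι h' w).left) ≫ q) ≫ projPlus F s
        simp only [Category.assoc, hq]
        rw [reassoc_of% hp]
      · change (g ≫ q) ≫ toSpec = (((g ≫ p) ≫ (sheetι h' w).left) ≫ q) ≫ toSpec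
        simp only [Category.assoc, ← hh]
        rw [reassoc_of% hq']
    have hz : z ∈ Set.range g := by
      rw [Scheme.range_fromSpecResidueField]
      rfl
    obtain ⟨y, hy⟩ := hz
    refine ⟨(g ≫ p) y, ?_⟩
    rw [← Scheme.Hom.comp_apply, ← e, hy]
  rcases eq_or_eq_comp_onBase c hN hFp α.hom β.hom e with h₁ | h₁
  · refine .inl (key h w ?_)
    rw [← hα, ← hβ, CommRingCat.hom_ext h₁]
  · refine .inr (key (h ≫ conjBase s c) w' ?_)
    have hc : conjBase s c ≫ toSpec =
      toSpec ≫ Spec.map (CommRingCat.ofHom (c.onBase : F →+* F)) := conjBase_snd s c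
    have : α = CommRingCat.ofHom (c.onBase : F →+* F) ≫ β := CommRingCat.hom_ext h₁
    rw [← hα, this, Spec.map_comp, hβ]
    simp only [Category.assoc, hc]

/-- A lift of `R⁺ ⟶ S₀⁺` to `S₀` and its conjugate are disjoint. -/
lemma isEmpty_of_comp_conjBase {N : ℕ} (hN : 2 < N) {ζ : F} (hζ : IsPrimitiveRoot ζ N)
    {T : Scheme.{u}} (f : T ⟶ baseF F s) (hf : f ≫ conjBase s c = f) : IsEmpty T := by
  refine ⟨fun t => ?_⟩
  let g := T.fromSpecResidueField t ≫ f ≫ pullback.snd _ _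
  obtain ⟨α, hα⟩ := Spec.map_surjective g
  -- A point of `T` would give an embedding of `F` in a residue field invariant under `c`, although
  -- `c` moves `ζ`.
  have : CommRingCat.ofHom (c.onBase : F →+* F) ≫ α = α := by
    apply Spec.map_injective
    rw [Spec.map_comp, hα]
    simp only [g, Category.assoc]
    rw [← conjBase_snd, reassoc_of% hf]
  exact c.onBase_ne hN hζ (α.hom.injective (congrArg (fun φ => φ.hom ζ) this))

lemma conjR_fst (Rp : Over Sp) : (conjR (s := s) c Rp).left ≫ pullback.fst Rp.hom (projPlus F s) =
    pullback.fst Rp.hom (projPlus F s) :=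
  pullback.lift_fst _ _ _

lemma conjR_snd (Rp : Over Sp) : (conjR (s := s) c Rp).left ≫ pullback.snd Rp.hom (projPlus F s) =
    pullback.snd Rp.hom (projPlus F s) ≫ conjBase s c :=
  pullback.lift_snd _ _ _

lemma sheetι_snd {Rp : Over Sp} (h : Rp.left ⟶ baseF F s) (w : h ≫ projPlus F s = Rp.hom) :
    (sheetι h w).left ≫ pullback.snd Rp.hom (projPlus F s) = h :=
  pullback.lift_snd _ _ _

/-- Conjugation of `R` exchanges the two sheets. In the opposite direction, `conj_map_sheetι_conj`,
the identification `conjConj` appears because the lift has been conjugated twice. -/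
lemma conj_map_sheetι {Rp : Over Sp} (h : Rp.left ⟶ baseF F s)
    (w : h ≫ projPlus F s = Rp.hom) (w' : (h ≫ conjBase s c) ≫ projPlus F s = Rp.hom) :
    (conj s c).map (sheetι h w) ≫ conjR c Rp = sheetι (h ≫ conjBase s c) w' := by
  ext1
  refine pullback.hom_ext ?_ ?_
  · change ((sheetι h w).left ≫ (conjR c Rp).left) ≫ pullback.fst _ _ = _
    rw [Category.assoc, conjR_fst, sheetι_fst, sheetι_fst]
    rfl
  · change ((sheetι h w).left ≫ (conjR c Rp).left) ≫ pullback.snd _ _ = _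
    rw [Category.assoc, conjR_snd, ← Category.assoc, sheetι_snd, sheetι_snd]

lemma conj_map_sheetι_conj {Rp : Over Sp} (h : Rp.left ⟶ baseF F s)
    (w : h ≫ projPlus F s = Rp.hom) (w' : (h ≫ conjBase s c) ≫ projPlus F s = Rp.hom) :
    (conj s c).map (sheetι (h ≫ conjBase s c) w') ≫ conjR c Rp =
      conjConj c (Over.mk h) ≫ sheetι h w := by
  ext1
  refine pullback.hom_ext ?_ ?_
  · change ((sheetι (h ≫ conjBase s c) w').left ≫ (conjR c Rp).left) ≫ pullback.fst _ _ =
      (𝟙 _ ≫ (sheetι h w).left) ≫ pullback.fst _ _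
    rw [Category.assoc, conjR_fst, Category.id_comp, sheetι_fst, sheetι_fst]
    rfl
  · change ((sheetι (h ≫ conjBase s c) w').left ≫ (conjR c Rp).left) ≫ pullback.snd _ _ =
      (𝟙 _ ≫ (sheetι h w).left) ≫ pullback.snd _ _
    rw [Category.assoc, conjR_snd, Category.id_comp, ← Category.assoc, sheetι_snd, sheetι_snd,
      Category.assoc, conjBase_conjBase, Category.comp_id]

/-- Sections of a sheaf over two disjoint étale subobjects which cover `R` glue. -/
lemma sheaf_glue_of_disjoint {S : Scheme.{u}} {Φ : (Over S)ᵒᵖ ⥤ Type w}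
    (hΦ : Presieve.IsSheaf (Scheme.etaleTopology.over S) Φ) {R V₁ V₂ : Over S} (i₁ : V₁ ⟶ R)
    (i₂ : V₂ ⟶ R) [Mono i₁] [Mono i₂] (h₁ : Etale i₁.left) (h₂ : Etale i₂.left)
    (hcov : ∀ z, z ∈ Set.range i₁.left ∨ z ∈ Set.range i₂.left)
    (hdisj : ∀ {T : Over S} (a : T ⟶ V₁) (b : T ⟶ V₂), a ≫ i₁ = b ≫ i₂ → IsEmpty T.left)
    (ξ₁ : Φ.obj (op V₁)) (ξ₂ : Φ.obj (op V₂)) :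
    ∃ ξ : Φ.obj (op R), Φ.map i₁.op ξ = ξ₁ ∧ Φ.map i₂.op ξ = ξ₂ := by
  refine (sheaf_glue hΦ (T := R) (fun {W} i a => (∃ l, l ≫ i₁ = i ∧ a = Φ.map l.op ξ₁) ∨
      ∃ l, l ≫ i₂ = i ∧ a = Φ.map l.op ξ₂) ?_ ?_ ?_).imp fun ξ hξ =>
    ⟨hξ i₁ _ (.inl ⟨𝟙 _, by simp⟩), hξ i₂ _ (.inr ⟨𝟙 _, by simp⟩)⟩
  · rintro W i a b (⟨l, hl, rfl⟩ | ⟨l, hl, rfl⟩) (⟨l', hl', rfl⟩ | ⟨l', hl', rfl⟩)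
    · rw [(cancel_mono i₁).1 (hl.trans hl'.symm)]
    · have := hdisj l l' (hl.trans hl'.symm)
      exact sheaf_ext hΦ fun t => isEmptyElim t
    · have := hdisj l' l (hl'.trans hl.symm)
      exact sheaf_ext hΦ fun t => isEmptyElim t
    · rw [(cancel_mono i₂).1 (hl.trans hl'.symm)]
  · rintro W W' i j a (⟨l, rfl, rfl⟩ | ⟨l, rfl, rfl⟩)
    · exact .inl ⟨j ≫ l, by simp, by rw [op_comp, Functor.map_comp_apply]⟩
    · exact .inr ⟨j ≫ l, by simp, by rw [op_comp, Functor.map_comp_apply]⟩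
  · intro t
    rcases hcov t with h | h
    · exact ⟨_, i₁, h₁, h, ξ₁, .inl ⟨𝟙 _, by simp⟩⟩
    · exact ⟨_, i₂, h₂, h, ξ₂, .inr ⟨𝟙 _, by simp⟩⟩

end Geometry

/-! ### Frames of lisse sheaves and their exterior powers. -/

section Lisse

variable {M : ℕ} {S : Scheme.{u}}

/-- A trivialisation of `A` over `V`: an isomorphism of `A|_V` with the constant sheaf
`(ℤ/M)ⁿ`. -/
structure Triv (A : EtSheaf M S) (n : ℕ) (V : Over S) where
  e (T : Over V) : sec A T.left ≃ₗ[ZMod M] LocallyConstant T.left.left (Fin n → ZMod M)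
  natural {T T' : Over V} (f : T' ⟶ T) (a : sec A T.left) :
    e T' (res A f.left a) = (e T a).comap (toContinuousMap f.left.left)

lemma sum_smul_const_single (X : Type*) [TopologicalSpace X] {n : ℕ} (r : Fin n → ZMod M) :
    ∑ j, r j • LocallyConstant.const X (Pi.single j 1 : Fin n → ZMod M) =
      LocallyConstant.const X r := by
  have (v : Fin n → ZMod M) : LocallyConstant.const X v =
      LocallyConstant.constₗ (ZMod M) v := rfl
  simp only [this, ← map_smul, ← map_sum]
  congr 1
  ext k
  simp [Finset.sum_apply, Pi.single_apply]

namespace Triv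

variable {A B : EtSheaf M S} {n : ℕ} {V : Over S} (t : Triv A n V)

/-- The restriction of a trivialisation. -/
noncomputable def restrict {V' : Over S} (f : V' ⟶ V) : Triv A n V' where
  e T := t.e ((Over.map f).obj T)
  natural g a := t.natural ((Over.map f).map g) a

/-- The frame given by a trivialisation. -/
noncomputable def frame (k : Fin n) : sec A V :=
  (t.e (Over.mk (𝟙 V))).symm (LocallyConstant.const _ (Pi.single k 1))

lemma e_res_frame {T : Over S} (f : T ⟶ V) (k : Fin n) :
    t.e (Over.mk f) (res A f (t.frame k)) = LocallyConstant.const _ (Pi.single k 1) := by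
  have := t.natural (Over.homMk f : Over.mk f ⟶ Over.mk (𝟙 V)) (t.frame k)
  refine this.trans ?_
  rw [frame, LinearEquiv.apply_symm_apply]
  rfl

lemma res_frame {T : Over S} (f : T ⟶ V) (k : Fin n) :
    res A f (t.frame k) = (t.restrict f).frame k := by
  apply ((t.restrict f).e (Over.mk (𝟙 T))).injective
  refine Eq.trans ?_ (((t.restrict f).e (Over.mk (𝟙 T))).apply_symm_apply _).symm
  exact (congrArg (fun g => t.e (Over.mk (𝟙 T ≫ f)) (res A g (t.frame k)))
    (Category.id_comp f).symm).trans (t.e_res_frame (𝟙 T ≫ f) k)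

/-- The coordinates of a section at a point. -/
noncomputable def coord {T : Over S} (f : T ⟶ V) (x : T.left) : sec A T →ₗ[ZMod M] Fin n → ZMod M where
  toFun a := t.e (Over.mk f) a x
  map_add' a b := by
    rw [map_add]
    rfl
  map_smul' r a := by
    rw [map_smul]
    rfl

lemma coord_res_frame {T : Over S} (f : T ⟶ V) (x : T.left) (k : Fin n) :
    t.coord f x (res A f (t.frame k)) = Pi.single k 1 :=
  congrArg (fun φ => φ x) (t.e_res_frame f k)

lemma coord_sum {T : Over S} (f : T ⟶ V) (x : T.left) (r : Fin n → ZMod M) :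
    t.coord f x (∑ j, r j • res A f (t.frame j)) = r := by
  simp only [map_sum, map_smul, coord_res_frame]
  ext k
  simp [Finset.sum_apply, Pi.single_apply]

/-- Sections of a trivialised sheaf are étale locally linear combinations of the frame. -/
lemma exists_res_eq {T : Over S} (f : T ⟶ V) {m : ℕ} (a : Fin m → sec A T) (x : T.left) :
    ∃ (W : Over S) (i : W ⟶ T), Etale i.left ∧ x ∈ Set.range i.left ∧
      ∃ α : Matrix (Fin n) (Fin m) (ZMod M),
        ∀ k, res A i (a k) = ∑ j, α j k • res A (i ≫ f) (t.frame j) := by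
  -- On this open set the coordinates of all the `a k` are constant, equal to their values at `x`.
  let U : T.left.Opens := ⟨⋂ k, (fun y => t.e (Over.mk f) (a k) y) ⁻¹' {t.e (Over.mk f) (a k) x},
    isOpen_iInter_of_finite fun k => (t.e (Over.mk f) (a k)).isLocallyConstant _⟩
  let i : Over.mk (U.ι ≫ T.hom) ⟶ T := Over.homMk U.ι
  refine ⟨_, i, ?_, ⟨⟨x, ?_⟩, rfl⟩, Matrix.of fun j k => t.e (Over.mk f) (a k) x j, fun k => ?_⟩
  · exact inferInstanceAs (Etale U.ι)
  · simp [U]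
  · apply (t.e (Over.mk (i ≫ f))).injective
    have := t.natural (Over.homMk i : Over.mk (i ≫ f) ⟶ Over.mk f) (a k)
    refine this.trans ?_
    simp only [map_sum, map_smul, e_res_frame, Matrix.of_apply, sum_smul_const_single]
    ext1 y
    exact Set.mem_iInter.1 y.2 k

/-- The trivialisation whose frame is obtained from that of `t` by an invertible matrix. -/
noncomputable def change (r : (Matrix (Fin n) (Fin n) (ZMod M))ˣ) : Triv A n V where
  -- Coordinates are multiplied by the inverse of `r`, so that the frame itself is multiplied by
  -- `r`.
  e T := (t.e T).trans (LocallyConstant.congrRightₗ (ZMod M)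
    (Matrix.toLin'OfInv r.mul_inv r.inv_mul))
  natural f a :=
    congrArg (LocallyConstant.map (Matrix.toLin'OfInv r.mul_inv r.inv_mul)) (t.natural f a)

lemma frame_change (r : (Matrix (Fin n) (Fin n) (ZMod M))ˣ) (k : Fin n) :
    (t.change r).frame k = ∑ j, (r : Matrix (Fin n) (Fin n) (ZMod M)) j k • t.frame j := by
  apply ((t.change r).e (Over.mk (𝟙 V))).injective
  refine ((t.change r).e (Over.mk (𝟙 V))).apply_symm_apply _ |>.trans ?_
  have h (j : Fin n) : t.e (Over.mk (𝟙 V)) (t.frame j) = LocallyConstant.const _ (Pi.single j 1) :=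
    (t.e (Over.mk (𝟙 V))).apply_symm_apply _
  change _ = LocallyConstant.map _ (t.e (Over.mk (𝟙 V)) _)
  simp only [map_sum, map_smul, h, sum_smul_const_single]
  ext1 x
  change Pi.single k 1 = (↑r⁻¹ : Matrix (Fin n) (Fin n) (ZMod M)).mulVec
    fun j => (r : Matrix (Fin n) (Fin n) (ZMod M)) j k
  have : (fun j => (r : Matrix (Fin n) (Fin n) (ZMod M)) j k) =
      (r : Matrix (Fin n) (Fin n) (ZMod M)).mulVec (Pi.single k 1) := by
    simp
    rfl
  rw [this, Matrix.mulVec_mulVec, r.inv_mul, Matrix.one_mulVec]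

/-- The isomorphism which identifies the frames of two trivialisations. -/
noncomputable def iso (t : Triv A n V) (t' : Triv B n V) :
    GaloisDescent.restrict A V ≅ GaloisDescent.restrict B V :=
  NatIso.ofComponents (fun T => ((t.e T.unop).trans (t'.e T.unop).symm).toModuleIso) (by
    intro T T' f
    ext a
    apply (t'.e T'.unop).injective
    exact ((t'.e T'.unop).apply_symm_apply _).trans ((t.natural f.unop a).trans
      ((t'.natural f.unop _).trans (congrArg (LocallyConstant.comap _)
        ((t'.e T.unop).apply_symm_apply _))).symm))

lemma iso_hom_frame (t : Triv A n V) (t' : Triv B n V) {T : Over S} (f : T ⟶ V) (k : Fin n) :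
    restrictMap (iso t t').hom (Over.mk f) (res A f (t.frame k)) = res B f (t'.frame k) := by
  apply (t'.e (Over.mk f)).injective
  refine ((t'.e (Over.mk f)).apply_symm_apply _).trans ?_
  rw [e_res_frame]
  exact t.e_res_frame f k

lemma hom_ext {ξ ξ' : GaloisDescent.restrict A V ⟶ GaloisDescent.restrict B V}
    (h : ∀ k, restrictMap ξ (Over.mk (𝟙 V)) (t.frame k) =
      restrictMap ξ' (Over.mk (𝟙 V)) (t.frame k)) : ξ = ξ' := by
  have (T : Over V) (a : sec A T.left) : restrictMap ξ T a = restrictMap ξ' T a := by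
    refine sec_ext B fun x => ?_
    obtain ⟨W, i, hi, hx, α, hα⟩ := t.exists_res_eq T.hom (m := 1) (fun _ => a) x
    refine ⟨W, i, hi, hx, ?_⟩
    have key (ζ : GaloisDescent.restrict A V ⟶ GaloisDescent.restrict B V) :
        res B i (restrictMap ζ T a) = ∑ j, α j 0 • res B (i ≫ T.hom)
          (restrictMap ζ (Over.mk (𝟙 V)) (t.frame j)) := by
      rw [← restrictMap_comp_res, hα 0, map_sum]
      refine Finset.sum_congr rfl fun j _ => ?_
      rw [map_smul]
      congr 1
      exact restrictMap_res ζ (Over.homMk (i ≫ T.hom) : Over.mk (i ≫ T.hom) ⟶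
        Over.mk (𝟙 V)) (t.frame j)
    rw [key, key]
    simp only [h]
  ext T a
  exact this T.unop a

end Triv

/-- The exterior product, as an alternating map. -/
noncomputable def wedgeAlternating (n : ℕ) (A : EtSheaf M S) (V : Over S) :
    sec A V [⋀^Fin n]→ₗ[ZMod M] sec (extPower n A) V :=
  ((toSheafify (Scheme.etaleTopology.over S)
      (A.obj ⋙ ModuleCat.exteriorPower.functor.{u + 1} (ZMod M) n)).app (op V)).hom.compAlternatingMap
    (exteriorPower.ιMulti (ZMod M) n)

/-- Both sides are alternating in the columns of `α`, so it suffices to compare them on permutations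
of the standard basis. -/
lemma wedge_sum {n : ℕ} (A : EtSheaf M S) (V : Over S) (e : Fin n → sec A V)
    (α : Matrix (Fin n) (Fin n) (ZMod M)) :
    wedge A V (fun k => ∑ j, α j k • e j) = α.det • wedge A V e := by
  let L : (Fin n → ZMod M) →ₗ[ZMod M] sec A V := Fintype.linearCombination (ZMod M) e
  let f : (Fin n → ZMod M) [⋀^Fin n]→ₗ[ZMod M] sec (extPower n A) V :=
    (wedgeAlternating n A V).compLinearMap L
  let g : (Fin n → ZMod M) [⋀^Fin n]→ₗ[ZMod M] sec (extPower n A) V :=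
    (LinearMap.toSpanSingleton (ZMod M) _ (wedge A V e)).compAlternatingMap Matrix.detRowAlternating
  have hfg : f = g := by
    refine Module.Basis.ext_alternating (Pi.basisFun (ZMod M) (Fin n)) fun v hv => ?_
    obtain ⟨σ, rfl⟩ : ∃ σ : Equiv.Perm (Fin n), v = σ :=
      ⟨Equiv.ofBijective v (Finite.injective_iff_bijective.1 hv), rfl⟩
    have h₁ : f (fun i => Pi.basisFun (ZMod M) (Fin n) i) =
        g fun i => Pi.basisFun (ZMod M) (Fin n) i := by
      have hL (i : Fin n) : L (Pi.basisFun (ZMod M) (Fin n) i) = e i := by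
        simp [L, Fintype.linearCombination_apply_single]
      have hd : Matrix.detRowAlternating (fun i => Pi.basisFun (ZMod M) (Fin n) i) = 1 := by
        refine Eq.trans ?_ (Matrix.det_one (n := Fin n) (R := ZMod M))
        congr 1
        ext i j
        simp [Matrix.one_apply, Pi.single_apply, eq_comm]
      change wedgeAlternating n A V (fun i => L _) =
        Matrix.detRowAlternating (R := ZMod M) (n := Fin n) _ • wedge A V e
      simp only [hL, hd, one_smul]
      rfl
    exact (f.map_perm _ σ).trans ((congrArg _ h₁).trans (g.map_perm _ σ).symm)
  have := congrArg (fun φ => φ (fun k j => α j k)) hfg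
  refine Eq.trans ?_ (this.trans (congrArg (fun d => d • wedge A V e) (Matrix.det_transpose α)))
  rfl

/-- The map to the associated sheaf is only locally injective, so the equality is first lifted to
the presheaf over an étale neighbourhood of `x`. There the determinant of the coordinates at a point
above `x` takes the value one on the frame and reads off the scalar. -/
lemma Triv.eq_of_smul_wedge_eq {A : EtSheaf M S} {n : ℕ} {V : Over S} (t : Triv A n V)
    {T : Over S} (f : T ⟶ V) (x : T.left) {r r' : ZMod M}
    (h : r • wedge A T (fun k => res A f (t.frame k)) =
      r' • wedge A T (fun k => res A f (t.frame k))) : r = r' := by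
  let p := A.obj ⋙ ModuleCat.exteriorPower.functor.{u + 1} (ZMod M) n
  let ω : p.obj (op T) := exteriorPower.ιMulti (ZMod M) n fun k => res A f (t.frame k)
  have h' : (toSheafify (Scheme.etaleTopology.over S) p).app (op T) (r • ω) =
      (toSheafify (Scheme.etaleTopology.over S) p).app (op T) (r' • ω) := by
    refine (map_smul ((toSheafify (Scheme.etaleTopology.over S) p).app (op T)).hom r ω).trans
      (Eq.trans h (map_smul ((toSheafify (Scheme.etaleTopology.over S) p).app (op T)).hom r' ω).symm)
  obtain ⟨W, i, hi, ⟨w, -⟩, e⟩ := exists_of_mem_over (Presheaf.equalizerSieve_mem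
    (Scheme.etaleTopology.over S) (toSheafify (Scheme.etaleTopology.over S) p) _ _ h') x
  let L : ⋀[ZMod M]^n (sec A W) →ₗ[ZMod M] ZMod M := exteriorPower.alternatingMapLinearEquiv
    (Matrix.detRowAlternating.compLinearMap (t.coord (i ≫ f) w))
  have key (r : ZMod M) : L (p.map i.op (r • ω)) = r := by
    have h₁ : p.map i.op (r • ω) = r • exteriorPower.ιMulti (ZMod M) n
        fun k => res A (i ≫ f) (t.frame k) := by
      refine (map_smul (p.map i.op).hom r ω).trans (congrArg (r • ·) ?_)
      refine (exteriorPower.map_apply_ιMulti (res A i) _).trans (congrArg _ ?_)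
      ext k
      exact res_res _ _ _ _
    have h₂ : L (exteriorPower.ιMulti (ZMod M) n fun k => res A (i ≫ f) (t.frame k)) = 1 := by
      refine (exteriorPower.alternatingMapLinearEquiv_apply_ιMulti _ _).trans ?_
      change Matrix.detRowAlternating (R := ZMod M) (n := Fin n)
        (fun k => t.coord (i ≫ f) w (res A (i ≫ f) (t.frame k))) = 1
      simp only [coord_res_frame]
      refine Eq.trans ?_ (Matrix.det_one (n := Fin n) (R := ZMod M))
      congr 1
      ext i j
      simp [Matrix.one_apply, Pi.single_apply, eq_comm]
    rw [h₁, map_smul, h₂, smul_eq_mul, mul_one]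
  rw [← key r, ← key r']
  exact congrArg L e

/-- The map from the exterior power of the sections to the sections of the exterior power. -/
noncomputable def toExtPower (n : ℕ) (A : EtSheaf M S) (V : Over S) :
    ⋀[ZMod M]^n (sec A V) →ₗ[ZMod M] sec (extPower n A) V :=
  ((toSheafify (Scheme.etaleTopology.over S)
      (A.obj ⋙ ModuleCat.exteriorPower.functor.{u + 1} (ZMod M) n)).app (op V)).hom

/-- Locally a section comes from the presheaf, hence is a sum of decomposable elements, and each of
these is locally a multiple of the exterior product of the frame. -/
lemma Triv.exists_res_eq_smul_wedge {A : EtSheaf M S} {n : ℕ} {V : Over S} (t : Triv A n V)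
    {T : Over S} (f : T ⟶ V) (a : sec (extPower n A) T) (x : T.left) :
    ∃ (W : Over S) (i : W ⟶ T), Etale i.left ∧ x ∈ Set.range i.left ∧
      ∃ r : ZMod M, res (extPower n A) i a = r • wedge A W fun k => res A (i ≫ f) (t.frame k) := by
  -- The statement ranges over all `T'` over `T`, because in the additive step the neighbourhood for
  -- the second summand is taken inside that for the first.
  have key {T : Over S} (y : ⋀[ZMod M]^n (sec A T)) : ∀ {T' : Over S} (g : T' ⟶ T) (f : T' ⟶ V)
      (x : T'.left), ∃ (W : Over S) (i : W ⟶ T'), Etale i.left ∧ x ∈ Set.range i.left ∧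
      ∃ r : ZMod M, res (extPower n A) (i ≫ g) (toExtPower n A T y) =
          r • wedge A W fun k => res A (i ≫ f) (t.frame k) := by
    have hy : y ∈ Submodule.span (ZMod M) (Set.range (exteriorPower.ιMulti (ZMod M) n)) := by
      rw [exteriorPower.ιMulti_span]
      trivial
    induction hy using Submodule.span_induction with
    | mem y hy =>
      intro T' g f x
      obtain ⟨a, rfl⟩ := hy
      obtain ⟨W, i, hi, hx, α, hα⟩ := t.exists_res_eq f (fun k => res A g (a k)) x
      refine ⟨W, i, hi, hx, α.det, ?_⟩
      rw [← wedge_sum]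
      refine (wedge_res A (i ≫ g) a).symm.trans ?_
      simp only [← hα, res_res]
    | zero =>
      intro T' g f x
      refine ⟨T', 𝟙 T', inferInstanceAs (Etale (𝟙 T'.left)), ⟨x, rfl⟩, 0, ?_⟩
      rw [map_zero, map_zero, zero_smul]
    | add y z _ _ hy hz =>
      intro T' g f x
      obtain ⟨W, i, hi, ⟨w, rfl⟩, r, hr⟩ := hy g f x
      obtain ⟨W', i', hi', ⟨w', rfl⟩, r', hr'⟩ := hz (i ≫ g) (i ≫ f) w
      refine ⟨W', i' ≫ i, inferInstanceAs (Etale (i'.left ≫ i.left)), ⟨w', rfl⟩, r + r', ?_⟩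
      have hr₁ := congrArg (res (extPower n A) i') hr
      rw [map_smul, ← wedge_res, res_res] at hr₁
      simp only [res_res] at hr₁
      rw [map_add, map_add, add_smul]
      simp only [Category.assoc]
      rw [hr', hr₁]
    | smul r y _ hy =>
      intro T' g f x
      obtain ⟨W, i, hi, hx, r', hr⟩ := hy g f x
      refine ⟨W, i, hi, hx, r * r', ?_⟩
      rw [map_smul, map_smul, hr, mul_smul]
  obtain ⟨W, i, hi, ⟨w, rfl⟩, y, hy⟩ := exists_of_mem_over (Presheaf.imageSieve_mem
    (Scheme.etaleTopology.over S) (toSheafify (Scheme.etaleTopology.over S)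
      (A.obj ⋙ ModuleCat.exteriorPower.functor.{u + 1} (ZMod M) n)) a) x
  obtain ⟨W', i', hi', ⟨w', rfl⟩, r, hr⟩ := key y (𝟙 W) (i ≫ f) w
  refine ⟨W', i' ≫ i, inferInstanceAs (Etale (i'.left ≫ i.left)), ⟨w', rfl⟩, r, ?_⟩
  have hy' : toExtPower n A W y = res (extPower n A) i a := hy
  rw [hy', Category.comp_id, res_res] at hr
  simpa only [Category.assoc] using hr

/-- A lisse sheaf is trivial in an étale neighbourhood of every point of an `S`-scheme. -/
lemma IsLisse.exists_triv {A : EtSheaf M S} {n : ℕ} (hA : IsLisse A n) (V : Over S) (v : V.left) :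
    ∃ (W : Over S) (i : W ⟶ V), Etale i.left ∧ v ∈ Set.range i.left ∧ Nonempty (Triv A n W) := by
  obtain ⟨U, hU, ⟨x, hx⟩, e, he⟩ := hA (V.hom v)
  obtain ⟨w, hw, -⟩ := Scheme.Pullback.exists_preimage_pullback (f := V.hom) (g := U.hom) v x hx.symm
  let t : Triv A n U := ⟨e, fun {T T'} f a => he T T' f a⟩
  let W : Over S := Over.mk (pullback.fst V.hom U.hom ≫ V.hom)
  let i : W ⟶ V := Over.homMk (pullback.fst V.hom U.hom)
  let j : W ⟶ U := Over.homMk (pullback.snd V.hom U.hom) pullback.condition.symm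
  exact ⟨W, i, inferInstanceAs (Etale (pullback.fst V.hom U.hom)), ⟨w, hw⟩, ⟨t.restrict j⟩⟩

end Lisse

/-! ### A local generator of the sheaf of a Galois character. -/

section Character

variable {M : ℕ} {F : Type u} [Field F]

open scoped TensorProduct in
/-- The geometric points of a finite extension form a discrete space. -/
lemma discreteTopology_geom (L : Type u) [Field L] [Algebra F L] [FiniteDimensional F L] :
    DiscreteTopology (geom (Spec.map (CommRingCat.ofHom (algebraMap F L)))) := by
  have : IsArtinianRing (L ⊗[F] AlgebraicClosure F) := by
    have := IsArtinianRing.of_finite (AlgebraicClosure F) (AlgebraicClosure F ⊗[F] L)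
    exact (Algebra.TensorProduct.comm F (AlgebraicClosure F) L).toRingEquiv.isArtinianRing
  have : DiscreteTopology (Spec (.of (L ⊗[F] AlgebraicClosure F))) :=
    inferInstanceAs (DiscreteTopology (PrimeSpectrum (L ⊗[F] AlgebraicClosure F)))
  exact (pullbackSpecIso F L (AlgebraicClosure F)).hom.homeomorph.isEmbedding.discreteTopology

lemma geomGal_snd {X : Scheme.{u}} (f : X ⟶ Spec (.of F))
    (σ : AlgebraicClosure F ≃ₐ[F] AlgebraicClosure F) :
    geomGal f σ ≫ pullback.snd f _ =
      pullback.snd f _ ≫ Spec.map (CommRingCat.ofHom (σ : AlgebraicClosure F →+* _)) :=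
  pullback.lift_snd _ _ _

lemma geomGal_fst {X : Scheme.{u}} (f : X ⟶ Spec (.of F))
    (σ : AlgebraicClosure F ≃ₐ[F] AlgebraicClosure F) :
    geomGal f σ ≫ geomFst f = geomFst f :=
  (pullback.lift_fst _ _ _).trans (Category.comp_id _)

lemma geomMap_snd {X Y : Scheme.{u}} {f : X ⟶ Spec (.of F)} {g : Y ⟶ Spec (.of F)}
    (h : X ⟶ Y) (w : h ≫ g = f) : geomMap h w ≫ pullback.snd g _ = pullback.snd f _ :=
  (pullback.lift_snd _ _ _).trans (Category.comp_id _)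

lemma geomGal_geomMap {X Y : Scheme.{u}} {f : X ⟶ Spec (.of F)} {g : Y ⟶ Spec (.of F)}
    (h : X ⟶ Y) (w : h ≫ g = f) (σ : AlgebraicClosure F ≃ₐ[F] AlgebraicClosure F) :
    geomGal f σ ≫ geomMap h w = geomMap h w ≫ geomGal g σ := by
  refine pullback.hom_ext ?_ ?_
  · have e₁ : geomMap h w ≫ geomFst g = geomFst f ≫ h := pullback.lift_fst _ _ _
    change (geomGal f σ ≫ geomMap h w) ≫ geomFst g = (geomMap h w ≫ geomGal g σ) ≫ geomFst g
    rw [Category.assoc, Category.assoc, geomGal_fst, e₁, reassoc_of% geomGal_fst f σ]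
  · rw [Category.assoc, Category.assoc, geomGal_snd, geomMap_snd, reassoc_of% geomMap_snd h w,
      geomGal_snd]

/-- Every embedding of a finite extension of `F` in an extension of `F̄` comes from an
automorphism of `F̄`. -/
lemma exists_algEquiv_comp {L : IntermediateField F (AlgebraicClosure F)} {κ : Type*} [Field κ]
    (j : L →+* κ) (k : AlgebraicClosure F →+* κ)
    (h : j.comp (algebraMap F L) = k.comp (algebraMap F (AlgebraicClosure F))) :
    ∃ σ : AlgebraicClosure F ≃ₐ[F] AlgebraicClosure F, ∀ l : L, j l = k (σ l) := by
  let := (k.comp (algebraMap F (AlgebraicClosure F))).toAlgebra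
  let j' : L →ₐ[F] κ := { j with commutes' := fun x => congrArg (fun f => f x) h }
  let k' : AlgebraicClosure F →ₐ[F] κ := { k with commutes' := fun x => rfl }
  -- The image of `l` is a root of its minimal polynomial, which already splits over `F̄`. The
  -- embedding of `L` therefore takes values in `F̄`, and normality extends it to an automorphism.
  have hr (l : L) : j' l ∈ k'.range := by
    have hs : ((minpoly F l).map (algebraMap F (AlgebraicClosure F))).Splits :=
      IsAlgClosed.splits _
    have h0 : ((minpoly F l).map (algebraMap F (AlgebraicClosure F))) ≠ 0 :=
      (Polynomial.map_ne_zero_iff (algebraMap F (AlgebraicClosure F)).injective).2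
        (minpoly.ne_zero (Algebra.IsIntegral.isIntegral l))
    have := hs.mem_range_of_isRoot (i := k) h0 (x := j' l) (by
      rw [Polynomial.map_map, Polynomial.IsRoot, Polynomial.eval_map]
      change Polynomial.aeval (j' l) (minpoly F l) = 0
      rw [Polynomial.aeval_algHom_apply, minpoly.aeval, map_zero])
    exact this
  let φ : L →ₐ[F] AlgebraicClosure F :=
    ((AlgEquiv.ofInjective k' k.injective).symm : k'.range →ₐ[F] _).comp (j'.codRestrict _ hr)
  have hφ (l : L) : k (φ l) = j l :=
    congrArg Subtype.val ((AlgEquiv.ofInjective k' k.injective).apply_symm_apply ⟨j' l, hr l⟩)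
  refine ⟨AlgEquiv.ofBijective (φ.liftNormal (AlgebraicClosure F))
    (Algebra.IsAlgebraic.algHom_bijective _), fun l => ?_⟩
  rw [← hφ]
  exact congrArg k (φ.liftNormal_commutes (AlgebraicClosure F) l).symm

lemma exists_fixingSubgroup_le_ker {χ : (AlgebraicClosure F ≃ₐ[F] AlgebraicClosure F) →* (ZMod M)ˣ}
    (hχ : Continuous χ) : ∃ L : IntermediateField F (AlgebraicClosure F), FiniteDimensional F L ∧
      ∀ σ ∈ L.fixingSubgroup, χ σ = 1 := by
  have : χ ⁻¹' {1} ∈ nhds (1 : AlgebraicClosure F ≃ₐ[F] AlgebraicClosure F) :=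
    hχ.continuousAt.preimage_mem_nhds (by rw [map_one]; exact mem_nhds_discrete.2 rfl)
  obtain ⟨L, hL, h⟩ := (krullTopology_mem_nhds_one_iff _ _ _).1 this
  exact ⟨L, hL, fun σ hσ => h hσ⟩

/-- A section without zeros of the sheaf of a character which is trivial on the Galois group
of `L`, over `Spec L`. -/
lemma exists_isUnit_charSections_of_fixingSubgroup_le
    {χ : (AlgebraicClosure F ≃ₐ[F] AlgebraicClosure F) →* (ZMod M)ˣ}
    (L : IntermediateField F (AlgebraicClosure F)) [FiniteDimensional F L]
    (hL : ∀ σ ∈ L.fixingSubgroup, χ σ = 1) :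
    ∃ v ∈ charSections χ (Spec.map (CommRingCat.ofHom (algebraMap F L))), ∀ x, IsUnit (v x) := by
  let f := Spec.map (CommRingCat.ofHom (algebraMap F L))
  let g := Spec.map (CommRingCat.ofHom (algebraMap F (AlgebraicClosure F)))
  have := discreteTopology_geom (F := F) L
  let j (x : geom f) := Spec.preimage ((geom f).fromSpecResidueField x ≫ geomFst f)
  let k (x : geom f) := Spec.preimage ((geom f).fromSpecResidueField x ≫ pullback.snd f g)
  have hj (x : geom f) : Spec.map (j x) = (geom f).fromSpecResidueField x ≫ geomFst f :=
    Spec.map_preimage _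
  have hk (x : geom f) : Spec.map (k x) = (geom f).fromSpecResidueField x ≫ pullback.snd f g :=
    Spec.map_preimage _
  have hjk (x : geom f) : (j x).hom.comp (algebraMap F L) =
      (k x).hom.comp (algebraMap F (AlgebraicClosure F)) := by
    have : CommRingCat.ofHom (algebraMap F L) ≫ j x =
        CommRingCat.ofHom (algebraMap F (AlgebraicClosure F)) ≫ k x := by
      apply Spec.map_injective
      rw [Spec.map_comp, Spec.map_comp, hj, hk, Category.assoc, Category.assoc]
      exact congrArg _ pullback.condition
    exact congrArg CommRingCat.Hom.hom this
  -- At a geometric point `x` the embeddings of `L` and of `F̄` in the residue field differ by some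
  -- `σ x`, unique up to the Galois group of `L`. Hence `χ (σ x)` is well defined, and it is the
  -- value of the section at `x`.
  choose σ hσ using fun x => exists_algEquiv_comp (j x).hom (k x).hom (hjk x)
  have huniq (x : geom f) (τ : AlgebraicClosure F ≃ₐ[F] AlgebraicClosure F)
      (hτ : ∀ l : L, (j x).hom l = (k x).hom (τ l)) : χ τ = χ (σ x) := by
    have : (σ x)⁻¹ * τ ∈ L.fixingSubgroup := by
      rw [IntermediateField.mem_fixingSubgroup_iff]
      intro l hl
      have := (k x).hom.injective ((hτ ⟨l, hl⟩).symm.trans (hσ x ⟨l, hl⟩))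
      exact (congrArg (σ x).symm this).trans ((σ x).symm_apply_apply l)
    have h₁ := hL _ this
    rw [map_mul, map_inv, inv_mul_eq_one] at h₁
    exact h₁.symm
  refine ⟨⟨fun x => χ (σ x), IsLocallyConstant.of_discrete _⟩, fun τ x => ?_, fun x => Units.isUnit _⟩
  let y := geomGal f τ x
  let ρ := (geomGal f τ).residueFieldMap x
  have hρ : (geom f).fromSpecResidueField x ≫ geomGal f τ =
      Spec.map ρ ≫ (geom f).fromSpecResidueField y :=
    (Scheme.Hom.SpecMap_residueFieldMap_fromSpecResidueField _ _).symm
  have h₁ : j x = j y ≫ ρ := by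
    apply Spec.map_injective
    rw [Spec.map_comp, hj, hj, ← reassoc_of% hρ, geomGal_fst]
  have h₂ : CommRingCat.ofHom (τ : AlgebraicClosure F →+* _) ≫ k x = k y ≫ ρ := by
    apply Spec.map_injective
    rw [Spec.map_comp, Spec.map_comp, hk, hk, ← reassoc_of% hρ, geomGal_snd, Category.assoc]
  -- Passing from `x` to `y` composes the embedding of `F̄` with `τ`, so `τ * σ y` is an admissible
  -- choice at `x`; this is the equivariance.
  have : χ (τ * σ y) = χ (σ x) := huniq x _ fun l => by
    have e₁ := congrArg (fun φ => φ.hom l) h₁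
    have e₂ := congrArg (fun φ => φ.hom (σ y l)) h₂
    exact e₁.trans ((congrArg ρ.hom (hσ y l)).trans e₂.symm)
  rw [map_mul] at this
  exact congrArg Units.val this

end Character

/-! ### Étale local triviality of the character sheaf. -/

section Conj

variable {M : ℕ} {Fp F : Type u} [Field Fp] [Field F] [Algebra Fp F]
  {χ : (AlgebraicClosure F ≃ₐ[F] AlgebraicClosure F) →* (ZMod M)ˣ}
  {Sp : Scheme.{u}} {s : Sp ⟶ Spec (.of Fp)}

lemma comap_mem_charSections {X Y : Scheme.{u}} {f : X ⟶ Spec (.of F)} {g : Y ⟶ Spec (.of F)}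
    (h : X ⟶ Y) (w : h ≫ g = f) {v : LocallyConstant (geom g) (ZMod M)}
    (hv : v ∈ charSections χ g) :
    v.comap (toContinuousMap (geomMap h w)) ∈ charSections χ f := by
  intro σ x
  refine Eq.trans ?_ (hv σ (geomMap h w x))
  change (χ σ : ZMod M) * v (geomMap h w (geomGal f σ x)) = _
  rw [← Scheme.Hom.comp_apply, geomGal_geomMap, Scheme.Hom.comp_apply]
  rfl

/-- The sheaf of a continuous character has, étale locally, a section without zeros. -/
lemma exists_isUnit_charSections [CharZero F] (hχ : Continuous χ) (V : Over (baseF F s))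
    (v : V.left) : ∃ (W : Over (baseF F s)) (i : W ⟶ V), Etale i.left ∧ v ∈ Set.range i.left ∧
      ∃ q ∈ charSections χ (toF F W), ∀ x, IsUnit (q x) := by
  obtain ⟨L, _, hL⟩ := exists_fixingSubgroup_le_ker hχ
  obtain ⟨q, hq, hq'⟩ := exists_isUnit_charSections_of_fixingSubgroup_le L hL
  let f := Spec.map (CommRingCat.ofHom (algebraMap F L))
  have : Etale f := (HasRingHomProperty.Spec_iff (P := @Etale)).2 (RingHom.etale_algebraMap.2
    ⟨Algebra.FormallyEtale.of_isSeparable F L,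
      Algebra.FinitePresentation.of_finiteType.1 (inferInstanceAs (Algebra.FiniteType F L))⟩)
  have : Surjective f := by
    refine ⟨fun x => ⟨(⊥ : PrimeSpectrum L), ?_⟩⟩
    exact Subsingleton.elim (α := PrimeSpectrum F) _ _
  let W : Over (baseF F s) := Over.mk (pullback.fst (toF F V) f ≫ V.hom)
  let i : W ⟶ V := Over.homMk (pullback.fst (toF F V) f)
  have w : pullback.snd (toF F V) f ≫ f = toF F W :=
    pullback.condition.symm.trans (Category.assoc _ _ _).symm
  exact ⟨W, i, inferInstanceAs (Etale (pullback.fst (toF F V) f)),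
    (pullback.fst (toF F V) f).surjective v, _, comap_mem_charSections _ w hq, fun x => hq' _⟩

end Conj

/-! ### Dual frames for a polarization. -/

section Dual

variable {M : ℕ} {Fp F : Type u} [Field Fp] [Field F] [Algebra Fp F]
  {c : ComplexConjugation Fp F} {χ : (AlgebraicClosure F ≃ₐ[F] AlgebraicClosure F) →* (ZMod M)ˣ}
  {Sp : Scheme.{u}} {s : Sp ⟶ Spec (.of Fp)} {A B : EtSheaf M (baseF F s)}
  {n : ℕ}

/-- The value of the pairing at a geometric point. -/
noncomputable def Polarization.eval (P : Polarization c χ A) (V : Over (baseF F s))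
    (x : geom (toF F V)) : sec A V →ₗ[ZMod M] sec A ((conj s c).obj V) →ₗ[ZMod M] ZMod M :=
  (P.pair V).compr₂ ((LocallyConstant.evalₗ (ZMod M) x).comp (charSections χ (toF F V)).subtype)

/-- The map on geometric points given by a morphism of `S₀`-schemes. -/
noncomputable abbrev geomMapOver {V W : Over (baseF F s)} (f : V ⟶ W) :
    geom (toF F V) ⟶ geom (toF F W) :=
  geomMap f.left (by simp [toF])

lemma geomMapOver_fst {V W : Over (baseF F s)} (f : V ⟶ W) :
    geomMapOver f ≫ geomFst (toF F W) = geomFst (toF F V) ≫ f.left :=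
  pullback.lift_fst _ _ _

lemma geomMapOver_comp {U V W : Over (baseF F s)} (f : U ⟶ V) (g : V ⟶ W) :
    geomMapOver f ≫ geomMapOver g = geomMapOver (f ≫ g) := by
  refine pullback.hom_ext ?_ ?_
  · change (geomMapOver f ≫ geomMapOver g) ≫ geomFst (toF F W) =
      geomMapOver (f ≫ g) ≫ geomFst (toF F W)
    rw [Category.assoc, geomMapOver_fst, geomMapOver_fst, ← Category.assoc, geomMapOver_fst]
    exact Category.assoc _ _ _
  · rw [Category.assoc, geomMap_snd, geomMap_snd, geomMap_snd]

lemma geomMapOver_id (V : Over (baseF F s)) : geomMapOver (𝟙 V) = 𝟙 _ := by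
  refine pullback.hom_ext ?_ ?_
  · change geomMapOver (𝟙 V) ≫ geomFst (toF F V) = 𝟙 _ ≫ geomFst (toF F V)
    rw [geomMapOver_fst, Category.id_comp]
    exact Category.comp_id _
  · rw [geomMap_snd, Category.id_comp]

lemma Polarization.eval_res (P : Polarization c χ A) {V W : Over (baseF F s)} (f : V ⟶ W)
    (x : geom (toF F V)) (a : sec A W) (b : sec A ((conj s c).obj W)) :
    P.eval V x (res A f a) (res A ((conj s c).map f) b) = P.eval W (geomMapOver f x) a b :=
  congrArg (fun φ => φ x) (P.pair_res f a b)

lemma Polarization.eval_conj (P : Polarization c χ A) (V : Over (baseF F s))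
    (x : geom (toF F V)) (a : sec A V) (b : sec A ((conj s c).obj V)) :
    P.eval V x a b = P.eval ((conj s c).obj V) (geomConj c V x) b (res A (conjConj c V) a) :=
  congrArg (fun φ => φ x) (P.symm V a b)

lemma Polarization.pair_ext {P : Polarization c χ A} {Q : Polarization c χ B}
    {V : Over (baseF F s)} {a : sec A V} {b : sec A ((conj s c).obj V)} {a' : sec B V}
    {b' : sec B ((conj s c).obj V)} (h : ∀ x, P.eval V x a b = Q.eval V x a' b') :
    P.pair V a b = Q.pair V a' b' :=
  Subtype.ext (LocallyConstant.ext h)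

instance : Surjective (Spec.map (CommRingCat.ofHom (algebraMap F (AlgebraicClosure F)))) :=
  ⟨fun _ => ⟨(⊥ : PrimeSpectrum (AlgebraicClosure F)), Subsingleton.elim (α := PrimeSpectrum F) _ _⟩⟩

lemma exists_geomFst_eq {X : Scheme.{u}} (f : X ⟶ Spec (.of F)) (x : X) :
    ∃ y, geomFst f y = x :=
  (geomFst f).surjective x

/-- A scheme over the conjugate of `V` is the conjugate of a scheme over `V`. -/
lemma exists_conj_map_eq {V W' : Over (baseF F s)} (i' : W' ⟶ (conj s c).obj V)
    [Etale i'.left] : ∃ (W : Over (baseF F s)) (i : W ⟶ V) (p : (conj s c).obj W ⟶ W'),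
      Etale i.left ∧ Set.range i.left = Set.range i'.left ∧ p ≫ i' = (conj s c).map i := by
  have e : i'.left ≫ V.hom ≫ conjBase s c = W'.hom := Over.w i'
  refine ⟨Over.mk (i'.left ≫ V.hom), Over.homMk i'.left rfl, Over.homMk (𝟙 _) ?_,
    inferInstanceAs (Etale i'.left), rfl, ?_⟩
  · refine (Category.id_comp _).trans (e.symm.trans ?_)
    exact (Category.assoc _ _ _).symm
  · ext1
    exact Category.id_comp _

/-- The frames of two trivialisations over `V` and its conjugate are dual to each other, up to
the section `q` of `χ`. -/
def IsDual (P : Polarization c χ A) {V : Over (baseF F s)} (t : Triv A n V)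
    (t' : Triv A n ((conj s c).obj V)) (q : LocallyConstant (geom (toF F V)) (ZMod M)) : Prop :=
  ∀ x j k, P.eval V x (t.frame j) (t'.frame k) = if j = k then q x else 0

lemma IsDual.restrict {P : Polarization c χ A} {V : Over (baseF F s)} {t : Triv A n V}
    {t' : Triv A n ((conj s c).obj V)} {q : LocallyConstant (geom (toF F V)) (ZMod M)}
    (h : IsDual P t t' q) {W : Over (baseF F s)} (i : W ⟶ V) :
    IsDual P (t.restrict i) (t'.restrict ((conj s c).map i))
      (q.comap (toContinuousMap (geomMapOver i))) := by
  intro x j k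
  rw [← Triv.res_frame, ← Triv.res_frame, P.eval_res, h]
  rfl

lemma IsDual.eval_frame_sum {P : Polarization c χ A} {V : Over (baseF F s)} {t : Triv A n V}
    {t' : Triv A n ((conj s c).obj V)} {q : LocallyConstant (geom (toF F V)) (ZMod M)}
    (h : IsDual P t t' q) (x : geom (toF F V)) (α β : Fin n → ZMod M) :
    P.eval V x (∑ j, α j • t.frame j) (∑ j, β j • t'.frame j) = (∑ j, α j * β j) * q x := by
  simp only [map_sum, map_smul, LinearMap.sum_apply, LinearMap.smul_apply, h _ _ _]
  rw [Finset.sum_mul]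
  refine Finset.sum_congr rfl fun j _ => ?_
  rw [Finset.sum_eq_single j]
  · simp only [if_true, smul_eq_mul]
    ring
  · intro k _ hk
    simp [hk]
  · simp

lemma IsDual.eval_sum {P : Polarization c χ A} {V : Over (baseF F s)} {t : Triv A n V}
    {t' : Triv A n ((conj s c).obj V)} {q : LocallyConstant (geom (toF F V)) (ZMod M)}
    (h : IsDual P t t' q) {W : Over (baseF F s)} (i : W ⟶ V) (x : geom (toF F W))
    (α β : Fin n → ZMod M) :
    P.eval W x (∑ j, α j • res A i (t.frame j))
      (∑ j, β j • res A ((conj s c).map i) (t'.frame j)) =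
        (∑ j, α j * β j) * q (geomMapOver i x) := by
  simp only [Triv.res_frame]
  exact (h.restrict i).eval_frame_sum x α β

/-- Sections over `W` and its conjugate are simultaneously linear combinations of frames, étale
locally. -/
lemma exists_res_eq_conj {V : Over (baseF F s)} (t : Triv A n V)
    (t' : Triv A n ((conj s c).obj V)) {W : Over (baseF F s)} (f : W ⟶ V) (a : sec A W)
    (b : sec A ((conj s c).obj W)) (x : W.left) :
    ∃ (W' : Over (baseF F s)) (i : W' ⟶ W), Etale i.left ∧ x ∈ Set.range i.left ∧
      ∃ α β : Fin n → ZMod M, res A i a = ∑ j, α j • res A (i ≫ f) (t.frame j) ∧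
        res A ((conj s c).map i) b =
          ∑ j, β j • res A ((conj s c).map (i ≫ f)) (t'.frame j) := by
  obtain ⟨W₁, i₁, h₁, ⟨w, rfl⟩, α, hα⟩ := t.exists_res_eq f (m := 1) (fun _ => a) x
  obtain ⟨W₂, i₂, h₂, hw, β, hβ⟩ := t'.exists_res_eq ((conj s c).map (i₁ ≫ f)) (m := 1)
    (fun _ => res A ((conj s c).map i₁) b) w
  obtain ⟨W₃, i₃, p, h₃, h₄, e⟩ := exists_conj_map_eq i₂
  obtain ⟨w', rfl⟩ := h₄ ▸ hw
  refine ⟨W₃, i₃ ≫ i₁, inferInstanceAs (Etale (i₃.left ≫ i₁.left)), ⟨w', by simp⟩,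
    fun j => α j 0, fun j => β j 0, ?_, ?_⟩
  · have := congrArg (res A i₃) (hα 0)
    simpa only [map_sum, map_smul, res_res, Category.assoc] using this
  · have := congrArg (res A p) (hβ 0)
    simpa only [map_sum, map_smul, res_res, Category.assoc, ← Functor.map_comp, reassoc_of% e]
      using this

lemma Triv.res_iso_hom {S : Scheme.{u}} {A B : EtSheaf M S} {V : Over S} (t : Triv A n V)
    (r : Triv B n V) {W W' : Over S} (f : W ⟶ V) (i : W' ⟶ W) {a : sec A W} {α : Fin n → ZMod M}
    (h : res A i a = ∑ j, α j • res A (i ≫ f) (t.frame j)) :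
    res B i (restrictMap (t.iso r).hom (Over.mk f) a) =
      ∑ j, α j • res B (i ≫ f) (r.frame j) := by
  refine (restrictMap_comp_res (t.iso r).hom (Over.mk f) i a).symm.trans ?_
  refine (congrArg (restrictMap (t.iso r).hom (Over.mk (i ≫ f))) h).trans ?_
  rw [map_sum]
  refine Finset.sum_congr rfl fun j _ => ?_
  rw [map_smul, t.iso_hom_frame]

/-- The isomorphisms which identify dual frames preserve the pairing. -/
lemma IsDual.pair_iso {P : Polarization c χ A} {Q : Polarization c χ B} {V : Over (baseF F s)}
    {t : Triv A n V} {t' : Triv A n ((conj s c).obj V)} {r : Triv B n V}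
    {r' : Triv B n ((conj s c).obj V)} {q : LocallyConstant (geom (toF F V)) (ZMod M)}
    (h : IsDual P t t' q) (h' : IsDual Q r r' q) {W : Over (baseF F s)} (f : W ⟶ V)
    (a : sec A W) (b : sec A ((conj s c).obj W)) :
    Q.pair W (restrictMap (t.iso r).hom (Over.mk f) a)
      (restrictMap (t'.iso r').hom (Over.mk ((conj s c).map f)) b) = P.pair W a b := by
  refine Polarization.pair_ext fun x => ?_
  obtain ⟨W', i, -, hx, α, β, hα, hβ⟩ := exists_res_eq_conj t t' f a b (geomFst _ x)
  obtain ⟨x', rfl⟩ := exists_geomMap_eq i.left (f := toF F W') (by simp [toF]) x hx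
  have hβ' : res A ((conj s c).map i) b =
      ∑ j, β j • res A ((conj s c).map i ≫ (conj s c).map f) (t'.frame j) := by
    rw [← Functor.map_comp]
    exact hβ
  have e₁ := t.res_iso_hom r f i hα
  have e₂ := t'.res_iso_hom r' ((conj s c).map f) ((conj s c).map i) hβ'
  rw [← Functor.map_comp] at e₂
  refine (Q.eval_res i x' _ _).symm.trans (Eq.trans ?_ (P.eval_res i x' _ _))
  refine Eq.trans (congrArg₂ (fun y z => Q.eval W' x' y z) e₁ e₂) ?_
  refine Eq.trans ?_ (congrArg₂ (fun y z => P.eval W' x' y z) hα hβ).symm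
  exact (h'.eval_sum _ _ _ _).trans (h.eval_sum _ _ _ _).symm

/-- A section which is orthogonal to a frame vanishes. -/
lemma IsDual.eq_zero {P : Polarization c χ A} {V : Over (baseF F s)}
    {t : Triv A n V} {t' : Triv A n ((conj s c).obj V)}
    {q : LocallyConstant (geom (toF F V)) (ZMod M)} (h : IsDual P t t' q)
    (hq : ∀ x, IsUnit (q x)) {d : sec A ((conj s c).obj V)}
    (hd : ∀ x j, P.eval V x (t.frame j) d = 0) : d = 0 := by
  refine sec_ext A fun x => ?_
  obtain ⟨W, i, hi, ⟨w, hw⟩, α, β, -, hβ⟩ := exists_res_eq_conj t t' (𝟙 V) 0 d x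
  refine ⟨_, (conj s c).map i, hi, ⟨w, hw⟩, ?_⟩
  have hβ0 : β = 0 := by
    ext j
    obtain ⟨y, -⟩ := exists_geomFst_eq (toF F W) w
    -- Pairing with the `j`-th frame vector gives `β j` times a unit value of `q`, so each
    -- coefficient vanishes.
    have h₁ := h.eval_sum (i ≫ 𝟙 V) y (Pi.single j 1) β
    rw [← hβ] at h₁
    have h₂ : ∑ k, (Pi.single j 1 : Fin n → ZMod M) k • res A (i ≫ 𝟙 V) (t.frame k) =
        res A i (t.frame j) := by
      simp [Pi.single_apply, ite_smul]
    rw [h₂, P.eval_res, hd] at h₁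
    have h₃ := (hq (geomMapOver (i ≫ 𝟙 V) y)).mul_left_eq_zero.1 h₁.symm
    simpa [Pi.single_apply] using h₃
  rw [hβ, hβ0]
  simp

/-- A change of frame by a matrix and by its inverse transpose preserves duality. -/
lemma IsDual.change {P : Polarization c χ A} {V : Over (baseF F s)}
    {t : Triv A n V} {t' : Triv A n ((conj s c).obj V)}
    {q : LocallyConstant (geom (toF F V)) (ZMod M)} (h : IsDual P t t' q)
    {g g' : (Matrix (Fin n) (Fin n) (ZMod M))ˣ}
    (hg : (g : Matrix (Fin n) (Fin n) (ZMod M)).transpose * g' = 1) :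
    IsDual P (t.change g) (t'.change g') q := by
  intro x j k
  rw [Triv.frame_change, Triv.frame_change, h.eval_frame_sum]
  have h₂ := congrFun (congrFun hg j) k
  rw [Matrix.mul_apply] at h₂
  simp only [Matrix.transpose_apply] at h₂
  rw [h₂, Matrix.one_apply]
  split_ifs <;> simp

/-- The product of a coordinate with a section of `χ`. -/
noncomputable def Triv.coordMul {V : Over (baseF F s)} (t : Triv A n V) (k : Fin n)
    {q : LocallyConstant (geom (toF F V)) (ZMod M)} (hq : q ∈ charSections χ (toF F V))
    (T : Over V) : sec A T.left →ₗ[ZMod M] charSections χ (toF F T.left) where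
  toFun a := ⟨((t.e T a).map (fun v => v k)).comap (toContinuousMap (geomFst (toF F T.left))) *
    q.comap (toContinuousMap (geomMapOver T.hom)), fun σ x => by
      have h₁ := comap_mem_charSections T.hom.left (f := toF F T.left) (by simp [toF]) hq σ x
      have h₂ : geomFst (toF F T.left) (geomGal (toF F T.left) σ x) =
          geomFst (toF F T.left) x := by
        rw [← Scheme.Hom.comp_apply, geomGal_fst]
      have h₃ : t.e T a (geomFst (toF F T.left) (geomGal (toF F T.left) σ x)) k =
          t.e T a (geomFst (toF F T.left) x) k := by rw [h₂]
      refine Eq.trans ?_ (congrArg₂ (· * ·) h₃ h₁)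
      exact mul_left_comm _ _ _⟩
  map_add' a b := by
    refine Subtype.ext (LocallyConstant.ext fun x => ?_)
    have h₁ := congrArg (fun φ => φ (geomFst (toF F T.left) x) k) (map_add (t.e T) a b)
    exact (congrArg (· * _) h₁).trans (add_mul _ _ _)
  map_smul' r a := by
    refine Subtype.ext (LocallyConstant.ext fun x => ?_)
    have h₁ := congrArg (fun φ => φ (geomFst (toF F T.left) x) k) (map_smul (t.e T) r a)
    exact (congrArg (· * _) h₁).trans (mul_assoc _ _ _)

/-- Over a trivialising scheme there are sections of the conjugate sheaf which are dual to a
frame. -/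
lemma exists_dual_sections (P : Polarization c χ A) {V : Over (baseF F s)} (t : Triv A n V)
    {q : LocallyConstant (geom (toF F V)) (ZMod M)} (hq : q ∈ charSections χ (toF F V)) :
    ∃ b : Fin n → sec A ((conj s c).obj V),
      ∀ x j k, P.eval V x (t.frame j) (b k) = if j = k then q x else 0 := by
  -- By perfectness, the functional given by the `k`-th coordinate times `q` is the pairing with a
  -- section of the conjugate sheaf.
  have h (k : Fin n) := (P.perfect V (t.coordMul k hq) fun T T' f a => by
    refine LocallyConstant.ext fun x => ?_
    have h₁ : geomFst (toF F T.left) (geomMapOver f.left x) =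
        f.left.left (geomFst (toF F T'.left) x) := by
      rw [← Scheme.Hom.comp_apply, geomMapOver_fst, Scheme.Hom.comp_apply]
    have h₂ : geomMapOver T.hom (geomMapOver f.left x) = geomMapOver T'.hom x := by
      rw [← Scheme.Hom.comp_apply, geomMapOver_comp, Over.w f]
    have h₃ := congrArg (fun φ => φ (geomFst (toF F T'.left) x) k) (t.natural f a)
    exact congrArg₂ (· * ·) (h₃.trans (congrArg (fun y => t.e T a y k) h₁.symm))
      (congrArg q h₂.symm)).exists
  choose b hb using h
  refine ⟨b, fun x j k => ?_⟩
  have h₁ := hb k (Over.mk (𝟙 V)) (t.frame j)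
  have h₂ : res (conjSheaf s c A) (Over.mk (𝟙 V)).hom (b k) = b k := res_id _ _
  rw [h₂] at h₁
  refine (congrArg (fun φ => φ.1 x) h₁).symm.trans ?_
  have h₃ : t.e (Over.mk (𝟙 V)) (t.frame j) = LocallyConstant.const _ (Pi.single j 1) :=
    (t.e (Over.mk (𝟙 V))).apply_symm_apply _
  have h₄ : geomMapOver (𝟙 V) x = x := by
    rw [geomMapOver_id]
    rfl
  refine (congrArg₂ (· * ·) (congrArg (fun φ => φ (geomFst (toF F V) x) k) h₃)
    (congrArg q h₄)).trans ?_
  change (Pi.single j 1 : Fin n → ZMod M) k * q x = _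
  simp [Pi.single_apply, eq_comm]

/-- Étale locally, every frame has a dual frame. -/
lemma exists_isDual (P : Polarization c χ A) {V : Over (baseF F s)} (t : Triv A n V)
    (t' : Triv A n ((conj s c).obj V)) {q : LocallyConstant (geom (toF F V)) (ZMod M)}
    (hq : q ∈ charSections χ (toF F V)) (hq' : ∀ x, IsUnit (q x)) (v : V.left) :
    ∃ (W : Over (baseF F s)) (i : W ⟶ V), Etale i.left ∧ v ∈ Set.range i.left ∧
      ∃ t'' : Triv A n ((conj s c).obj W),
        IsDual P (t.restrict i) t'' (q.comap (toContinuousMap (geomMapOver i))) := by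
  obtain ⟨b, hb⟩ := exists_dual_sections P t hq
  obtain ⟨W₂, i₂, h₂, hw, β, hβ⟩ := t'.exists_res_eq (𝟙 _) b v
  obtain ⟨W, i, p, h₃, h₄, e⟩ := exists_conj_map_eq i₂
  obtain ⟨w, rfl⟩ := h₄ ▸ hw
  have hβ' (k : Fin n) : res A ((conj s c).map i) (b k) =
      ∑ j, β j k • (t'.restrict ((conj s c).map i)).frame j := by
    have := congrArg (res A p) (hβ k)
    simp only [map_sum, map_smul, res_res] at this
    rw [reassoc_of% e, Category.comp_id, e] at this
    simpa only [Triv.res_frame] using this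
  have hb' (x : geom (toF F W)) (j k : Fin n) : P.eval W x ((t.restrict i).frame j)
      (∑ j, β j k • (t'.restrict ((conj s c).map i)).frame j) =
        if j = k then q (geomMapOver i x) else 0 := by
    rw [← hβ', ← Triv.res_frame, P.eval_res, hb]
  -- The dual sections form a frame once their matrix `β` in some frame is invertible. At one
  -- geometric point the Gram matrix `m` satisfies `m * β = q • 1`, whose determinant `q ^ n` is a
  -- unit.
  have hβu : IsUnit β := by
    rw [Matrix.isUnit_iff_isUnit_det]
    obtain ⟨x, -⟩ := exists_geomFst_eq (toF F W) w
    let m : Matrix (Fin n) (Fin n) (ZMod M) := Matrix.of fun j k =>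
      P.eval W x ((t.restrict i).frame j) ((t'.restrict ((conj s c).map i)).frame k)
    have hm : m * β = q (geomMapOver i x) • (1 : Matrix (Fin n) (Fin n) (ZMod M)) := by
      ext j k
      have := hb' x j k
      simp only [map_sum, map_smul, smul_eq_mul] at this
      rw [Matrix.mul_apply, Matrix.smul_apply, Matrix.one_apply, smul_eq_mul, mul_ite, mul_one,
        mul_zero, ← this]
      exact Finset.sum_congr rfl fun l _ => mul_comm _ _
    have hd := congrArg Matrix.det hm
    rw [Matrix.det_mul, Matrix.det_smul, Matrix.det_one, mul_one] at hd
    exact isUnit_of_mul_isUnit_right (hd ▸ (hq' _).pow _)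
  obtain ⟨β', rfl⟩ := hβu
  refine ⟨W, i, h₃, ⟨w, rfl⟩, (t'.restrict ((conj s c).map i)).change β', fun x j k => ?_⟩
  rw [Triv.frame_change]
  exact hb' x j k

end Dual

/-! ### Simultaneous trivialisations of all the data. -/

section LocalData

variable {M : ℕ} {Fp F : Type u} [Field Fp] [Field F] [Algebra Fp F]
  {c : ComplexConjugation Fp F} {χ : (AlgebraicClosure F ≃ₐ[F] AlgebraicClosure F) →* (ZMod M)ˣ}
  {Sp : Scheme.{u}} {s : Sp ⟶ Spec (.of Fp)} {A B : EtSheaf M (baseF F s)}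
  {P : Polarization c χ A} {Q : Polarization c χ B} {n : ℕ} {η : extPower n A ≅ extPower n B}

lemma Triv.wedge_frame_restrict {S : Scheme.{u}} {A : EtSheaf M S} {V W : Over S}
    (t : Triv A n V) (f : W ⟶ V) :
    wedge A W (t.restrict f).frame = res (extPower n A) f (wedge A V t.frame) := by
  rw [← wedge_res]
  congr 1
  ext k
  exact (t.res_frame f k).symm

/-- The sheaf is trivialised first near `v`, then near the same point for the conjugate structure
morphism. The second refinement is again the conjugate of a refinement over `V`, so both frames live
over one scheme. -/
lemma exists_isDual_frames (hA : IsLisse A n) (P : Polarization c χ A) {V : Over (baseF F s)}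
    {q : LocallyConstant (geom (toF F V)) (ZMod M)} (hq : q ∈ charSections χ (toF F V))
    (hq' : ∀ x, IsUnit (q x)) (v : V.left) :
    ∃ (W : Over (baseF F s)) (i : W ⟶ V), Etale i.left ∧ v ∈ Set.range i.left ∧
      ∃ (t : Triv A n W) (t' : Triv A n ((conj s c).obj W)),
        IsDual P t t' (q.comap (toContinuousMap (geomMapOver i))) := by
  obtain ⟨W₁, i₁, h₁, ⟨w₁, rfl⟩, ⟨t₁⟩⟩ := hA.exists_triv V v
  obtain ⟨W', i', h', hw', ⟨t'⟩⟩ := hA.exists_triv ((conj s c).obj W₁) w₁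
  obtain ⟨W₂, i₂, p, h₂, e, -⟩ := exists_conj_map_eq i'
  obtain ⟨w₂, rfl⟩ := e ▸ hw'
  obtain ⟨W₃, i₃, h₃, ⟨w₃, rfl⟩, t'', ht⟩ := exists_isDual P (t₁.restrict i₂) (t'.restrict p)
    (q := q.comap (toContinuousMap (geomMapOver (i₂ ≫ i₁))))
    (comap_mem_charSections _ (by simp [toF]) hq) (fun x => hq' _) w₂
  refine ⟨W₃, i₃ ≫ i₂ ≫ i₁, inferInstanceAs (Etale (i₃.left ≫ i₂.left ≫ i₁.left)),
    ⟨w₃, by simp⟩, (t₁.restrict i₂).restrict i₃, t'', ?_⟩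
  rw [← geomMapOver_comp]
  exact ht

/-- Étale locally, `η` is the multiplication by a constant with respect to the frames. -/
lemma exists_secMap_wedge_frame {S : Scheme.{u}} {A B : EtSheaf M S} (η : extPower n A ≅ extPower n B)
    {V : Over S} (t : Triv A n V) (t' : Triv B n V) (v : V.left) :
    ∃ (W : Over S) (i : W ⟶ V), Etale i.left ∧ v ∈ Set.range i.left ∧ ∃ r : ZMod M,
      secMap η.hom W (wedge A W (t.restrict i).frame) = r • wedge B W (t'.restrict i).frame := by
  obtain ⟨W, i, hi, hv, r, hr⟩ :=
    t'.exists_res_eq_smul_wedge (𝟙 V) (secMap η.hom V (wedge A V t.frame)) v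
  refine ⟨W, i, hi, hv, r, ?_⟩
  rw [Triv.wedge_frame_restrict, secMap_res, hr, wedge_res, Category.comp_id,
    Triv.wedge_frame_restrict]

variable (P Q η) in
/-- Compatible trivialisations of all the data over an `S₀`-scheme. -/
structure LocalData (V : Over (baseF F s)) where
  q : LocallyConstant (geom (toF F V)) (ZMod M)
  isUnit_q : ∀ x, IsUnit (q x)
  tA : Triv A n V
  tA' : Triv A n ((conj s c).obj V)
  tB : Triv B n V
  tB' : Triv B n ((conj s c).obj V)
  dualA : IsDual P tA tA' q
  dualB : IsDual Q tB tB' q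
  r : (ZMod M)ˣ
  wedge_eq : secMap η.hom V (wedge A V tA.frame) = (r : ZMod M) • wedge B V tB.frame
  wedge_eq' : secMap η.hom ((conj s c).obj V) (wedge A ((conj s c).obj V) tA'.frame) =
    ((r⁻¹ : (ZMod M)ˣ) : ZMod M) • wedge B ((conj s c).obj V) tB'.frame

/-- The restriction of compatible trivialisations. -/
noncomputable def LocalData.restrict {V W : Over (baseF F s)} (D : LocalData P Q η V) (f : W ⟶ V) :
    LocalData P Q η W where
  q := D.q.comap (toContinuousMap (geomMapOver f))
  isUnit_q x := D.isUnit_q _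
  tA := D.tA.restrict f
  tA' := D.tA'.restrict ((conj s c).map f)
  tB := D.tB.restrict f
  tB' := D.tB'.restrict ((conj s c).map f)
  dualA := D.dualA.restrict f
  dualB := D.dualB.restrict f
  r := D.r
  wedge_eq := by
    rw [Triv.wedge_frame_restrict, secMap_res, D.wedge_eq, map_smul, Triv.wedge_frame_restrict]
  wedge_eq' := by
    rw [Triv.wedge_frame_restrict, secMap_res, D.wedge_eq', map_smul, Triv.wedge_frame_restrict]

lemma IsDual.det_matrix {V : Over (baseF F s)} {t : Triv A n V}
    {t' : Triv A n ((conj s c).obj V)} {q : LocallyConstant (geom (toF F V)) (ZMod M)}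
    (h : IsDual P t t' q) (α β : Matrix (Fin n) (Fin n) (ZMod M)) (x : geom (toF F V)) :
    (P.matrix V (fun k => ∑ j, α j k • t.frame j) (fun k => ∑ j, β j k • t'.frame j)).det x =
      α.det * β.det * q x ^ n := by
  have h₁ : (P.matrix V (fun k => ∑ j, α j k • t.frame j)
      (fun k => ∑ j, β j k • t'.frame j)).map (fun f => f x) = q x • (α.transpose * β) := by
    ext j k
    refine (h.eval_frame_sum x (fun l => α l j) (fun l => β l k)).trans ?_
    rw [Matrix.smul_apply, Matrix.mul_apply, smul_eq_mul, mul_comm]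
    rfl
  have h₂ := RingHom.map_det (LocallyConstant.evalRingHom x) (P.matrix V
    (fun k => ∑ j, α j k • t.frame j) (fun k => ∑ j, β j k • t'.frame j))
  refine h₂.trans ((congrArg Matrix.det h₁).trans ?_)
  rw [Matrix.det_smul, Matrix.det_mul, Matrix.det_transpose, Fintype.card_fin, mul_comm]

/-- A matrix of given determinant. -/
lemma exists_det_eq (hn : 0 < n) (r : ZMod M) :
    ∃ α : Matrix (Fin n) (Fin n) (ZMod M), α.det = r := by
  refine ⟨Matrix.diagonal (Function.update 1 ⟨0, hn⟩ r), ?_⟩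
  rw [Matrix.det_diagonal, Finset.prod_update_of_mem (Finset.mem_univ _)]
  simp

/-- The compatibility of `η` is stated for decomposable sections, so the scalars are written as
determinants, which needs `0 < n`. In dual frames the induced pairings are then `q ^ n` for `A` and
`r * r' * q ^ n` for `B`, and `q` is a unit. -/
lemma IsDual.mul_eq_one (hn : 0 < n) (hη : CompatibleDet P Q η) {V : Over (baseF F s)} (v : V.left)
    {tA : Triv A n V} {tA' : Triv A n ((conj s c).obj V)} {tB : Triv B n V}
    {tB' : Triv B n ((conj s c).obj V)} {q : LocallyConstant (geom (toF F V)) (ZMod M)}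
    (hq : ∀ x, IsUnit (q x)) (hA : IsDual P tA tA' q) (hB : IsDual Q tB tB' q) {r r' : ZMod M}
    (h : secMap η.hom V (wedge A V tA.frame) = r • wedge B V tB.frame)
    (h' : secMap η.hom ((conj s c).obj V) (wedge A ((conj s c).obj V) tA'.frame) =
      r' • wedge B ((conj s c).obj V) tB'.frame) : r * r' = 1 := by
  obtain ⟨α, rfl⟩ := exists_det_eq hn r
  obtain ⟨β, rfl⟩ := exists_det_eq hn r'
  obtain ⟨x, -⟩ := exists_geomFst_eq (toF F V) v
  rw [← wedge_sum] at h h'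
  have h₁ := congrArg (fun f => f x) (hη _ _ _ _ _ h h')
  have h₂ := hA.det_matrix 1 1 x
  have h₃ (t : Triv A n V) : (fun k => ∑ j, (1 : Matrix (Fin n) (Fin n) (ZMod M)) j k • t.frame j) =
      t.frame := by
    ext k
    simp [Matrix.one_apply]
  have h₄ (t : Triv A n ((conj s c).obj V)) :
      (fun k => ∑ j, (1 : Matrix (Fin n) (Fin n) (ZMod M)) j k • t.frame j) = t.frame := by
    ext k
    simp [Matrix.one_apply]
  rw [h₃, h₄, Matrix.det_one, one_mul] at h₂
  have h₅ := (hB.det_matrix α β x).symm.trans (h₁.trans h₂)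
  exact ((hq x).pow n).mul_right_cancel h₅

/-- Compatible trivialisations exist étale locally. -/
lemma exists_localData [CharZero F] (hn : 0 < n) (hχ : Continuous χ) (hA : IsLisse A n)
    (hB : IsLisse B n) (hη : CompatibleDet P Q η) (V : Over (baseF F s)) (v : V.left) :
    ∃ (W : Over (baseF F s)) (i : W ⟶ V), Etale i.left ∧ v ∈ Set.range i.left ∧
      Nonempty (LocalData P Q η W) := by
  obtain ⟨W₁, i₁, h₁, ⟨w, rfl⟩, q, hq, hq'⟩ := exists_isUnit_charSections hχ V v
  obtain ⟨W₂, i₂, h₂, ⟨w, rfl⟩, tA, tA', htA⟩ := exists_isDual_frames hA P hq hq' w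
  obtain ⟨W₃, i₃, h₃, ⟨w, rfl⟩, tB, tB', htB⟩ := exists_isDual_frames hB Q
    (comap_mem_charSections i₂.left (by simp [toF]) hq) (fun x => hq' _) w
  obtain ⟨W₄, i₄, h₄, ⟨w, rfl⟩, r, hr⟩ := exists_secMap_wedge_frame η (tA.restrict i₃) tB w
  -- The scalar of `η` is made constant on the conjugate side as well; this refinement is then
  -- transported back to the original side.
  obtain ⟨W', i', h', hw', r', hr'⟩ := exists_secMap_wedge_frame η
    (tA'.restrict ((conj s c).map (i₄ ≫ i₃))) (tB'.restrict ((conj s c).map i₄)) w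
  obtain ⟨W₅, i₅, p, h₅, e, hp⟩ := exists_conj_map_eq i'
  obtain ⟨w, rfl⟩ := e ▸ hw'
  have hA₅ := (htA.restrict i₃).restrict (i₅ ≫ i₄)
  have hB₅ := htB.restrict (i₅ ≫ i₄)
  have hr₅ : secMap η.hom W₅ (wedge A W₅ ((tA.restrict i₃).restrict (i₅ ≫ i₄)).frame) =
      r • wedge B W₅ (tB.restrict (i₅ ≫ i₄)).frame := by
    have := congrArg (res (extPower n B) i₅) hr
    simpa only [Triv.wedge_frame_restrict, secMap_res, map_smul, res_res, Category.assoc] using this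
  have hr₅' : secMap η.hom ((conj s c).obj W₅) (wedge A ((conj s c).obj W₅)
      ((tA'.restrict ((conj s c).map i₃)).restrict ((conj s c).map (i₅ ≫ i₄))).frame) =
        r' • wedge B ((conj s c).obj W₅) (tB'.restrict ((conj s c).map (i₅ ≫ i₄))).frame := by
    have := congrArg (res (extPower n B) p) hr'
    simp only [Triv.wedge_frame_restrict, secMap_res, map_smul, res_res] at this
    rw [reassoc_of% hp, reassoc_of% hp] at this
    simpa only [Triv.wedge_frame_restrict, secMap_res, map_smul, res_res, ← Functor.map_comp,
      Category.assoc] using this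
  have hq₅ (x : geom (toF F W₅)) : IsUnit ((((q.comap (toContinuousMap (geomMapOver i₂))).comap
      (toContinuousMap (geomMapOver i₃))).comap (toContinuousMap (geomMapOver (i₅ ≫ i₄)))) x) :=
    hq' _
  have hrr := IsDual.mul_eq_one hn hη w hq₅ hA₅ hB₅ hr₅ hr₅'
  exact ⟨W₅, i₅ ≫ i₄ ≫ i₃ ≫ i₂ ≫ i₁,
    inferInstanceAs (Etale (i₅.left ≫ i₄.left ≫ i₃.left ≫ i₂.left ≫ i₁.left)), ⟨w, by simp⟩,
    ⟨{ q := _, isUnit_q := hq₅, tA := _, tA' := _, tB := _, tB' := _, dualA := hA₅, dualB := hB₅,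
       r := Units.mkOfMulEqOne r r' hrr, wedge_eq := hr₅, wedge_eq' := hr₅' }⟩⟩

end LocalData

lemma exists_comp_eq_of_mem_range {S : Scheme.{u}} {T R V : Over S} (f : T ⟶ R) (i : V ⟶ R)
    (hi : Etale i.left) (t : T.left) (ht : f.left t ∈ Set.range i.left) :
    ∃ (W : Over S) (j : W ⟶ T) (k : W ⟶ V), Etale j.left ∧ t ∈ Set.range j.left ∧
      j ≫ f = k ≫ i := by
  obtain ⟨v, hv⟩ := ht
  obtain ⟨w, hw, -⟩ := Scheme.Pullback.exists_preimage_pullback (f := f.left) (g := i.left) t v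
    hv.symm
  let W : Over S := Over.mk (pullback.fst f.left i.left ≫ T.hom)
  let j : W ⟶ T := Over.homMk (pullback.fst f.left i.left)
  let k : W ⟶ V := Over.homMk (pullback.snd f.left i.left) (by
    have h₁ := Over.w f
    have h₂ := Over.w i
    dsimp [W] at h₁ h₂ ⊢
    rw [← h₁, ← h₂, pullback.condition_assoc])
  refine ⟨W, j, k, inferInstanceAs (Etale (pullback.fst f.left i.left)), ⟨w, hw⟩, ?_⟩
  ext1
  exact pullback.condition

/-- The isomorphism which identifies two frames lifts `η` if `η` identifies their exterior
products. -/
lemma Triv.liftsWedge_iso {M : ℕ} {Fp F : Type u} [Field Fp] [Field F] [Algebra Fp F]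
    {Sp : Scheme.{u}} {s : Sp ⟶ Spec (.of Fp)} {A B : EtSheaf M (baseF F s)} {n : ℕ}
    {η : extPower n A ≅ extPower n B}
    {V : Over (baseF F s)} (t : Triv A n V) (t' : Triv B n V)
    (h : secMap η.hom V (wedge A V t.frame) = wedge B V t'.frame) (T : Over V) :
    LiftsWedge η (t.iso t').hom T := by
  intro a
  refine sec_ext _ fun x => ?_
  obtain ⟨W, i, hi, hx, α, hα⟩ := t.exists_res_eq T.hom a x
  refine ⟨W, i, hi, hx, ?_⟩
  have h₁ (k : Fin n) : res B i (restrictMap (t.iso t').hom T (a k)) =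
      ∑ j, α j k • res B (i ≫ T.hom) (t'.frame j) := t.res_iso_hom t' T.hom i (hα k)
  refine (wedge_res B i _).symm.trans (Eq.trans ?_ (secMap_res η.hom i _))
  refine (congrArg (wedge B W) (funext h₁)).trans ?_
  refine Eq.trans ?_ (congrArg (secMap η.hom W) (wedge_res A i a))
  refine Eq.trans ?_ (congrArg (fun b => secMap η.hom W (wedge A W b)) (funext hα).symm)
  rw [wedge_sum, wedge_sum, map_smul, wedge_res, wedge_res, secMap_res, h]

/-! ### Polarized isomorphisms described on the two sheets. -/

section Sheets

variable {M N : ℕ} {Fp F : Type u} [Field Fp] [Field F] [Algebra Fp F]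
  {c : ComplexConjugation Fp F} {χ : (AlgebraicClosure F ≃ₐ[F] AlgebraicClosure F) →* (ZMod M)ˣ}
  {Sp : Scheme.{u}} {s : Sp ⟶ Spec (.of Fp)} {A B : EtSheaf M (baseF F s)}
  {P : Polarization c χ A} {Q : Polarization c χ B} {n : ℕ} {η : extPower n A ≅ extPower n B}

lemma sheetι_comp_map {Rp Rp' : Over Sp} (f : Rp' ⟶ Rp) {h : Rp.left ⟶ baseF F s}
    (w : h ≫ projPlus F s = Rp.hom) {h' : Rp'.left ⟶ baseF F s}
    (w' : h' ≫ projPlus F s = Rp'.hom) (k : Over.mk h' ⟶ Over.mk h) (hk : k.left = f.left) :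
    sheetι h' w' ≫ baseChange.map f = k ≫ sheetι h w := by
  ext1
  refine pullback.hom_ext ?_ ?_
  · have e : (baseChange.map f).left ≫ pullback.fst Rp.hom (projPlus F s) =
        pullback.fst Rp'.hom (projPlus F s) ≫ f.left := pullback.lift_fst _ _ _
    change ((sheetι h' w').left ≫ (baseChange.map f).left) ≫ pullback.fst Rp.hom (projPlus F s) =
      (k.left ≫ (sheetι h w).left) ≫ pullback.fst Rp.hom (projPlus F s)
    rw [Category.assoc, e, Category.assoc, sheetι_fst, ← Category.assoc, sheetι_fst, hk]
    exact (Category.id_comp _).trans (Category.comp_id _).symm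
  · have e : (baseChange.map f).left ≫ pullback.snd Rp.hom (projPlus F s) =
        pullback.snd Rp'.hom (projPlus F s) := Over.w (baseChange.map f)
    change ((sheetι h' w').left ≫ (baseChange.map f).left) ≫ pullback.snd Rp.hom (projPlus F s) =
      (k.left ≫ (sheetι h w).left) ≫ pullback.snd Rp.hom (projPlus F s)
    rw [Category.assoc, e, Category.assoc, sheetι_snd, sheetι_snd]
    exact (Over.w k).symm

lemma PolarizedIso.restrictMap_pull {Rp Rp' : Over Sp} (ξ : PolarizedIso P Q η Rp) (f : Rp' ⟶ Rp)
    {h : Rp.left ⟶ baseF F s} (w : h ≫ projPlus F s = Rp.hom) {h' : Rp'.left ⟶ baseF F s}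
    (w' : h' ≫ projPlus F s = Rp'.hom) (k : Over.mk h' ⟶ Over.mk h) (hk : k.left = f.left)
    (a : sec A (Over.mk h)) :
    restrictMap (ξ.pull f).iso.hom (Over.mk (sheetι h' w')) (res A k a) =
      res B k (restrictMap ξ.iso.hom (Over.mk (sheetι h w)) a) :=
  (restrictMap_mk_congr ξ.iso.hom (sheetι_comp_map f w w' k hk) (res A k a)).trans
    (restrictMap_comp_res ξ.iso.hom (Over.mk (sheetι h w)) k a)

/-- Over the image of `R⁺`, a morphism which identifies dual frames on a sheet and on its conjugate
preserves the pairing. -/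
lemma preservesPair_of_sheets {Rp : Over Sp} {h : Rp.left ⟶ baseF F s}
    (w : h ≫ projPlus F s = Rp.hom) (w' : (h ≫ conjBase s c) ≫ projPlus F s = Rp.hom)
    {tA : Triv A n (Over.mk h)} {tA' : Triv A n ((conj s c).obj (Over.mk h))}
    {tB : Triv B n (Over.mk h)} {tB' : Triv B n ((conj s c).obj (Over.mk h))}
    {q : LocallyConstant (geom (toF F (Over.mk h))) (ZMod M)} (hA : IsDual P tA tA' q)
    (hB : IsDual Q tB tB' q) {ξ : restrict A (baseChange.obj Rp) ⟶ restrict B (baseChange.obj Rp)}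
    (h₁ : pullHom (sheetι h w) ξ = (tA.iso tB).hom)
    (h₂ : pullHom (sheetι (h ≫ conjBase s c) w') ξ = (tA'.iso tB').hom) (W : Over (baseF F s)) :
    (∀ k : W ⟶ Over.mk h, PreservesPair P Q ξ (Over.mk (k ≫ sheetι h w))) ∧
      ∀ k : W ⟶ Over.mk (h ≫ conjBase s c),
        PreservesPair P Q ξ (Over.mk (k ≫ sheetι (h ≫ conjBase s c) w')) := by
  have e₁ {W : Over (baseF F s)} (k : W ⟶ Over.mk h) (a : sec A W) :
      restrictMap ξ (Over.mk (k ≫ sheetι h w)) a = restrictMap (tA.iso tB).hom (Over.mk k) a :=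
    congrArg (fun ζ => restrictMap ζ (Over.mk k) a) h₁
  have e₂ {W : Over (baseF F s)} (k : W ⟶ Over.mk (h ≫ conjBase s c)) (a : sec A W) :
      restrictMap ξ (Over.mk (k ≫ sheetι (h ≫ conjBase s c) w')) a =
        restrictMap (tA'.iso tB').hom (Over.mk k) a :=
    congrArg (fun ζ => restrictMap ζ (Over.mk k) a) h₂
  refine ⟨fun k a b => ?_, fun k a b => ?_⟩
  · have e : (conj s c).map (k ≫ sheetι h w) ≫ conjR c Rp =
        (conj s c).map k ≫ sheetι (h ≫ conjBase s c) w' := by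
      rw [Functor.map_comp, Category.assoc, conj_map_sheetι c h w w']
    have h₃ := (restrictMap_mk_congr ξ e b).trans (e₂ ((conj s c).map k) b)
    exact (congrArg₂ (fun y z => Q.pair W y z) (e₁ k a) h₃).trans (hA.pair_iso hB k a b)
  · let l : (conj s c).obj W ⟶ Over.mk h := (conj s c).map k ≫ conjConj c (Over.mk h)
    have e : (conj s c).map (k ≫ sheetι (h ≫ conjBase s c) w') ≫ conjR c Rp = l ≫ sheetι h w := by
      rw [Functor.map_comp, Category.assoc, conj_map_sheetι_conj c h w w', ← Category.assoc]
    have h₃ := (restrictMap_mk_congr ξ e b).trans (e₁ l b)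
    refine (congrArg₂ (fun y z => Q.pair W y z) (e₂ k a) h₃).trans ?_
    refine Polarization.pair_ext fun x => ?_
    refine (Q.eval_conj W x _ _).trans (Eq.trans ?_ (P.eval_conj W x a b).symm)
    have hl : conjConj c W ≫ k = (conj s c).map l := by
      ext1
      exact (Category.id_comp _).trans (Category.comp_id _).symm
    have h₄ := restrictMap_comp_res (tA'.iso tB').hom (Over.mk k) (conjConj c W) a
    have h₅ := h₄.symm.trans (restrictMap_mk_congr (tA'.iso tB').hom hl _)
    have h₆ := hA.pair_iso hB l b (res A (conjConj c W) a)
    refine (congrArg (Q.eval _ (geomConj c W x) _) h₅).trans ?_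
    exact congrArg (fun φ => φ.1 (geomConj c W x)) h₆

variable [NumberField Fp] [IsCyclotomicExtension {N} Fp F]

lemma exists_comp_eq_sheetι (hN : 2 < N)
    (hFp : Nonempty (NumberField.maximalRealSubfield (CyclotomicField N ℚ) →+* Fp)) {Rp : Over Sp}
    {h : Rp.left ⟶ baseF F s} (w : h ≫ projPlus F s = Rp.hom)
    (w' : (h ≫ conjBase s c) ≫ projPlus F s = Rp.hom) {T : Over (baseF F s)}
    (f : T ⟶ baseChange.obj Rp) (t : T.left) :
    ∃ (W : Over (baseF F s)) (j : W ⟶ T), Etale j.left ∧ t ∈ Set.range j.left ∧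
      ((∃ k, j ≫ f = k ≫ sheetι h w) ∨ ∃ k, j ≫ f = k ≫ sheetι (h ≫ conjBase s c) w') := by
  have : FiniteDimensional Fp F := IsCyclotomicExtension.finiteDimensional {N} Fp F
  rcases mem_range_sheetι c hN hFp h w w' (f.left t) with ht | ht
  · obtain ⟨W, j, k, hj, ht, e⟩ := exists_comp_eq_of_mem_range f _ (etale_sheetι h w) t ht
    exact ⟨W, j, hj, ht, .inl ⟨k, e⟩⟩
  · obtain ⟨W, j, k, hj, ht, e⟩ := exists_comp_eq_of_mem_range f _ (etale_sheetι _ w') t ht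
    exact ⟨W, j, hj, ht, .inr ⟨k, e⟩⟩

lemma hom_ext_of_sheets (hN : 2 < N)
    (hFp : Nonempty (NumberField.maximalRealSubfield (CyclotomicField N ℚ) →+* Fp)) {Rp : Over Sp}
    {h : Rp.left ⟶ baseF F s} (w : h ≫ projPlus F s = Rp.hom)
    (w' : (h ≫ conjBase s c) ≫ projPlus F s = Rp.hom)
    {ξ ξ' : restrict A (baseChange.obj Rp) ⟶ restrict B (baseChange.obj Rp)}
    (h₁ : pullHom (sheetι h w) ξ = pullHom (sheetι h w) ξ')
    (h₂ : pullHom (sheetι (h ≫ conjBase s c) w') ξ = pullHom (sheetι (h ≫ conjBase s c) w') ξ') :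
    ξ = ξ' := by
  refine sheaf_ext (isSheaf_presheafHom A B) (T := baseChange.obj Rp) fun z => ?_
  obtain ⟨W, j, hj, hz, ⟨k, e⟩ | ⟨k, e⟩⟩ := exists_comp_eq_sheetι hN hFp w w' (𝟙 _) z
  · refine ⟨W, j, hj, hz, ?_⟩
    rw [Category.comp_id] at e
    rw [e]
    exact congrArg (pullHom k) h₁
  · refine ⟨W, j, hj, hz, ?_⟩
    rw [Category.comp_id] at e
    rw [e]
    exact congrArg (pullHom k) h₂

lemma exists_hom_of_sheets (hN : 2 < N)
    (hFp : Nonempty (NumberField.maximalRealSubfield (CyclotomicField N ℚ) →+* Fp)) {Rp : Over Sp}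
    {h : Rp.left ⟶ baseF F s} (w : h ≫ projPlus F s = Rp.hom)
    (w' : (h ≫ conjBase s c) ≫ projPlus F s = Rp.hom)
    (ξ₁ : restrict A (Over.mk h) ⟶ restrict B (Over.mk h))
    (ξ₂ : restrict A (Over.mk (h ≫ conjBase s c)) ⟶ restrict B (Over.mk (h ≫ conjBase s c))) :
    ∃ ξ : restrict A (baseChange.obj Rp) ⟶ restrict B (baseChange.obj Rp),
      pullHom (sheetι h w) ξ = ξ₁ ∧ pullHom (sheetι (h ≫ conjBase s c) w') ξ = ξ₂ := by
  have : FiniteDimensional Fp F := IsCyclotomicExtension.finiteDimensional {N} Fp F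
  have : NeZero N := ⟨by omega⟩
  have hζ := IsCyclotomicExtension.zeta_spec N Fp F
  refine sheaf_glue_of_disjoint (isSheaf_presheafHom A B) (sheetι h w)
    (sheetι (h ≫ conjBase s c) w') (etale_sheetι h w) (etale_sheetι _ w')
    (mem_range_sheetι c hN hFp h w w') (fun {T} a b e => ?_) ξ₁ ξ₂
  have e₁ := congrArg (fun f => f.left ≫ pullback.fst Rp.hom (projPlus F s)) e
  have e₂ := congrArg (fun f => f.left ≫ pullback.snd Rp.hom (projPlus F s)) e
  simp only [Over.comp_left, Category.assoc, sheetι_fst, sheetι_snd] at e₁ e₂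
  have e₃ : a.left = b.left := (Category.comp_id _).symm.trans (e₁.trans (Category.comp_id _))
  -- A common point of the two sheets would give a map to `S₀` which is fixed by conjugation.
  refine isEmpty_of_comp_conjBase c hN hζ (a.left ≫ h) ?_
  rw [Category.assoc]
  exact ((congrArg (fun f => f ≫ h ≫ conjBase s c) e₃).trans e₂.symm)

/-- Polarized isomorphisms over `R⁺` are determined by their restriction to a sheet. -/
lemma PolarizedIso.ext_of_sheet (hN : 2 < N)
    (hFp : Nonempty (NumberField.maximalRealSubfield (CyclotomicField N ℚ) →+* Fp)) {Rp : Over Sp}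
    {h : Rp.left ⟶ baseF F s} (w : h ≫ projPlus F s = Rp.hom) (D : LocalData P Q η (Over.mk h))
    {ξ ξ' : PolarizedIso P Q η Rp}
    (hξ : ∀ k, restrictMap ξ.iso.hom (Over.mk (sheetι h w)) (D.tA.frame k) =
      restrictMap ξ'.iso.hom (Over.mk (sheetι h w)) (D.tA.frame k)) : ξ = ξ' := by
  have w' : (h ≫ conjBase s c) ≫ projPlus F s = Rp.hom := by
    rw [Category.assoc, conjBase_fst, w]
  have h₁ : pullHom (sheetι h w) ξ.iso.hom = pullHom (sheetι h w) ξ'.iso.hom := by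
    refine D.tA.hom_ext fun k => ?_
    have e := Category.id_comp (sheetι h w)
    exact (restrictMap_mk_congr ξ.iso.hom e _).trans
      ((hξ k).trans (restrictMap_mk_congr ξ'.iso.hom e _).symm)
  refine PolarizedIso.ext (Iso.ext (hom_ext_of_sheets hN hFp w w' h₁ (D.tA'.hom_ext fun k => ?_)))
  let b : sec A ((conj s c).obj (Over.mk h)) := D.tA'.frame k
  have e := Category.id_comp (sheetι (h ≫ conjBase s c) w')
  refine (restrictMap_mk_congr ξ.iso.hom e _).trans
      (Eq.trans ?_ (restrictMap_mk_congr ξ'.iso.hom e _).symm)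
  -- On the conjugate sheet an image is determined by its pairings with the frame of `B`. The frame
  -- vector is the image of some `a` from the first sheet, the same for `ξ` and `ξ'`, so both
  -- pairings equal the pairing of `a` and `b` in `A`.
  refine sub_eq_zero.1 (D.dualB.eq_zero D.isUnit_q fun x j => ?_)
  let a : sec A (Over.mk h) := restrictMap ξ.iso.inv (Over.mk (sheetι h w)) (D.tB.frame j)
  have ha : restrictMap ξ.iso.hom (Over.mk (sheetι h w)) a = D.tB.frame j :=
    congrArg (fun ζ => restrictMap ζ (Over.mk (sheetι h w)) (D.tB.frame j)) ξ.iso.inv_hom_id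
  have ha' : restrictMap ξ'.iso.hom (Over.mk (sheetι h w)) a = D.tB.frame j := by
    refine Eq.trans ?_ ha
    have := congrArg (fun ζ => restrictMap ζ (Over.mk (𝟙 (Over.mk h))) a) h₁
    have e := Category.id_comp (sheetι h w)
    exact (restrictMap_mk_congr ξ'.iso.hom e _).symm.trans
      (this.symm.trans (restrictMap_mk_congr ξ.iso.hom e _))
  have key (ζ : PolarizedIso P Q η Rp)
      (hζ : restrictMap ζ.iso.hom (Over.mk (sheetι h w)) a = D.tB.frame j) :
      Q.eval (Over.mk h) x (D.tB.frame j)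
        (restrictMap ζ.iso.hom (Over.mk (sheetι (h ≫ conjBase s c) w')) b) =
          P.eval (Over.mk h) x a b := by
    have h₂ := ζ.pair_eq (Over.mk (sheetι h w)) a b
    have h₃ := restrictMap_mk_congr ζ.iso.hom (conj_map_sheetι c h w w') b
    have h₄ := (congrArg₂ (fun y z => Q.pair (Over.mk h) y z) hζ h₃).symm.trans h₂
    exact congrArg (fun φ => φ.1 x) h₄
  refine (map_sub (Q.eval (Over.mk h) x (D.tB.frame j)) _ _).trans (sub_eq_zero.2 ?_)
  exact (key ξ ha).trans (key ξ' ha').symm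

/-- Over a sheet, every matrix of the right determinant gives a polarized isomorphism. -/
lemma exists_polarizedIso (hN : 2 < N)
    (hFp : Nonempty (NumberField.maximalRealSubfield (CyclotomicField N ℚ) →+* Fp)) {Rp : Over Sp}
    {h : Rp.left ⟶ baseF F s} (w : h ≫ projPlus F s = Rp.hom) (D : LocalData P Q η (Over.mk h))
    (g : (Matrix (Fin n) (Fin n) (ZMod M))ˣ)
    (hg : (g : Matrix (Fin n) (Fin n) (ZMod M)).det = D.r) :
    ∃ ξ : PolarizedIso P Q η Rp, ∀ k,
      restrictMap ξ.iso.hom (Over.mk (sheetι h w)) (D.tA.frame k) =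
        ∑ j, (g : Matrix (Fin n) (Fin n) (ZMod M)) j k • D.tB.frame j := by
  have w' : (h ≫ conjBase s c) ≫ projPlus F s = Rp.hom := by
    rw [Category.assoc, conjBase_fst, w]
  -- Duality forces the inverse transpose of `g` on the conjugate sheet. Its determinant is the
  -- inverse of `D.r`, which is the scalar of `η` there.
  let g' : (Matrix (Fin n) (Fin n) (ZMod M))ˣ :=
    ⟨(↑g⁻¹ : Matrix (Fin n) (Fin n) (ZMod M)).transpose,
      (g : Matrix (Fin n) (Fin n) (ZMod M)).transpose,
      by rw [← Matrix.transpose_mul, g.mul_inv, Matrix.transpose_one],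
      by rw [← Matrix.transpose_mul, g.inv_mul, Matrix.transpose_one]⟩
  have hgg' : (g : Matrix (Fin n) (Fin n) (ZMod M)).transpose * g' = 1 := g'.inv_mul
  have hg' : (g' : Matrix (Fin n) (Fin n) (ZMod M)).det = (D.r⁻¹ : (ZMod M)ˣ) := by
    have := congrArg Matrix.det hgg'
    rw [Matrix.det_mul, Matrix.det_transpose, hg, Matrix.det_one] at this
    exact (Units.inv_eq_of_mul_eq_one_right this).symm
  let tB := D.tB.change g
  let tB' := D.tB'.change g'
  have hB : IsDual Q tB tB' D.q := D.dualB.change hgg'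
  have hw : secMap η.hom (Over.mk h) (wedge A (Over.mk h) D.tA.frame) =
      wedge B (Over.mk h) tB.frame := by
    rw [D.wedge_eq, ← hg, ← wedge_sum]
    exact congrArg _ (funext fun k => (D.tB.frame_change g k).symm)
  have hw' : secMap η.hom ((conj s c).obj (Over.mk h))
      (wedge A ((conj s c).obj (Over.mk h)) D.tA'.frame) =
        wedge B ((conj s c).obj (Over.mk h)) tB'.frame := by
    rw [D.wedge_eq', ← hg', ← wedge_sum]
    exact congrArg _ (funext fun k => (D.tB'.frame_change g' k).symm)
  obtain ⟨ξ, h₁, h₂⟩ := exists_hom_of_sheets hN hFp w w' (D.tA.iso tB).hom (D.tA'.iso tB').hom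
  obtain ⟨ζ, h₃, h₄⟩ := exists_hom_of_sheets hN hFp w w' (D.tA.iso tB).inv (D.tA'.iso tB').inv
  have hξζ : ξ ≫ ζ = 𝟙 _ := by
    refine hom_ext_of_sheets hN hFp w w' ?_ ?_
    · change pullHom (sheetι h w) ξ ≫ pullHom (sheetι h w) ζ = 𝟙 _
      rw [h₁, h₃, Iso.hom_inv_id]
    · change pullHom (sheetι _ w') ξ ≫ pullHom (sheetι _ w') ζ = 𝟙 _
      rw [h₂, h₄]
      exact (D.tA'.iso tB').hom_inv_id
  have hζξ : ζ ≫ ξ = 𝟙 _ := by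
    refine hom_ext_of_sheets hN hFp w w' ?_ ?_
    · change pullHom (sheetι h w) ζ ≫ pullHom (sheetι h w) ξ = 𝟙 _
      rw [h₁, h₃, Iso.inv_hom_id]
    · change pullHom (sheetι _ w') ζ ≫ pullHom (sheetι _ w') ξ = 𝟙 _
      rw [h₂, h₄]
      exact (D.tA'.iso tB').inv_hom_id
  refine ⟨⟨⟨ξ, ζ, hξζ, hζξ⟩, fun T => ?_, fun T => ?_⟩, fun k => ?_⟩
  · refine PreservesPair.of_local (P := P) (Q := Q) (ξ := ξ) (T := T) fun t => ?_
    obtain ⟨W, j, -, ht, ⟨k, e⟩ | ⟨k, e⟩⟩ := exists_comp_eq_sheetι hN hFp w w' T.hom t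
    · refine ⟨W, j, ht, ?_⟩
      rw [e]
      exact (preservesPair_of_sheets w w' D.dualA hB h₁ h₂ W).1 k
    · refine ⟨W, j, ht, ?_⟩
      rw [e]
      exact (preservesPair_of_sheets w w' D.dualA hB h₁ h₂ W).2 k
  · refine LiftsWedge.of_local (η := η) (ξ := ξ) (T := T) fun t => ?_
    obtain ⟨W, j, hj, ht, ⟨k, e⟩ | ⟨k, e⟩⟩ := exists_comp_eq_sheetι hN hFp w w' T.hom t
    · refine ⟨W, j, hj, ht, ?_⟩
      refine LiftsWedge.of_pullHom (sheetι h w) e.symm ?_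
      rw [h₁]
      exact D.tA.liftsWedge_iso tB hw _
    · refine ⟨W, j, hj, ht, ?_⟩
      refine LiftsWedge.of_pullHom (sheetι _ w') e.symm ?_
      rw [h₂]
      exact D.tA'.liftsWedge_iso tB' hw' _
  · have e := Category.id_comp (sheetι h w)
    refine (restrictMap_mk_congr ξ e.symm _).trans ?_
    refine (congrArg (fun ζ => restrictMap ζ (Over.mk (𝟙 (Over.mk h))) (D.tA.frame k)) h₁).trans ?_
    rw [← D.tB.frame_change]
    have := D.tA.iso_hom_frame tB (𝟙 _) k
    rw [res_id, res_id] at this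
    exact this

end Sheets

/-! ### Local constancy of the functor and the theorem. -/

section Main

variable {M N : ℕ} {Fp F : Type u} [Field Fp] [Field F] [Algebra Fp F]
  {c : ComplexConjugation Fp F} {χ : (AlgebraicClosure F ≃ₐ[F] AlgebraicClosure F) →* (ZMod M)ˣ}
  {Sp : Scheme.{u}} {s : Sp ⟶ Spec (.of Fp)} {A B : EtSheaf M (baseF F s)}
  {P : Polarization c χ A} {Q : Polarization c χ B} {n : ℕ} {η : extPower n A ≅ extPower n B}

/-- The matrix of a polarized isomorphism has the determinant given by `η`. -/
lemma LocalData.det_eq {Rp : Over Sp} {h : Rp.left ⟶ baseF F s} (w : h ≫ projPlus F s = Rp.hom)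
    {V : Over (baseF F s)} (D : LocalData P Q η V) (f : Over.mk h ⟶ V)
    (ξ : PolarizedIso P Q η Rp) {W : Over (baseF F s)} (i : W ⟶ Over.mk h) (x : W.left)
    {α : Matrix (Fin n) (Fin n) (ZMod M)}
    (hα : ∀ k, res B i (restrictMap ξ.iso.hom (Over.mk (sheetι h w)) (res A f (D.tA.frame k))) =
      ∑ j, α j k • res B (i ≫ f) (D.tB.frame j)) : α.det = D.r := by
  refine D.tB.eq_of_smul_wedge_eq (i ≫ f) x ?_
  rw [← wedge_sum]
  refine (congrArg (wedge B W) (funext hα)).symm.trans ?_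
  refine (wedge_res B i _).trans ?_
  refine (congrArg (res (extPower n B) i) (ξ.wedge_eq (Over.mk (sheetι h w)) _)).trans ?_
  refine (congrArg (fun y => res (extPower n B) i (secMap η.hom (Over.mk h) y))
    (wedge_res A f _)).trans ?_
  rw [secMap_res, D.wedge_eq, map_smul, map_smul, res_res, ← wedge_res]

variable [NumberField Fp] [IsCyclotomicExtension {N} Fp F]

/-- Over a scheme which carries compatible trivialisations, the functor of polarized isomorphisms
is constant. -/
lemma exists_isConstantOn [NeZero M] (hN : 2 < N)
    (hFp : Nonempty (NumberField.maximalRealSubfield (CyclotomicField N ℚ) →+* Fp))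
    (hn : 0 < n) {X : Scheme.{u}} (h : X ⟶ baseF F s) (D : LocalData P Q η (Over.mk h)) :
    ∃ (G : Type) (_ : Finite G) (_ : Nonempty G)
      (ξ : G → (isomFunctor P Q η).obj (op (Over.mk (h ≫ projPlus F s)))),
        IsConstantOn (isomFunctor P Q η) ξ := by
  let U : Over Sp := Over.mk (h ≫ projPlus F s)
  -- The constant value is the set of matrices of determinant `D.r`, a coset of the special linear
  -- group.
  let G : Type := {g : (Matrix (Fin n) (Fin n) (ZMod M))ˣ //
    (g : Matrix (Fin n) (Fin n) (ZMod M)).det = D.r}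
  have unit {α : Matrix (Fin n) (Fin n) (ZMod M)} (hα : α.det = D.r) : IsUnit α :=
    (Matrix.isUnit_iff_isUnit_det α).2 (hα ▸ D.r.isUnit)
  have hG : Nonempty G := by
    obtain ⟨α, hα⟩ := exists_det_eq hn (D.r : ZMod M)
    exact ⟨⟨(unit hα).unit, hα⟩⟩
  choose ξ hξ using fun g : G => exists_polarizedIso (Rp := U) (h := h) hN hFp rfl D g.1 g.2
  have hξ' {T : Over Sp} (f : T ⟶ U) {h' : T.left ⟶ baseF F s} (w' : h' ≫ projPlus F s = T.hom)
      (k : Over.mk h' ⟶ Over.mk h) (hk : k.left = f.left) (g : G) (l : Fin n) :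
      restrictMap ((ξ g).pull f).iso.hom (Over.mk (sheetι h' w')) (res A k (D.tA.frame l)) =
        ∑ j, (g.1 : Matrix (Fin n) (Fin n) (ZMod M)) j l • res B k (D.tB.frame j) := by
    refine ((ξ g).restrictMap_pull f rfl w' k hk (D.tA.frame l)).trans ?_
    rw [hξ, map_sum]
    simp only [map_smul]
  refine ⟨G, inferInstance, hG, ξ, fun {T} f (a : PolarizedIso P Q η T) t => ?_,
    fun {T} f t g g' e => ?_⟩
  · let hT : T.left ⟶ baseF F s := f.left ≫ h
    have wT : hT ≫ projPlus F s = T.hom := (Category.assoc _ _ _).trans (Over.w f)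
    let f₁ : Over.mk hT ⟶ Over.mk h := Over.homMk f.left
    -- Near `t` the given isomorphism has a constant matrix on the sheet; its determinant is imposed
    -- by `η`, and the sheet determines the isomorphism.
    obtain ⟨W, i, hi, ⟨x, rfl⟩, α, hα⟩ := D.tB.exists_res_eq f₁ (fun k =>
      restrictMap a.iso.hom (Over.mk (sheetι hT wT)) (res A f₁ (D.tA.frame k))) t
    have hdet := D.det_eq wT f₁ a i x hα
    let W' : Over Sp := Over.mk (i.left ≫ T.hom)
    let i' : W' ⟶ T := Over.homMk i.left
    have wW : W.hom ≫ projPlus F s = W'.hom := by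
      rw [← Over.w i, Category.assoc]
      exact congrArg (i.left ≫ ·) wT
    refine ⟨W', i', hi, ⟨x, rfl⟩, ⟨(unit hdet).unit, hdet⟩, ?_⟩
    refine PolarizedIso.ext_of_sheet (ξ := a.pull i') (ξ' := (ξ _).pull (i' ≫ f)) hN hFp wW
      (D.restrict (i ≫ f₁)) fun k => ?_
    have e : (D.tA.restrict (i ≫ f₁)).frame k = res A (i ≫ f₁) (D.tA.frame k) :=
      (D.tA.res_frame (i ≫ f₁) k).symm
    have key (ζ : PolarizedIso P Q η W') := congrArg
      (restrictMap ζ.iso.hom (Over.mk (sheetι W.hom wW))) e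
    refine (key _).trans (Eq.trans ?_ (key _).symm)
    refine Eq.trans ?_ (hξ' (i' ≫ f) wW (i ≫ f₁) rfl _ k).symm
    refine Eq.trans ?_ (hα k)
    refine Eq.trans ?_ (a.restrictMap_pull i' wT wW i rfl (res A f₁ (D.tA.frame k)))
    exact congrArg _ (res_res A i f₁ _).symm
  · let hT : T.left ⟶ baseF F s := f.left ≫ h
    have wT : hT ≫ projPlus F s = T.hom := (Category.assoc _ _ _).trans (Over.w f)
    let f₁ : Over.mk hT ⟶ Over.mk h := Over.homMk f.left
    refine Subtype.ext (Units.ext ?_)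
    ext j k
    have e' : (ξ g).pull f = (ξ g').pull f := e
    have h₁ := (hξ' f wT f₁ rfl g k).symm.trans
      ((congrArg (fun ζ : PolarizedIso P Q η T => restrictMap ζ.iso.hom _ _) e').trans
        (hξ' f wT f₁ rfl g' k))
    -- The coordinates at the point `t` recover the columns of the matrix.
    have h₂ := congrArg (D.tB.coord f₁ t) h₁
    rw [D.tB.coord_sum, D.tB.coord_sum] at h₂
    exact congrFun h₂ j

end Main

end GaloisDescent

open GaloisDescent
theorem mainTheorem10 (N : ℕ) (hN : 2 < N) (M : ℕ) [NeZero M] (n : ℕ) (hn : 0 < n)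
    (Fp F : Type u) [Field Fp] [NumberField Fp] [NumberField.IsTotallyReal Fp]
    (hFp : Nonempty (NumberField.maximalRealSubfield (CyclotomicField N ℚ) →+* Fp))
    [Field F] [Algebra Fp F] [IsCyclotomicExtension {N} Fp F]
    (c : ComplexConjugation Fp F)
    (χ : (AlgebraicClosure F ≃ₐ[F] AlgebraicClosure F) →* (ZMod M)ˣ) (hχ : Continuous χ)
    (Sp : Scheme.{u}) (s : Sp ⟶ Spec (.of Fp))
    (A B : EtSheaf M (baseF F s)) (hA : IsLisse A n) (hB : IsLisse B n)
    (P : Polarization c χ A) (Q : Polarization c χ B)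
    (η : extPower n A ≅ extPower n B) (hη : CompatibleDet P Q η) :
    ∃ X : Over Sp, Nonempty ((isomFunctor P Q η).RepresentableBy X) ∧
      IsFinite X.hom ∧ Etale X.hom ∧ Surjective X.hom := by
  have : FiniteDimensional Fp F := IsCyclotomicExtension.finiteDimensional {N} Fp F
  have : CharZero F := charZero_of_injective_algebraMap (algebraMap Fp F).injective
  have h₁ : Etale (projPlus F s) := etale_projPlus
  have h₂ : Surjective (Spec.map (CommRingCat.ofHom (algebraMap Fp F))) :=
    ⟨fun _ => ⟨(⊥ : PrimeSpectrum F), Subsingleton.elim (α := PrimeSpectrum Fp) _ _⟩⟩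
  refine exists_representableBy_of_isConstantOn isSheaf_isomFunctor fun x => ?_
  -- As `S₀ ⟶ S₀⁺` is étale and surjective, étale neighbourhoods of points of `S₀` serve as étale
  -- neighbourhoods over `S₀⁺`, and they come with the lift to `S₀` which splits the double cover.
  obtain ⟨y, rfl⟩ := (projPlus F s).surjective x
  obtain ⟨W, i, hi, ⟨v, hv⟩, ⟨D⟩⟩ :=
    exists_localData (P := P) (Q := Q) hn hχ hA hB hη (Over.mk (𝟙 _)) y
  have e : i.left = W.hom := (Category.comp_id _).symm.trans (Over.w i)
  have h₃ : Etale W.hom := e ▸ hi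
  refine ⟨Over.mk (W.hom ≫ projPlus F s), inferInstanceAs (Etale (W.hom ≫ projPlus F s)),
    ⟨v, ?_⟩, exists_isConstantOn hN hFp hn W.hom D⟩
  refine (Scheme.Hom.comp_apply W.hom (projPlus F s) v).trans (congrArg (projPlus F s) ?_)
  rw [← e, hv]
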